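/- **Theorem (Characterization of $k$-fold unitary endomorphisms, unitary case).** Let $d,k\ge 0$ be integers, $V=\mathbb C^d$, and let $V^{\otimes 2k}=V^{\otimes k}\otimes V^{\otimes k}$, with standard basis $|i_1,\dots,i_k,j_1,\dots,j_k\rangle$. For $\sigma\in S_k$ let $\hat S_\sigma|i_1,\dots,i_k\rangle=|i_{\sigma(1)},\dots,i_{\sigma(k)}\rangle$ on $V^{\otimes k}$, and let $\hat T|i,j\rangle=|j,i\rangle$ be the half-swap on $V^{\otimes 2k}$. Call a complex $d^{2k}\times d^{2k}$ matrix $\Phi$ *invariant* if $$[U^{\otimes 2k},\Phi]=[\hat S_\sigma\otimes\hat S_\sigma,\Phi]=[\hat T,\Phi]=0\qquad\text{for all }U\in U(d),\ \sigma\in S_k .$$ *Notation.* For a partition $\lambda\vdash n$, the irreducible representation of $S_n$ labelled by $\lambda$ (the Specht module, the left ideal of $\mathbb C[S_n]$ generated by the Young symmetrizer of $\lambda$) is also denoted $\lambda$, and $d'_\lambda$ is its dimension. $V_\lambda$ is the representation of $U(d)$ labelled by $\lambda$ (the image of the Young symmetrizer on $V^{\otimes n}$), and $d_\lambda=\dim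 V_\lambda$. Write $\lambda\vdash(n,d)$ if $\lambda\vdash n$ has at most $d$ parts. For $\mu\vdash 2k$ and $\lambda,\lambda',\mu'\vdash k$ put $$B^\mu_{\lambda\lambda'}=\dim\operatorname{Hom}_{S_k\times S_k}(\lambda\boxtimes\lambda',\operatorname{Res}\mu),\qquad c^{\mu'}_{\lambda\lambda'}=\dim\operatorname{Hom}_{S_k}(\mu',\lambda\otimes\lambda').$$ For $\varepsilon\in\{\pm1\}$ let $B^{\mu,\varepsilon}_{\lambda}$ be the dimension of the $\varepsilon$-eigenspace of the involution $f\mapsto \tau\circ f\circ\mathrm{swap}$ on $\operatorname{Hom}_{S_k\times S_k}(\lambda\boxtimes\lambda,\operatorname{Res}\mu)$, where $\tau\in S_{2k}$ exchanges the first $k$ with the last $k$ letters and $\mathrm{swap}$ exchanges the tensor factors, and let $c^{\mu',\varepsilon}_\lambda$ be the dimension of the $\varepsilon$-eigenspace of $f\mapsto\mathrm{swap}\circ f$ on $\operatorname{Hom}_{S_k}(\mu',\lambda\otimes\lambda)$. For $\mu\vdash(2k,d)$, $\mu'\vdash k$, $s\in\{\pm1\}$ define $$C^k_{\mu\mu's}=\tfrac12\sum_{\substack{\lambda,\lambda'\vdash(k,d)\\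 \lambda\ne\lambda'}}B^\mu_{\lambda\lambda'}\,c^{\mu'}_{\lambda\lambda'}+\sum_{\lambda\vdash(k,d)}\ \sum_{\varepsilon=\pm1}B^{\mu,\varepsilon}_\lambda\,c^{\mu',s\varepsilon}_\lambda .$$ *Claim.* For all $\mu\vdash(2k,d)$ and $\mu'\vdash k$, $$\sum_{s=\pm1}C^k_{\mu\mu's}=\sum_{\lambda,\lambda'\vdash(k,d)}B^\mu_{\lambda\lambda'}\,c^{\mu'}_{\lambda\lambda'} .$$ Moreover there are unitary matrix forms $\pi_\mu$ of the representations $V_\mu$ of $U(d)$ and $\rho_{\mu'}$ of the representations $\mu'$ of $S_k$, an identification of the standard basis of $\bigoplus_{\mu\vdash(2k,d)}\bigoplus_{\mu'\vdash k}\bigoplus_{s=\pm1}\mathbb C^{C^k_{\mu\mu's}}\otimes\mathbb C^{d_\mu}\otimes\mathbb C^{d'_{\mu'}}$ with that of $V^{\otimes2k}$, and a fixed unitary matrix $U\in U(d^{2k})$ such that, with all direct sums over these $\mu,\mu',s$: 1. $U$ decomposes the action of $U(d)\times S_k\times\mathbb Z_2$: for all $g\in U(d)$ and $\sigma\in S_k$,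 $$g^{\otimes 2k}=U\Big[\bigoplus\mathbb I\otimes\pi_\mu(g)\otimes\mathbb I\Big]U^\dagger,\quad \hat S_{\sigma^{-1}}\otimes\hat S_{\sigma^{-1}}=U\Big[\bigoplus\mathbb I\otimes\mathbb I\otimes\rho_{\mu'}(\sigma)\Big]U^\dagger,\quad \hat T=U\Big[\bigoplus s\,\mathbb I\otimes\mathbb I\otimes\mathbb I\Big]U^\dagger .$$ 2. For every invariant positive definite Hermitian matrix $\Phi$ there is exactly one family of positive definite Hermitian matrices $M_{\mu\mu's}$, of size $C^k_{\mu\mu's}\times C^k_{\mu\mu's}$, with $$\Phi=U\Big[\bigoplus_{\mu,\mu'}\bigoplus_{s=\pm1}M_{\mu\mu's}\otimes\mathbb I_{d_\mu}\otimes\mathbb I_{d'_{\mu'}}\Big]U^\dagger .$$ 3. Conversely, for every family of positive definite Hermitian matrices $M_{\mu\mu's}$ of these sizes, the right-hand side is an invariant positive definite Hermitian matrix. -/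

import Mathlib

open scoped Matrix Kronecker ComplexOrder TensorProduct

noncomputable section

/-! ### Partitions, Young symmetrizers and Specht modules -/

/-- Number of cells of the diagram with given row lengths. -/
theorem card_cellsOfRowLens (w : List ℕ) : (YoungDiagram.cellsOfRowLens w).card = w.sum := by
  induction w with
  | nil => simp [YoungDiagram.cellsOfRowLens]
  | cons a w ih =>
    rw [YoungDiagram.cellsOfRowLens, Finset.card_union_of_disjoint]
    · simp [ih]
    · rw [Finset.disjoint_left]
      rintro ⟨x, y⟩ h1 h2
      simp only [Finset.mem_product, Finset.mem_singleton, Finset.mem_map] at h1 h2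
      obtain ⟨c, -, hc⟩ := h2
      have := congrArg Prod.fst hc
      simp at this
      omega

/-- The Young diagram of a partition: its rows, from top to bottom, have the parts of the
partition, in weakly decreasing order, as lengths. -/
def partitionDiagram {n : ℕ} (p : n.Partition) : YoungDiagram :=
  YoungDiagram.ofRowLens (p.parts.sort (· ≥ ·)) (Multiset.pairwise_sort p.parts (· ≥ ·)).sortedGE

theorem card_partitionDiagram {n : ℕ} (p : n.Partition) :
    Fintype.card (partitionDiagram p).cells = n := by
  rw [Fintype.card_coe]
  change (YoungDiagram.cellsOfRowLens (p.parts.sort (· ≥ ·))).card = n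
  rw [card_cellsOfRowLens, ← Multiset.sum_coe, Multiset.sort_eq, p.parts_sum]

/-- A tableau of shape `p`, fixed once and for all: the letters `0, …, n - 1` are placed
bijectively in the cells of the diagram of `p`. -/
def tableau {n : ℕ} (p : n.Partition) : Fin n ≃ (partitionDiagram p).cells :=
  (Fintype.equivFinOfCardEq (card_partitionDiagram p)).symm

/-- The row of the tableau in which the letter `i` stands. -/
def rowOf {n : ℕ} (p : n.Partition) (i : Fin n) : ℕ := (tableau p i).1.1

/-- The column of the tableau in which the letter `i` stands. -/
def colOf {n : ℕ} (p : n.Partition) (i : Fin n) : ℕ := (tableau p i).1.2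

/-- The sum of all permutations that preserve every row of the tableau. -/
def rowSymmetrizer {n : ℕ} (p : n.Partition) : MonoidAlgebra ℂ (Equiv.Perm (Fin n)) :=
  ∑ σ : Equiv.Perm (Fin n) with ∀ i, rowOf p (σ i) = rowOf p i, MonoidAlgebra.of ℂ _ σ

/-- The signed sum of all permutations that preserve every column of the tableau. -/
def colAntisymmetrizer {n : ℕ} (p : n.Partition) : MonoidAlgebra ℂ (Equiv.Perm (Fin n)) :=
  ∑ σ : Equiv.Perm (Fin n) with ∀ i, colOf p (σ i) = colOf p i,
    ((Equiv.Perm.sign σ : ℤ) : ℂ) • MonoidAlgebra.of ℂ _ σ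

/-- The Young symmetrizer of a partition. -/
def youngSymmetrizer {n : ℕ} (p : n.Partition) : MonoidAlgebra ℂ (Equiv.Perm (Fin n)) :=
  rowSymmetrizer p * colAntisymmetrizer p

/-- The Specht module of a partition `p` of `n` (the irreducible representation of `S_n`
labelled by `p`): the left ideal of `ℂ[S_n]` generated by the Young symmetrizer. -/
def Specht {n : ℕ} (p : n.Partition) : Type :=
  ↥(Ideal.span {youngSymmetrizer p} : Ideal (MonoidAlgebra ℂ (Equiv.Perm (Fin n))))

instance {n : ℕ} (p : n.Partition) : AddCommGroup (Specht p) :=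
  inferInstanceAs (AddCommGroup
    ↥(Ideal.span {youngSymmetrizer p} : Ideal (MonoidAlgebra ℂ (Equiv.Perm (Fin n)))))

instance {n : ℕ} (p : n.Partition) : Module (MonoidAlgebra ℂ (Equiv.Perm (Fin n))) (Specht p) :=
  inferInstanceAs (Module _
    ↥(Ideal.span {youngSymmetrizer p} : Ideal (MonoidAlgebra ℂ (Equiv.Perm (Fin n)))))

instance {n : ℕ} (p : n.Partition) : Module ℂ (Specht p) :=
  inferInstanceAs (Module ℂ
    ↥(Ideal.span {youngSymmetrizer p} : Ideal (MonoidAlgebra ℂ (Equiv.Perm (Fin n)))))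

instance {n : ℕ} (p : n.Partition) :
    IsScalarTower ℂ (MonoidAlgebra ℂ (Equiv.Perm (Fin n))) (Specht p) :=
  inferInstanceAs (IsScalarTower ℂ (MonoidAlgebra ℂ (Equiv.Perm (Fin n)))
    ↥(Ideal.span {youngSymmetrizer p} : Ideal (MonoidAlgebra ℂ (Equiv.Perm (Fin n)))))

/-- The action of `S_n` on the Specht module by left multiplication. -/
def spechtRep {n : ℕ} (p : n.Partition) :
    Representation ℂ (Equiv.Perm (Fin n)) (Specht p) :=
  Representation.ofModule' (Specht p)

/-- `d'_p`, the dimension of the Specht module. -/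
def spechtDim {n : ℕ} (p : n.Partition) : ℕ := Module.finrank ℂ (Specht p)

/-! ### Tensor powers of `ℂ^d` -/

/-- The `n`-th tensor power `A ⊗ ⋯ ⊗ A` of a matrix, as a matrix indexed by multi-indices. -/
def tensorPow {d : ℕ} (n : ℕ) (A : Matrix (Fin d) (Fin d) ℂ) :
    Matrix (Fin n → Fin d) (Fin n → Fin d) ℂ :=
  Matrix.of fun i j => ∏ a, A (i a) (j a)

/-- The permutation operator `S_σ |j_1, …, j_n⟩ = |j_{σ(1)}, …, j_{σ(n)}⟩`. -/
def permOp {n : ℕ} (d : ℕ) (σ : Equiv.Perm (Fin n)) :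
    Matrix (Fin n → Fin d) (Fin n → Fin d) ℂ :=
  Matrix.of fun i j => if i = j ∘ σ then 1 else 0

theorem tensorPow_one {d : ℕ} (n : ℕ) : tensorPow n (1 : Matrix (Fin d) (Fin d) ℂ) = 1 := by
  ext i j
  simp only [tensorPow, Matrix.of_apply, Matrix.one_apply]
  rw [Finset.prod_ite_zero]
  simp [funext_iff]

theorem tensorPow_mul {d : ℕ} (n : ℕ) (A B : Matrix (Fin d) (Fin d) ℂ) :
    tensorPow n (A * B) = tensorPow n A * tensorPow n B := by
  ext i j
  simp only [tensorPow, Matrix.of_apply, Matrix.mul_apply, ← Finset.prod_mul_distrib]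
  rw [Finset.prod_univ_sum]
  simp

/-- The left action of `S_n` on `(ℂ^d)^{⊗n}` by permutation of the tensor factors:
`σ` acts by the operator `S_{σ⁻¹}`. -/
def tensorPermRep (n d : ℕ) :
    Representation ℂ (Equiv.Perm (Fin n)) ((Fin n → Fin d) → ℂ) where
  toFun σ := LinearMap.funLeft ℂ ℂ (fun i : Fin n → Fin d => i ∘ σ)
  map_one' := rfl
  map_mul' _ _ := rfl

theorem tensorPermRep_apply {n d : ℕ} (σ : Equiv.Perm (Fin n)) (w : (Fin n → Fin d) → ℂ) :
    tensorPermRep n d σ w = permOp d σ⁻¹ *ᵥ w := by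
  ext i
  simp only [Matrix.mulVec, dotProduct, permOp, Matrix.of_apply, ite_mul, one_mul, zero_mul]
  rw [Finset.sum_eq_single (i ∘ σ)]
  · rw [if_pos]
    · rfl
    · ext a; simp
  · intro j _ hj
    rw [if_neg]
    rintro rfl
    exact hj (by ext a; simp)
  · simp

/-- The action of `U(d)` on `(ℂ^d)^{⊗n}` by tensor powers. -/
def tensorUnitaryRep (n d : ℕ) :
    Representation ℂ (Matrix.unitaryGroup (Fin d) ℂ) ((Fin n → Fin d) → ℂ) where
  toFun g := (tensorPow n (g : Matrix (Fin d) (Fin d) ℂ)).mulVecLin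
  map_one' := by simp [tensorPow_one, Module.End.one_eq_id]
  map_mul' g h := by simp [tensorPow_mul, Matrix.mulVecLin_mul, Module.End.mul_eq_comp]

theorem commute_tensorPermRep {n d : ℕ} (σ : Equiv.Perm (Fin n))
    (g : Matrix.unitaryGroup (Fin d) ℂ) :
    Commute (tensorPermRep n d σ) (tensorUnitaryRep n d g) := by
  refine LinearMap.ext fun w => ?_
  ext i
  change ∑ j, (∏ a, (g : Matrix (Fin d) (Fin d) ℂ) ((i ∘ σ) a) (j a)) * w j =
    ∑ j, (∏ a, (g : Matrix (Fin d) (Fin d) ℂ) (i a) (j a)) * w (j ∘ σ)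
  refine (Fintype.sum_equiv (σ.arrowCongr (Equiv.refl (Fin d))) _ _ fun j => ?_)
  have h : ((σ.arrowCongr (Equiv.refl (Fin d))) j) ∘ σ = j := by ext a; simp
  rw [h]
  congr 1
  rw [← Equiv.prod_comp σ (fun a => (g : Matrix (Fin d) (Fin d) ℂ) (i a)
    ((σ.arrowCongr (Equiv.refl (Fin d))) j a))]
  simp

theorem commute_asAlgebraHom {n d : ℕ} (x : MonoidAlgebra ℂ (Equiv.Perm (Fin n)))
    (g : Matrix.unitaryGroup (Fin d) ℂ) :
    Commute ((tensorPermRep n d).asAlgebraHom x) (tensorUnitaryRep n d g) := by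
  induction x using MonoidAlgebra.induction_on with
  | of σ => simpa using commute_tensorPermRep σ g
  | add x y hx hy => rw [map_add]; exact hx.add_left hy
  | smul r x hx => rw [map_smul]; exact hx.smul_left r

/-- The representation `V_p` of `U(d)` labelled by a partition `p` of `n`, as a
subrepresentation of `(ℂ^d)^{⊗n}`: the image of the Young symmetrizer of `p`.
It is irreducible when `p` has at most `d` parts, and zero otherwise. -/
def weylSub {n : ℕ} (d : ℕ) (p : n.Partition) : Subrepresentation (tensorUnitaryRep n d) where
  toSubmodule := LinearMap.range ((tensorPermRep n d).asAlgebraHom (youngSymmetrizer p))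
  apply_mem_toSubmodule g := by
    rintro _ ⟨w, rfl⟩
    exact ⟨tensorUnitaryRep n d g w,
      LinearMap.congr_fun (commute_asAlgebraHom (youngSymmetrizer p) g).eq w⟩

/-- The underlying space of `V_p`. -/
abbrev Weyl {n : ℕ} (d : ℕ) (p : n.Partition) : Type := ↥(weylSub d p).toSubmodule

/-- The action of `U(d)` on `V_p`. -/
def weylRep {n : ℕ} (d : ℕ) (p : n.Partition) :
    Representation ℂ (Matrix.unitaryGroup (Fin d) ℂ) (Weyl d p) :=
  (weylSub d p).toRepresentation

/-- `d_p = dim V_p`. -/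
def weylDim {n : ℕ} (d : ℕ) (p : n.Partition) : ℕ := Module.finrank ℂ (Weyl d p)

/-! ### Branching coefficients, tensor product coefficients, block sizes -/

/-- Partitions of `n` with at most `d` parts. -/
abbrev BoundedPartition (n d : ℕ) : Type := {p : n.Partition // Multiset.card p.parts ≤ d}

/-- The inclusion `S_k × S_k ⊆ S_{2k}` (first `k` letters, last `k` letters). -/
def youngInclusion (k : ℕ) :
    Equiv.Perm (Fin k) × Equiv.Perm (Fin k) →* Equiv.Perm (Fin (k + k)) :=
  (finSumFinEquiv.permCongrHom : Equiv.Perm (Fin k ⊕ Fin k) ≃* _).toMonoidHom.comp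
    (Equiv.Perm.sumCongrHom (Fin k) (Fin k))

/-- The permutation in `S_{2k}` that exchanges the first `k` letters with the last `k` letters. -/
def blockSwap (k : ℕ) : Equiv.Perm (Fin (k + k)) := finAddFlip

/-- The external tensor product of two Specht modules, a representation of `S_k × S_k`. -/
def spechtExternal {k : ℕ} (p q : k.Partition) :
    Representation ℂ (Equiv.Perm (Fin k) × Equiv.Perm (Fin k)) (Specht p ⊗[ℂ] Specht q) :=
  Representation.tprod ((spechtRep p).comp (MonoidHom.fst _ _))
    ((spechtRep q).comp (MonoidHom.snd _ _))

/-- The restriction to `S_k × S_k` of a Specht module of `S_{2k}`. -/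
def spechtRestrict {k : ℕ} (μ : (k + k).Partition) :
    Representation ℂ (Equiv.Perm (Fin k) × Equiv.Perm (Fin k)) (Specht μ) :=
  (spechtRep μ).comp (youngInclusion k)

/-- The branching space `Hom_{S_k × S_k}(p ⊠ q, Res μ)`. -/
abbrev BranchingSpace {k : ℕ} (μ : (k + k).Partition) (p q : k.Partition) : Type :=
  Representation.IntertwiningMap (spechtExternal p q) (spechtRestrict μ)

/-- The branching coefficient `B^μ_{pq}`: the multiplicity of `p ⊠ q` in the restriction of
`μ` to `S_k × S_k`. -/
def branchingCoeff {k : ℕ} (μ : (k + k).Partition) (p q : k.Partition) : ℕ :=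
  Module.finrank ℂ (BranchingSpace μ p q)

/-- The part of `Hom_{S_k × S_k}(p ⊠ p, Res μ)` of sign `ε` under the involution
`f ↦ (block swap) ∘ f ∘ (exchange of the two tensor factors)`. -/
def signedBranchingSpace {k : ℕ} (μ : (k + k).Partition) (p : k.Partition) (ε : ℤˣ) :
    Submodule ℂ (BranchingSpace μ p p) where
  carrier := {f | ∀ x : Specht p ⊗[ℂ] Specht p,
    spechtRep μ (blockSwap k) (f (TensorProduct.comm ℂ _ _ x)) = ((ε : ℤ) : ℂ) • f x}
  zero_mem' x := by simp
  add_mem' {f g} hf hg x := by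
    have := congrArg₂ (· + ·) (hf x) (hg x)
    simpa using this
  smul_mem' c f hf x := by
    have := congrArg (c • ·) (hf x)
    simpa [smul_comm c] using this

/-- The dimension `B^{μ,ε}_p` of the part of sign `ε` of the branching space for `p ⊠ p`. -/
def signedBranchingCoeff {k : ℕ} (μ : (k + k).Partition) (p : k.Partition) (ε : ℤˣ) : ℕ :=
  Module.finrank ℂ (signedBranchingSpace μ p ε)

/-- The space `Hom_{S_k}(ν, p ⊗ q)`. -/
abbrev ProductSpace {k : ℕ} (ν p q : k.Partition) : Type :=
  Representation.IntertwiningMap (spechtRep ν)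
    (Representation.tprod (spechtRep p) (spechtRep q))

/-- The tensor product coefficient `c^ν_{pq}`: the multiplicity of `ν` in the representation
`p ⊗ q` of `S_k`. -/
def productCoeff {k : ℕ} (ν p q : k.Partition) : ℕ := Module.finrank ℂ (ProductSpace ν p q)

/-- The part of `Hom_{S_k}(ν, p ⊗ p)` of sign `ε` under the exchange of the tensor factors. -/
def signedProductSpace {k : ℕ} (ν p : k.Partition) (ε : ℤˣ) :
    Submodule ℂ (ProductSpace ν p p) where
  carrier := {f | ∀ x : Specht ν, TensorProduct.comm ℂ _ _ (f x) = ((ε : ℤ) : ℂ) • f x}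
  zero_mem' x := by simp
  add_mem' {f g} hf hg x := by
    have := congrArg₂ (· + ·) (hf x) (hg x)
    simpa using this
  smul_mem' c f hf x := by
    have := congrArg (c • ·) (hf x)
    simpa [smul_comm c] using this

/-- The multiplicity `c^{ν,ε}_p` of `ν` in the symmetric (`ε = 1`) or the exterior (`ε = -1`)
square of `p`. -/
def signedProductCoeff {k : ℕ} (ν p : k.Partition) (ε : ℤˣ) : ℕ :=
  Module.finrank ℂ (signedProductSpace ν p ε)

/-- The block size `C_{μ ν s}`. Every unordered pair of distinct `p`, `q` contributes
`B^μ_{pq} c^ν_{pq}` to either sign (the ordered sum is halved; it is even because the two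
orders of a pair contribute equally); a pair of equal partitions contributes according to sign. -/
def blockSize {k : ℕ} (d : ℕ) (μ : (k + k).Partition) (ν : k.Partition) (s : ℤˣ) : ℕ :=
  (∑ p : BoundedPartition k d, ∑ q : BoundedPartition k d,
      if p = q then 0 else branchingCoeff μ p.1 q.1 * productCoeff ν p.1 q.1) / 2 +
    ∑ p : BoundedPartition k d, ∑ ε : ℤˣ,
      signedBranchingCoeff μ p.1 ε * signedProductCoeff ν p.1 (s * ε)

/-! ### Operators on `(ℂ^d)^{⊗2k}` -/

/-- Index set, with `d^{2k}` elements, of the standard basis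
`|i_1, …, i_k, j_1, …, j_k⟩` of `(ℂ^d)^{⊗2k} = (ℂ^d)^{⊗k} ⊗ (ℂ^d)^{⊗k}`. -/
abbrev TensorIndex (d k : ℕ) : Type := (Fin k → Fin d) × (Fin k → Fin d)

/-- `A^{⊗2k} = A^{⊗k} ⊗ A^{⊗k}`. -/
def doublePow {d : ℕ} (k : ℕ) (A : Matrix (Fin d) (Fin d) ℂ) :
    Matrix (TensorIndex d k) (TensorIndex d k) ℂ :=
  tensorPow k A ⊗ₖ tensorPow k A

/-- `S_σ ⊗ S_σ`. -/
def doublePerm {k : ℕ} (d : ℕ) (σ : Equiv.Perm (Fin k)) :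
    Matrix (TensorIndex d k) (TensorIndex d k) ℂ :=
  permOp d σ ⊗ₖ permOp d σ

/-- The half-swap `T |i, j⟩ = |j, i⟩`. -/
def halfSwap (d k : ℕ) : Matrix (TensorIndex d k) (TensorIndex d k) ℂ :=
  Matrix.of fun i j => if i = j.swap then 1 else 0

/-- The matrix commutes with all `U^{⊗2k}`, all `S_σ ⊗ S_σ`, and with `T`. -/
def IsKFoldInvariant {d k : ℕ} (Φ : Matrix (TensorIndex d k) (TensorIndex d k) ℂ) : Prop :=
  (∀ g ∈ Matrix.unitaryGroup (Fin d) ℂ, Commute (doublePow k g) Φ) ∧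
    (∀ σ : Equiv.Perm (Fin k), Commute (doublePerm d σ) Φ) ∧ Commute (halfSwap d k) Φ

/-! ### Block matrices -/

/-- The labels of the blocks: a partition `μ` of `2k` with at most `d` parts, a partition `ν`
of `k`, and a sign. -/
abbrev BlockLabel (d k : ℕ) : Type := BoundedPartition (k + k) d × k.Partition × ℤˣ

/-- The number of rows of the block with a given label. -/
def BlockLabel.size {d k : ℕ} (l : BlockLabel d k) : ℕ := blockSize d l.1.1 l.2.1 l.2.2

/-- Index set of `⨁_{μ ν s} ℂ^{C_{μ ν s}} ⊗ ℂ^{d_μ} ⊗ ℂ^{d'_ν}`. -/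
abbrev BlockIndex (d k : ℕ) : Type :=
  Σ l : BlockLabel d k, Fin l.size × Fin (weylDim d l.1.1) × Fin (spechtDim l.2.1)

/-- The matrix `⨁_{μ ν s} M_{μ ν s} ⊗ A_μ ⊗ B_ν`. -/
def blockSum {d k : ℕ}
    (M : ∀ l : BlockLabel d k, Matrix (Fin l.size) (Fin l.size) ℂ)
    (A : ∀ μ : BoundedPartition (k + k) d, Matrix (Fin (weylDim d μ.1)) (Fin (weylDim d μ.1)) ℂ)
    (B : ∀ ν : k.Partition, Matrix (Fin (spechtDim ν)) (Fin (spechtDim ν)) ℂ) :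
    Matrix (BlockIndex d k) (BlockIndex d k) ℂ :=
  Matrix.blockDiagonal' fun l => M l ⊗ₖ (A l.1 ⊗ₖ B l.2.1)

/-- A unitary matrix representation `π` is the matrix form of the representation `ρ` in
some basis. -/
def IsMatrixForm {G V : Type*} [Group G] [AddCommGroup V] [Module ℂ V] {n : ℕ}
    (ρ : Representation ℂ G V) (π : G →* Matrix.unitaryGroup (Fin n) ℂ) : Prop :=
  ∃ b : V ≃ₗ[ℂ] (Fin n → ℂ), ∀ g v, b (ρ g v) = (π g : Matrix (Fin n) (Fin n) ℂ) *ᵥ b v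

end

noncomputable section

/-! ### Tableaux -/

/-! By Schur-Weyl duality `V^{⊗2k}` is the sum over `μ` of `Specht μ ⊗ V_μ`, with `S_{2k}` acting on
the first factor and `U(d)` on the second. The operators `S_σ ⊗ S_σ` and `T` come from elements of
`S_{2k}`: the diagonal of `S_k × S_k` and the block swap, which commutes with that diagonal.
Splitting each `Specht μ` under `S_k × ℤ/2` produces the blocks, and a matrix commuting with
everything is arbitrary on the multiplicity spaces and scalar on the other factors.

Representations are handled through primitive idempotents. A multiple `e_p` of the Young symmetrizer
satisfies `e_p A e_p = ℂ e_p` and `e_p A e_q = 0` for `p ≠ q`, where `A = ℂ[S_n]`. The multiplicity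
space of `p` in a representation `X` is then `e_p X`, and `X` has a basis of products of basis
vectors of `Specht p = A e_p` and of `e_p X` (`isotypicBasis`). Completeness of the Specht modules
follows by counting characters against cycle types (`subsingleton_of_youngIdempotent_smul`).

The block sizes are found by restricting through `S_k × S_k`: the multiplicity space of `ν` in
`Specht μ` is the sum over `p, q` of `Hom(p ⊠ q, μ) ⊗ Hom(ν, p ⊗ q)`. The block swap exchanges the
summands `(p, q)` and `(q, p)`, and on the summand `(p, p)` it is a tensor product of two
involutions. Its trace (`trace_swap_multSpace`) gives the dimensions of its eigenspaces. Partitions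
with more than `d` parts drop out because `μ` has at most `d` parts (`multSpace₂_eq_bot`).

To recognise invariant matrices, irreducibility of `V_μ` is not used as such. A polynomial vanishing
on `U(d)` vanishes on all matrices, by the Cayley transform, so a matrix commuting with all
`g^{⊗2k}` commutes with every matrix invariant under permutations of the factors
(`commute_of_commute_tensorPow`). In particular it commutes with arbitrary matrices acting on the
factors `V_μ`. The group algebra of `S_k` similarly realises arbitrary matrices on the Specht
factors.

The adapted basis need not be orthonormal. Its matrix `F` intertwines unitary matrices on both
sides, and therefore so does the unitary factor of its polar decomposition
(`exists_unitary_intertwiner`). -/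

theorem rowOf_colOf_mem {n : ℕ} (p : n.Partition) (i : Fin n) :
    (rowOf p i, colOf p i) ∈ partitionDiagram p :=
  (YoungDiagram.mem_cells _).1 (tableau p i).2

theorem exists_rowOf_colOf {n : ℕ} (p : n.Partition) {a b : ℕ}
    (h : (a, b) ∈ partitionDiagram p) : ∃ i, rowOf p i = a ∧ colOf p i = b := by
  obtain ⟨i, hi⟩ := (tableau p).surjective ⟨(a, b), (YoungDiagram.mem_cells _).2 h⟩
  exact ⟨i, by simp [rowOf, hi], by simp [colOf, hi]⟩

theorem eq_of_rowOf_colOf {n : ℕ} (p : n.Partition) {i j : Fin n}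
    (h1 : rowOf p i = rowOf p j) (h2 : colOf p i = colOf p j) : i = j :=
  (tableau p).injective (Subtype.ext (Prod.ext h1 h2))

theorem card_rowOf_lt_colOf {n : ℕ} (p : n.Partition) (m j : ℕ) :
    (Finset.univ.filter fun i => rowOf p i < m ∧ colOf p i = j).card =
      min m ((partitionDiagram p).colLen j) := by
  rw [← Finset.card_range (min m ((partitionDiagram p).colLen j))]
  refine Finset.card_bij (fun i _ => rowOf p i) ?_ ?_ ?_
  · intro i hi
    simp only [Finset.mem_filter, Finset.mem_univ, true_and] at hi
    have := rowOf_colOf_mem p i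
    rw [hi.2, YoungDiagram.mem_iff_lt_colLen] at this
    simp [hi.1, this]
  · intro i hi i' hi' h
    simp only [Finset.mem_filter, Finset.mem_univ, true_and] at hi hi'
    exact eq_of_rowOf_colOf p h (hi.2.trans hi'.2.symm)
  · intro a ha
    simp only [Finset.mem_range, lt_min_iff] at ha
    obtain ⟨i, h1, h2⟩ := exists_rowOf_colOf p (YoungDiagram.mem_iff_lt_colLen.2 ha.2)
    exact ⟨i, by simp [h1, h2, ha.1], h1⟩

theorem card_filter_rowOf {n : ℕ} (p : n.Partition) (a : ℕ) :
    (Finset.univ.filter fun i => rowOf p i = a).card = (partitionDiagram p).rowLen a := by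
  rw [← Finset.card_range ((partitionDiagram p).rowLen a)]
  refine Finset.card_bij (fun i _ => colOf p i) ?_ ?_ ?_
  · intro i hi
    simp only [Finset.mem_filter, Finset.mem_univ, true_and] at hi
    have := rowOf_colOf_mem p i
    rw [hi, YoungDiagram.mem_iff_lt_rowLen] at this
    simp [this]
  · intro i hi i' hi' h
    simp only [Finset.mem_filter, Finset.mem_univ, true_and] at hi hi'
    exact eq_of_rowOf_colOf p (hi.trans hi'.symm) h
  · intro b hb
    obtain ⟨i, h1, h2⟩ := exists_rowOf_colOf p
      (YoungDiagram.mem_iff_lt_rowLen.2 (Finset.mem_range.1 hb))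
    exact ⟨i, by simp [h1], h2⟩

theorem partitionDiagram_injective {n : ℕ} :
    Function.Injective (partitionDiagram : n.Partition → YoungDiagram) := by
  intro p q h
  have key : ∀ p : n.Partition, (partitionDiagram p).rowLens = p.parts.sort (· ≥ ·) := fun p =>
    YoungDiagram.rowLens_ofRowLens_eq_self fun x hx => p.parts_pos ((Multiset.mem_sort _).1 hx)
  have h2 := key p
  rw [h, key q] at h2
  ext1
  rw [← Multiset.sort_eq p.parts (· ≥ ·), ← h2, Multiset.sort_eq]

/-- Differences of consecutive counts are the row lengths, which determine the partition. These
counts are the partial sums that define the dominance order. -/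
theorem partition_eq_of_card_rowOf_lt {n : ℕ} {p q : n.Partition}
    (h : ∀ m, (Finset.univ.filter fun i => rowOf p i < m).card =
      (Finset.univ.filter fun i => rowOf q i < m).card) : p = q := by
  have key : ∀ (p : n.Partition) (a : ℕ), (Finset.univ.filter fun i => rowOf p i < a + 1).card =
      (Finset.univ.filter fun i => rowOf p i < a).card + (partitionDiagram p).rowLen a := by
    intro p a
    rw [← card_filter_rowOf, ← Finset.card_union_of_disjoint]
    · congr 1; ext i; simp; omega
    · rw [Finset.disjoint_filter]; intro i _ h1 h2; omega
  apply partitionDiagram_injective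
  refine YoungDiagram.ext (Finset.ext ?_)
  rintro ⟨a, b⟩
  rw [YoungDiagram.mem_cells, YoungDiagram.mem_cells, YoungDiagram.mem_iff_lt_rowLen,
    YoungDiagram.mem_iff_lt_rowLen]
  have h1 := key p a
  rw [h, h, key q a] at h1
  rw [Nat.add_left_cancel h1]

/-! ### Arrangements of letters with prescribed column sizes, and dominance -/

section Margins

variable {n : ℕ} (q : n.Partition) (R C : Fin n → ℕ)
  (hinj : ∀ i j, R i = R j → C i = C j → i = j)
  (hC : ∀ j, (Finset.univ.filter fun i => C i = j).card =
    (Finset.univ.filter fun i => colOf q i = j).card)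

include hinj hC

/-- `R` and `C` place the letters in distinct cells, with the column sizes of `q`. Letters of one
column have distinct rows, so at most `m` of them lie in the first `m` rows, and at most the whole
column does. The tableau of `q`, whose columns have no gaps, attains the smaller of these two
bounds. -/
theorem card_lt_col_le (m j : ℕ) : (Finset.univ.filter fun i => R i < m ∧ C i = j).card ≤
    (Finset.univ.filter fun i => rowOf q i < m ∧ colOf q i = j).card := by
  rw [card_rowOf_lt_colOf, le_min_iff]
  constructor
  · rw [← Finset.card_range m]
    refine Finset.card_le_card_of_injOn R ?_ ?_
    · intro i hi
      simpa using (Finset.mem_filter.1 hi).2.1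
    · intro i hi j hj h
      exact hinj i j h ((Finset.mem_filter.1 hi).2.2.trans (Finset.mem_filter.1 hj).2.2.symm)
  · calc _ ≤ (Finset.univ.filter fun i => C i = j).card :=
          Finset.card_le_card fun i hi => by
            simp only [Finset.mem_filter, Finset.mem_univ, true_and] at hi ⊢; exact hi.2
      -- Any row bound that is at least the column length imposes no condition on the column.
      _ = (Finset.univ.filter fun i => rowOf q i < n + (partitionDiagram q).colLen j ∧
            colOf q i = j).card := by
          rw [hC]
          congr 1
          ext i
          simp only [Finset.mem_filter, Finset.mem_univ, true_and]
          refine ⟨fun h => ⟨?_, h⟩, fun h => h.2⟩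
          have := rowOf_colOf_mem q i
          rw [YoungDiagram.mem_iff_lt_colLen, h] at this
          omega
      _ = _ := by rw [card_rowOf_lt_colOf]
      _ ≤ _ := min_le_right _ _

omit hinj hC in
theorem card_lt_eq_sum (m : ℕ) (t : Finset ℕ) (ht : ∀ i, C i ∈ t) :
    (Finset.univ.filter fun i => R i < m).card =
      ∑ j ∈ t, (Finset.univ.filter fun i => R i < m ∧ C i = j).card := by
  rw [Finset.card_eq_sum_card_fiberwise (f := C) (t := t) (fun i _ => ht i)]
  simp [Finset.filter_filter]

theorem card_lt_le (m : ℕ) : (Finset.univ.filter fun i => R i < m).card ≤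
    (Finset.univ.filter fun i => rowOf q i < m).card := by
  let t := Finset.univ.image C ∪ Finset.univ.image (colOf q)
  rw [card_lt_eq_sum R C m t (by simp [t]), card_lt_eq_sum (rowOf q) (colOf q) m t (by simp [t])]
  exact Finset.sum_le_sum fun j _ => card_lt_col_le q R C hinj hC m j

/-- Equality of the totals forces equality in every column of `card_lt_col_le`. The count in a
column then grows by one at each step of `m` below the column length, so every such row is occupied.
-/
theorem exists_of_card_lt_eq (h : ∀ m, (Finset.univ.filter fun i => R i < m).card =
    (Finset.univ.filter fun i => rowOf q i < m).card) (i : Fin n) :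
    ∃ i', R i' = rowOf q i ∧ C i' = colOf q i := by
  let t := Finset.univ.image C ∪ Finset.univ.image (colOf q)
  have key : ∀ m, (Finset.univ.filter fun i' => R i' < m ∧ C i' = colOf q i).card =
      min m ((partitionDiagram q).colLen (colOf q i)) := by
    intro m
    have h1 := h m
    rw [card_lt_eq_sum R C m t (by simp [t]),
      card_lt_eq_sum (rowOf q) (colOf q) m t (by simp [t]),
      Finset.sum_eq_sum_iff_of_le fun j _ => card_lt_col_le q R C hinj hC m j] at h1
    rw [h1 _ (by simp [t]), card_rowOf_lt_colOf]
  have hlt : rowOf q i < (partitionDiagram q).colLen (colOf q i) :=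
    YoungDiagram.mem_iff_lt_colLen.1 (rowOf_colOf_mem q i)
  by_contra! hne
  have h1 := key (rowOf q i + 1)
  have h2 : (Finset.univ.filter fun i' => R i' < rowOf q i + 1 ∧ C i' = colOf q i) =
      (Finset.univ.filter fun i' => R i' < rowOf q i ∧ C i' = colOf q i) := by
    ext i'
    simp only [Finset.mem_filter, Finset.mem_univ, true_and]
    refine ⟨fun h => ⟨?_, h.2⟩, fun h => ⟨by omega, h.2⟩⟩
    have h3 : R i' ≠ rowOf q i := fun h' => hne i' h' h.2
    have h4 := h.1
    omega
  rw [h2, key] at h1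
  omega

end Margins

/-! ### The Young symmetrizers -/

section Young

variable {n : ℕ}

theorem card_colOf_comp (p : n.Partition) (g : Equiv.Perm (Fin n)) (j : ℕ) :
    (Finset.univ.filter fun i => colOf p (g i) = j).card =
    (Finset.univ.filter fun i => colOf p i = j).card :=
  Finset.card_bij (fun i _ => g i) (by simp) (by simp) fun i hi => ⟨g.symm i, by simpa using hi⟩

theorem rowSymmetrizer_mul_of (p : n.Partition) {σ : Equiv.Perm (Fin n)}
    (h : ∀ i, rowOf p (σ i) = rowOf p i) :
    rowSymmetrizer p * MonoidAlgebra.of ℂ _ σ = rowSymmetrizer p := by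
  rw [rowSymmetrizer, Finset.sum_mul]
  refine Finset.sum_bij (fun τ _ => τ * σ) ?_ ?_ ?_ ?_
  · intro τ hτ
    simp only [Finset.mem_filter, Finset.mem_univ, true_and] at hτ ⊢
    intro i; rw [Equiv.Perm.mul_apply, hτ, h]
  · intro τ _ τ' _ h; exact mul_right_cancel h
  · intro τ hτ
    simp only [Finset.mem_filter, Finset.mem_univ, true_and] at hτ
    refine ⟨τ * σ⁻¹, ?_, by simp⟩
    simp only [Finset.mem_filter, Finset.mem_univ, true_and]
    intro i; rw [Equiv.Perm.mul_apply, hτ, ← h]; simp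
  · intro τ _; rw [← map_mul]

theorem of_mul_colAntisymmetrizer (p : n.Partition) {σ : Equiv.Perm (Fin n)}
    (h : ∀ i, colOf p (σ i) = colOf p i) :
    MonoidAlgebra.of ℂ _ σ * colAntisymmetrizer p =
      ((Equiv.Perm.sign σ : ℤ) : ℂ) • colAntisymmetrizer p := by
  rw [colAntisymmetrizer, Finset.mul_sum, Finset.smul_sum]
  refine Finset.sum_bij (fun τ _ => σ * τ) ?_ ?_ ?_ ?_
  · intro τ hτ
    simp only [Finset.mem_filter, Finset.mem_univ, true_and] at hτ ⊢
    intro i; rw [Equiv.Perm.mul_apply, h, hτ]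
  · intro τ _ τ' _ h; exact mul_left_cancel h
  · intro τ hτ
    simp only [Finset.mem_filter, Finset.mem_univ, true_and] at hτ
    refine ⟨σ⁻¹ * τ, ?_, by simp⟩
    simp only [Finset.mem_filter, Finset.mem_univ, true_and]
    intro i; rw [Equiv.Perm.mul_apply, ← h]; simp [hτ]
  · intro τ _
    rw [mul_smul_comm, ← map_mul, smul_smul, map_mul Equiv.Perm.sign]
    congr 1
    rcases Int.units_eq_one_or (Equiv.Perm.sign σ) with h1 | h1 <;>
      rcases Int.units_eq_one_or (Equiv.Perm.sign τ) with h2 | h2 <;> simp [h1, h2]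

/-- The transposition of `i` and `j` is absorbed by the row symmetrizer. Moved through `g`, it
becomes a column transposition and yields the factor `-1`. The product is thus its own negative. -/
theorem rowSymmetrizer_mul_of_mul_colAntisymmetrizer_eq_zero {p q : n.Partition}
    {g : Equiv.Perm (Fin n)} {i j : Fin n} (hij : i ≠ j) (hr : rowOf p i = rowOf p j)
    (hc : colOf q (g⁻¹ i) = colOf q (g⁻¹ j)) :
    rowSymmetrizer p * MonoidAlgebra.of ℂ _ g * colAntisymmetrizer q = 0 := by
  have h1 : rowSymmetrizer p * MonoidAlgebra.of ℂ _ (Equiv.swap i j) = rowSymmetrizer p := by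
    refine rowSymmetrizer_mul_of p fun x => ?_
    rw [Equiv.swap_apply_def]; split_ifs <;> simp_all
  have h2 : MonoidAlgebra.of ℂ _ (Equiv.swap (g⁻¹ i) (g⁻¹ j)) * colAntisymmetrizer q =
      - colAntisymmetrizer q := by
    rw [of_mul_colAntisymmetrizer q]
    · rw [Equiv.Perm.sign_swap (by simpa using hij)]; simp
    · intro x
      rw [Equiv.swap_apply_def]; split_ifs <;> simp_all
  have h3 : Equiv.swap i j * g = g * Equiv.swap (g⁻¹ i) (g⁻¹ j) := by
    rw [Equiv.mul_swap_eq_swap_mul]; simp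
  have h4 : rowSymmetrizer p * MonoidAlgebra.of ℂ _ g * colAntisymmetrizer q =
      - (rowSymmetrizer p * MonoidAlgebra.of ℂ _ g * colAntisymmetrizer q) := by
    conv_lhs => rw [← h1, mul_assoc (rowSymmetrizer p), ← map_mul, h3, map_mul, ← mul_assoc,
      mul_assoc _ _ (colAntisymmetrizer q), h2, mul_neg]
  have h5 := add_eq_zero_iff_eq_neg.2 h4
  rw [← two_smul ℂ] at h5
  exact (smul_eq_zero.1 h5).resolve_left two_ne_zero

/-- Without a collision, the rows of `p` and the columns of `q` moved by `g` place the letters in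
distinct cells, so `card_lt_le` gives dominance. -/
theorem exists_collision_or (p q : n.Partition) (g : Equiv.Perm (Fin n)) :
    (∃ i j, i ≠ j ∧ rowOf p i = rowOf p j ∧ colOf q (g⁻¹ i) = colOf q (g⁻¹ j)) ∨
    ∀ m, (Finset.univ.filter fun i => rowOf p i < m).card ≤
      (Finset.univ.filter fun i => rowOf q i < m).card := by
  by_cases h : ∃ i j, i ≠ j ∧ rowOf p i = rowOf p j ∧ colOf q (g⁻¹ i) = colOf q (g⁻¹ j)
  · exact Or.inl h
  · right
    push Not at h
    exact card_lt_le q (rowOf p) (fun i => colOf q (g⁻¹ i))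
      (fun i j h1 h2 => by_contra fun h3 => h i j h3 h1 h2) (card_colOf_comp q g⁻¹)

theorem rowSymmetrizer_mul_mul_eq_zero {p q : n.Partition}
    (h : ¬ ∀ m, (Finset.univ.filter fun i => rowOf p i < m).card ≤
      (Finset.univ.filter fun i => rowOf q i < m).card)
    (x : MonoidAlgebra ℂ (Equiv.Perm (Fin n))) :
    rowSymmetrizer p * x * colAntisymmetrizer q = 0 := by
  induction x using MonoidAlgebra.induction_on with
  | of g =>
    obtain ⟨i, j, h1, h2, h3⟩ := (exists_collision_or p q g).resolve_right h
    exact rowSymmetrizer_mul_of_mul_colAntisymmetrizer_eq_zero h1 h2 h3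
  | add x y hx hy => rw [mul_add, add_mul, hx, hy, add_zero]
  | smul r x hx => rw [mul_smul_comm, smul_mul_assoc, hx, smul_zero]

/-- A collision makes the product vanish. Without one, `g` is a row permutation times a column
permutation (von Neumann's lemma), and both are absorbed up to sign. -/
theorem exists_smul_youngSymmetrizer (p : n.Partition)
    (x : MonoidAlgebra ℂ (Equiv.Perm (Fin n))) :
    ∃ z : ℂ, rowSymmetrizer p * x * colAntisymmetrizer p = z • youngSymmetrizer p := by
  induction x using MonoidAlgebra.induction_on with
  | of g =>
    by_cases h : ∃ i j, i ≠ j ∧ rowOf p i = rowOf p j ∧ colOf p (g⁻¹ i) = colOf p (g⁻¹ j)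
    · obtain ⟨i, j, h1, h2, h3⟩ := h
      exact ⟨0, by rw [zero_smul, rowSymmetrizer_mul_of_mul_colAntisymmetrizer_eq_zero h1 h2 h3]⟩
    · push Not at h
      have key := exists_of_card_lt_eq p (rowOf p) (fun i => colOf p (g⁻¹ i))
        (fun i j h1 h2 => by_contra fun h3 => h i j h3 h1 h2) (card_colOf_comp p g⁻¹)
        (fun _ => rfl)
      -- `f i` lies in the row of `i`, and `g⁻¹ (f i)` lies in the column of `i`. Hence `f` is the
      -- row factor of `g`, and the remaining factor preserves columns.
      choose f hf1 hf2 using key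
      have hf : Function.Injective f := fun i j hij => eq_of_rowOf_colOf p
        (by rw [← hf1 i, ← hf1 j, hij]) (by rw [← hf2 i, ← hf2 j, hij])
      let r : Equiv.Perm (Fin n) := Equiv.ofBijective f (Finite.injective_iff_bijective.1 hf)
      have hr : ∀ i, r i = f i := fun i => rfl
      have hg : g = r * (r⁻¹ * g) := by simp
      have hc : ∀ i, colOf p ((r⁻¹ * g) i) = colOf p i := by
        intro i
        rw [← hf2, ← hr]
        simp
      refine ⟨((Equiv.Perm.sign (r⁻¹ * g) : ℤ) : ℂ), ?_⟩
      rw [hg, map_mul, ← mul_assoc, rowSymmetrizer_mul_of p (fun i => by rw [hr, hf1]), mul_assoc,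
        of_mul_colAntisymmetrizer p hc, mul_smul_comm, ← hg, youngSymmetrizer]
  | add x y hx hy =>
    obtain ⟨a, ha⟩ := hx
    obtain ⟨b, hb⟩ := hy
    exact ⟨a + b, by rw [mul_add, add_mul, ha, hb, add_smul]⟩
  | smul r x hx =>
    obtain ⟨a, ha⟩ := hx
    exact ⟨r * a, by rw [mul_smul_comm, smul_mul_assoc, ha, smul_smul]⟩

theorem exists_youngSymmetrizer_mul_mul (p : n.Partition)
    (x : MonoidAlgebra ℂ (Equiv.Perm (Fin n))) :
    ∃ z : ℂ, youngSymmetrizer p * x * youngSymmetrizer p = z • youngSymmetrizer p := by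
  obtain ⟨z, hz⟩ := exists_smul_youngSymmetrizer p (colAntisymmetrizer p * x * rowSymmetrizer p)
  exact ⟨z, by rw [← hz]; simp only [youngSymmetrizer, mul_assoc]⟩

theorem coeff_colAntisymmetrizer (p : n.Partition) (g : Equiv.Perm (Fin n)) :
    (colAntisymmetrizer p).coeff g =
      if ∀ i, colOf p (g i) = colOf p i then ((Equiv.Perm.sign g : ℤ) : ℂ) else 0 := by
  simp [colAntisymmetrizer, MonoidAlgebra.coeff_sum, Finsupp.single_apply, Finset.sum_ite_eq']

/-- Only the identity preserves all rows and all columns, so exactly one product of a row and a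
column permutation equals `1`. -/
theorem coeff_one_youngSymmetrizer (p : n.Partition) : (youngSymmetrizer p).coeff 1 = 1 := by
  simp only [youngSymmetrizer, rowSymmetrizer, Finset.sum_mul, MonoidAlgebra.coeff_sum,
    Finsupp.coe_finsetSum, Finset.sum_apply, MonoidAlgebra.of_apply,
    MonoidAlgebra.coeff_single_mul_apply, coeff_colAntisymmetrizer, mul_one, one_mul]
  rw [Finset.sum_eq_single 1]
  · simp
  · intro σ hσ hne
    simp only [Finset.mem_filter, Finset.mem_univ, true_and] at hσ
    refine if_neg fun h => hne ?_
    ext1 i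
    refine eq_of_rowOf_colOf p (hσ i) ?_
    simpa using (h (σ i)).symm
  · simp

theorem trace_mulLeft {G : Type*} [Group G] [Fintype G] [DecidableEq G] (x : MonoidAlgebra ℂ G) :
    LinearMap.trace ℂ _ (LinearMap.mulLeft ℂ x) = Fintype.card G * x.coeff 1 := by
  rw [LinearMap.trace_eq_matrix_trace ℂ (MonoidAlgebra.basis G ℂ), Matrix.trace]
  simp only [Matrix.diag_apply, LinearMap.toMatrix_apply, MonoidAlgebra.basis_apply,
    LinearMap.mulLeft_apply]
  have : ∀ g : G, ((MonoidAlgebra.basis G ℂ).repr (x * MonoidAlgebra.single g 1)) g =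
      x.coeff 1 := fun g => by
    change (x * MonoidAlgebra.single g 1).coeff g = _
    simp
  simp [this]

/-- Up to the order of the group, the coefficient at `1` is the trace of left multiplication, and
nilpotent operators have trace zero. -/
theorem coeff_one_eq_zero_of_isNilpotent {G : Type*} [Group G] [Fintype G] [DecidableEq G]
    {x : MonoidAlgebra ℂ G} (hx : IsNilpotent x) : x.coeff 1 = 0 := by
  have h1 : IsNilpotent (LinearMap.mulLeft ℂ x) := by
    obtain ⟨m, hm⟩ := hx
    exact ⟨m, by rw [LinearMap.pow_mulLeft, hm, LinearMap.mulLeft_zero_eq_zero]⟩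
  have h2 := LinearMap.isNilpotent_trace_of_isNilpotent h1
  rw [trace_mulLeft, isNilpotent_iff_eq_zero] at h2
  simpa using h2

theorem eq_zero_of_forall_isNilpotent {G : Type*} [Group G] [Fintype G] [DecidableEq G]
    {x : MonoidAlgebra ℂ G} (hx : ∀ z, IsNilpotent (z * x)) : x = 0 := by
  ext g
  have := coeff_one_eq_zero_of_isNilpotent (hx (MonoidAlgebra.single g⁻¹ 1))
  simpa using this

theorem youngSymmetrizer_ne_zero (p : n.Partition) : youngSymmetrizer p ≠ 0 := fun h => by
  simpa [h] using coeff_one_youngSymmetrizer p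

/-- If `q` does not dominate `p`, collisions give the claim. Otherwise `p` does not dominate `q`,
and the products in the opposite order vanish. Every left multiple of the element then has square
zero, which forces the element to vanish by the trace argument. -/
theorem youngSymmetrizer_mul_mul_eq_zero {p q : n.Partition} (hpq : p ≠ q)
    (x : MonoidAlgebra ℂ (Equiv.Perm (Fin n))) :
    youngSymmetrizer p * x * youngSymmetrizer q = 0 := by
  have key : ∀ {p q : n.Partition}, (¬ ∀ m, (Finset.univ.filter fun i => rowOf p i < m).card ≤
      (Finset.univ.filter fun i => rowOf q i < m).card) → ∀ x,
      youngSymmetrizer p * x * youngSymmetrizer q = 0 := by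
    intro p q h x
    have := rowSymmetrizer_mul_mul_eq_zero h (colAntisymmetrizer p * x * rowSymmetrizer q)
    rw [← this]
    simp only [youngSymmetrizer, mul_assoc]
  by_cases h : ∀ m, (Finset.univ.filter fun i => rowOf p i < m).card ≤
      (Finset.univ.filter fun i => rowOf q i < m).card
  · have h' : ¬ ∀ m, (Finset.univ.filter fun i => rowOf q i < m).card ≤
        (Finset.univ.filter fun i => rowOf p i < m).card := fun h' =>
      hpq (partition_eq_of_card_rowOf_lt fun m => le_antisymm (h m) (h' m))
    refine eq_zero_of_forall_isNilpotent fun z => ⟨2, ?_⟩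
    rw [pow_two]
    calc _ = z * youngSymmetrizer p * x * (youngSymmetrizer q * z * youngSymmetrizer p) * x *
          youngSymmetrizer q := by simp only [mul_assoc]
      _ = 0 := by rw [key h']; simp
  · exact key h x

/-- If the scalar were zero, the symmetrizer would be nilpotent, but its coefficient at `1` is `1`.
-/
theorem exists_youngSymmetrizer_mul_self (p : n.Partition) :
    ∃ z : ℂ, z ≠ 0 ∧ youngSymmetrizer p * youngSymmetrizer p = z • youngSymmetrizer p := by
  obtain ⟨z, hz⟩ := exists_youngSymmetrizer_mul_mul p 1
  rw [mul_one] at hz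
  refine ⟨z, ?_, hz⟩
  rintro rfl
  have h : IsNilpotent (youngSymmetrizer p) := ⟨2, by rw [pow_two, hz, zero_smul]⟩
  simpa [coeff_one_youngSymmetrizer] using coeff_one_eq_zero_of_isNilpotent h

end Young


/-! ### Primitive idempotents and Specht modules -/

/-- The primitive idempotent proportional to the Young symmetrizer. -/
def youngIdempotent {n : ℕ} (p : n.Partition) : MonoidAlgebra ℂ (Equiv.Perm (Fin n)) :=
  (exists_youngSymmetrizer_mul_self p).choose⁻¹ • youngSymmetrizer p

theorem exists_youngSymmetrizer_eq_smul {n : ℕ} (p : n.Partition) :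
    ∃ z : ℂ, z ≠ 0 ∧ youngSymmetrizer p = z • youngIdempotent p := by
  obtain ⟨h, -⟩ := (exists_youngSymmetrizer_mul_self p).choose_spec
  exact ⟨_, h, by rw [youngIdempotent, smul_inv_smul₀ h]⟩

theorem exists_youngIdempotent_eq_smul {n : ℕ} (p : n.Partition) :
    ∃ z : ℂ, z ≠ 0 ∧ youngIdempotent p = z • youngSymmetrizer p :=
  ⟨_, inv_ne_zero (exists_youngSymmetrizer_mul_self p).choose_spec.1, rfl⟩

theorem youngIdempotent_mul_self {n : ℕ} (p : n.Partition) :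
    youngIdempotent p * youngIdempotent p = youngIdempotent p := by
  obtain ⟨h, h'⟩ := (exists_youngSymmetrizer_mul_self p).choose_spec
  rw [youngIdempotent]
  generalize (exists_youngSymmetrizer_mul_self p).choose = z at h h'
  rw [smul_mul_smul_comm, h', smul_smul, mul_assoc, inv_mul_cancel₀ h, mul_one]

theorem youngIdempotent_ne_zero {n : ℕ} (p : n.Partition) : youngIdempotent p ≠ 0 := by
  obtain ⟨z, h, h'⟩ := exists_youngIdempotent_eq_smul p
  rw [h']
  exact smul_ne_zero h (youngSymmetrizer_ne_zero p)

theorem youngIdempotent_mul_mul_eq_zero {n : ℕ} {p q : n.Partition} (hpq : p ≠ q)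
    (x : MonoidAlgebra ℂ (Equiv.Perm (Fin n))) :
    youngIdempotent p * x * youngIdempotent q = 0 := by
  simp [youngIdempotent, youngSymmetrizer_mul_mul_eq_zero hpq]

theorem exists_youngIdempotent_mul_mul {n : ℕ} (p : n.Partition)
    (x : MonoidAlgebra ℂ (Equiv.Perm (Fin n))) :
    ∃ z : ℂ, youngIdempotent p * x * youngIdempotent p = z • youngIdempotent p := by
  obtain ⟨z, hz⟩ := exists_youngSymmetrizer_mul_mul p x
  obtain ⟨w, -, hw⟩ := exists_youngIdempotent_eq_smul p
  refine ⟨w * z, ?_⟩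
  rw [hw, smul_mul_assoc, smul_mul_smul_comm, hz, smul_smul, smul_smul]
  congr 1; ring

/-- The inclusion of the Specht module in the group algebra. -/
def spechtVal {n : ℕ} (p : n.Partition) :
    Specht p →ₗ[MonoidAlgebra ℂ (Equiv.Perm (Fin n))] MonoidAlgebra ℂ (Equiv.Perm (Fin n)) :=
  Submodule.subtype (Ideal.span {youngSymmetrizer p} : Ideal (MonoidAlgebra ℂ (Equiv.Perm (Fin n))))

theorem spechtVal_injective {n : ℕ} (p : n.Partition) : Function.Injective (spechtVal p) :=
  Subtype.val_injective

theorem spechtVal_smul {n : ℕ} (p : n.Partition) (z : ℂ) (x : Specht p) :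
    spechtVal p (z • x) = z • spechtVal p x := rfl

theorem mem_range_spechtVal {n : ℕ} {p : n.Partition} {a : MonoidAlgebra ℂ (Equiv.Perm (Fin n))} :
    (∃ x, spechtVal p x = a) ↔ a * youngIdempotent p = a := by
  obtain ⟨z, hz, h⟩ := exists_youngSymmetrizer_eq_smul p
  obtain ⟨w, hw, h'⟩ := exists_youngIdempotent_eq_smul p
  constructor
  · rintro ⟨x, rfl⟩
    obtain ⟨b, hb⟩ := Ideal.mem_span_singleton'.1 x.2
    change x.1 * _ = x.1
    rw [← hb, h, mul_smul_comm, smul_mul_assoc, mul_assoc, youngIdempotent_mul_self]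
  · intro ha
    refine ⟨⟨a, Ideal.mem_span_singleton'.2 ⟨w • a, ?_⟩⟩, rfl⟩
    rw [smul_mul_assoc, ← mul_smul_comm, ← h', ha]

theorem spechtVal_mul_youngIdempotent {n : ℕ} {p : n.Partition} (x : Specht p) :
    spechtVal p x * youngIdempotent p = spechtVal p x := mem_range_spechtVal.1 ⟨x, rfl⟩

/-- The Young idempotent as the generator of the Specht module. -/
def spechtGen {n : ℕ} (p : n.Partition) : Specht p :=
  (mem_range_spechtVal.2 (youngIdempotent_mul_self p)).choose

theorem spechtVal_spechtGen {n : ℕ} (p : n.Partition) :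
    spechtVal p (spechtGen p) = youngIdempotent p :=
  (mem_range_spechtVal.2 (youngIdempotent_mul_self p)).choose_spec

theorem spechtVal_smul_spechtGen {n : ℕ} {p : n.Partition} (x : Specht p) :
    spechtVal p x • spechtGen p = x := by
  apply spechtVal_injective
  rw [map_smul, spechtVal_spechtGen, smul_eq_mul, spechtVal_mul_youngIdempotent]

theorem spechtGen_ne_zero {n : ℕ} (p : n.Partition) : spechtGen p ≠ 0 := fun h =>
  youngIdempotent_ne_zero p (by rw [← spechtVal_spechtGen, h, map_zero])

instance {n : ℕ} : Module.Finite ℂ (MonoidAlgebra ℂ (Equiv.Perm (Fin n))) :=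
  Module.Finite.of_basis (MonoidAlgebra.basis _ ℂ)

instance {n : ℕ} (p : n.Partition) : Module.Finite ℂ (Specht p) :=
  Module.Finite.of_injective ((spechtVal p).restrictScalars ℂ) (spechtVal_injective p)

theorem youngIdempotent_smul_of_ne {n : ℕ} {p q : n.Partition} (hpq : p ≠ q) (x : Specht q) :
    youngIdempotent p • x = 0 := by
  apply spechtVal_injective
  rw [map_smul, map_zero, smul_eq_mul, ← spechtVal_mul_youngIdempotent x, ← mul_assoc,
    youngIdempotent_mul_mul_eq_zero hpq]

theorem exists_youngIdempotent_smul {n : ℕ} {p : n.Partition} (x : Specht p) :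
    ∃ z : ℂ, youngIdempotent p • x = z • spechtGen p := by
  obtain ⟨z, hz⟩ := exists_youngIdempotent_mul_mul p (spechtVal p x)
  refine ⟨z, spechtVal_injective p ?_⟩
  rw [map_smul, spechtVal_smul, smul_eq_mul, spechtVal_spechtGen, ← hz, mul_assoc,
    spechtVal_mul_youngIdempotent]

/-! ### Completeness of the Specht modules -/

/-- The character of a module over an algebra, as a linear functional. -/
def moduleTrace (A M : Type*) [Ring A] [Algebra ℂ A] [AddCommGroup M] [Module ℂ M] [Module A M]
    [IsScalarTower ℂ A M] : A →ₗ[ℂ] ℂ :=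
  LinearMap.trace ℂ M ∘ₗ (Algebra.lsmul ℂ ℂ M).toLinearMap

theorem moduleTrace_mul_comm {A M : Type*} [Ring A] [Algebra ℂ A] [AddCommGroup M] [Module ℂ M]
    [Module A M] [IsScalarTower ℂ A M] (a b : A) :
    moduleTrace A M (a * b) = moduleTrace A M (b * a) := by
  simp only [moduleTrace, LinearMap.comp_apply, AlgHom.toLinearMap_apply, map_mul]
  exact LinearMap.trace_mul_comm ℂ _ _

theorem moduleTrace_of_partition_eq {n : ℕ} {M : Type*} [AddCommGroup M] [Module ℂ M]
    [Module (MonoidAlgebra ℂ (Equiv.Perm (Fin n))) M]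
    [IsScalarTower ℂ (MonoidAlgebra ℂ (Equiv.Perm (Fin n))) M] {σ τ : Equiv.Perm (Fin n)}
    (h : σ.partition = τ.partition) :
    moduleTrace (MonoidAlgebra ℂ (Equiv.Perm (Fin n))) M (MonoidAlgebra.of ℂ _ σ) =
      moduleTrace (MonoidAlgebra ℂ (Equiv.Perm (Fin n))) M (MonoidAlgebra.of ℂ _ τ) := by
  obtain ⟨c, rfl⟩ := isConj_iff.1 (Equiv.Perm.partition_eq_of_isConj.2 h)
  rw [map_mul, moduleTrace_mul_comm, ← map_mul, inv_mul_cancel_left]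

/-- `e_p` projects `Specht p` onto the line of its generator, and `e_q` annihilates it for `q ≠ p`.
The idempotents are thus dual to the characters. -/
theorem moduleTrace_specht_youngIdempotent {n : ℕ} (p q : n.Partition) :
    moduleTrace (MonoidAlgebra ℂ (Equiv.Perm (Fin n))) (Specht p) (youngIdempotent q) =
      if p = q then 1 else 0 := by
  split_ifs with h
  · subst h
    have : LinearMap.IsProj (ℂ ∙ spechtGen p)
        (Algebra.lsmul ℂ ℂ (Specht p) (youngIdempotent p)) := by
      constructor
      · intro x
        obtain ⟨z, hz⟩ := exists_youngIdempotent_smul x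
        exact Submodule.mem_span_singleton.2 ⟨z, hz.symm⟩
      · intro x hx
        obtain ⟨z, rfl⟩ := Submodule.mem_span_singleton.1 hx
        rw [map_smul]
        congr 1
        apply spechtVal_injective
        rw [Algebra.lsmul_coe, map_smul, spechtVal_spechtGen, smul_eq_mul, youngIdempotent_mul_self]
    simp only [moduleTrace, LinearMap.comp_apply, AlgHom.toLinearMap_apply]
    rw [this.trace, finrank_span_singleton (spechtGen_ne_zero p), Nat.cast_one]
  · have : Algebra.lsmul ℂ ℂ (Specht p) (youngIdempotent q) = 0 :=
      LinearMap.ext fun x => youngIdempotent_smul_of_ne (Ne.symm h) x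
    simp [moduleTrace, this]

/-- The characters of the Specht modules and of `M` are determined by their values on cycle types,
and they are one more than the number of cycle types, so they satisfy a nontrivial linear relation.
Evaluation at each `e_p` removes the Specht characters, because `e_p` has trace zero on `M`. The
character of `M` is then zero, and its value at `1` is the dimension of `M`. -/
theorem subsingleton_of_youngIdempotent_smul {n : ℕ} {M : Type*} [AddCommGroup M] [Module ℂ M]
    [Module (MonoidAlgebra ℂ (Equiv.Perm (Fin n))) M]
    [IsScalarTower ℂ (MonoidAlgebra ℂ (Equiv.Perm (Fin n))) M] [Module.Finite ℂ M]
    (h : ∀ (p : n.Partition) (x : M), youngIdempotent p • x = 0) : Subsingleton M := by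
  let A := MonoidAlgebra ℂ (Equiv.Perm (Fin n))
  -- One permutation is chosen for each cycle type, and `E` below evaluates functionals at these
  -- representatives.
  let rep : (Fintype.card (Fin n)).Partition → Equiv.Perm (Fin n) :=
    Function.invFun Equiv.Perm.partition
  have hrep : ∀ σ : Equiv.Perm (Fin n), (rep σ.partition).partition = σ.partition := fun σ =>
    Function.invFun_eq ⟨σ, rfl⟩
  let T : (n.Partition → ℂ) × ℂ →ₗ[ℂ] (A →ₗ[ℂ] ℂ) :=
    LinearMap.coprod (∑ p : n.Partition,
      LinearMap.smulRight (LinearMap.proj p) (moduleTrace A (Specht p)))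
      (LinearMap.smulRight LinearMap.id (moduleTrace A M))
  have hT : ∀ z a, T z a = ∑ p, z.1 p * moduleTrace A (Specht p) a + z.2 * moduleTrace A M a := by
    intro z a
    simp [T, LinearMap.sum_apply]
  let E : (A →ₗ[ℂ] ℂ) →ₗ[ℂ] ((Fintype.card (Fin n)).Partition → ℂ) :=
    LinearMap.pi fun π => LinearMap.applyₗ (MonoidAlgebra.of ℂ _ (rep π))
  obtain ⟨z, hz, hz0⟩ := (Submodule.ne_bot_iff _).1
    (LinearMap.ker_ne_bot_of_finrank_lt (f := E ∘ₗ T) (by simp))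
  have hz' : T z = 0 := by
    refine MonoidAlgebra.lhom_ext' fun σ => LinearMap.ext_ring ?_
    have h1 : (E ∘ₗ T) z σ.partition = 0 := by rw [LinearMap.mem_ker.1 hz]; rfl
    change T z (MonoidAlgebra.of ℂ _ (rep σ.partition)) = 0 at h1
    change T z (MonoidAlgebra.of ℂ _ σ) = 0
    rw [hT] at h1 ⊢
    simp only [A] at h1 ⊢
    rw [← h1, moduleTrace_of_partition_eq (hrep σ)]
    simp_rw [moduleTrace_of_partition_eq (hrep σ)]
  have hM : ∀ p : n.Partition, moduleTrace A M (youngIdempotent p) = 0 := by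
    intro p
    have : Algebra.lsmul ℂ ℂ M (youngIdempotent p) = 0 := LinearMap.ext fun x => h p x
    simp [moduleTrace, this]
  have hz1 : z.1 = 0 := by
    ext p
    have := hT z (youngIdempotent p)
    simp only [A] at this
    simp_rw [moduleTrace_specht_youngIdempotent] at this
    rw [hz', hM] at this
    simpa using this.symm
  have hz2 : z.2 ≠ 0 := fun h => hz0 (Prod.ext hz1 h)
  have := hT z 1
  rw [hz', hz1] at this
  have h3 : moduleTrace A M 1 = 0 := by simpa [hz2] using this.symm
  rw [moduleTrace, LinearMap.comp_apply, AlgHom.toLinearMap_apply, map_one, LinearMap.trace_one,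
    Nat.cast_eq_zero] at h3
  exact Module.finrank_zero_iff.1 h3

/-- Every `e_p` annihilates the quotient by this left ideal, so the quotient is zero. This is the
form in which completeness is used. -/
theorem ideal_span_youngIdempotent (n : ℕ) :
    Ideal.span (Set.range fun p : n.Partition × MonoidAlgebra ℂ (Equiv.Perm (Fin n)) =>
      youngIdempotent p.1 * p.2) = ⊤ := by
  set I := Ideal.span (Set.range fun p : n.Partition × MonoidAlgebra ℂ (Equiv.Perm (Fin n)) =>
    youngIdempotent p.1 * p.2) with hI
  rw [← Submodule.Quotient.subsingleton_iff]
  have : Module.Finite ℂ (MonoidAlgebra ℂ (Equiv.Perm (Fin n)) ⧸ I) :=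
    Module.Finite.of_surjective ((Submodule.mkQ I).restrictScalars ℂ) (Submodule.mkQ_surjective I)
  refine subsingleton_of_youngIdempotent_smul (n := n) fun p x => ?_
  obtain ⟨y, rfl⟩ := Submodule.mkQ_surjective I x
  rw [← map_smul, Submodule.mkQ_apply, Submodule.Quotient.mk_eq_zero]
  exact Ideal.subset_span ⟨(p, y), rfl⟩


/-! ### Isotypic decomposition -/

section Isotypic

variable {n : ℕ}

/-- The annihilator of `x` contains all `e_q a`: for `q = p` by assumption, and for `q ≠ p` because
`e_q a x = e_q (a x) e_p = 0`. By completeness it contains `1`. -/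
theorem eq_zero_of_forall_youngIdempotent_mul {p : n.Partition} {x : Specht p}
    (h : ∀ a, youngIdempotent p * a * spechtVal p x = 0) : x = 0 := by
  have h1 : Ideal.span (Set.range fun p : n.Partition × MonoidAlgebra ℂ (Equiv.Perm (Fin n)) =>
      youngIdempotent p.1 * p.2) ≤ LinearMap.ker (LinearMap.toSpanSingleton _ _ x) := by
    rw [Ideal.span, Submodule.span_le]
    rintro _ ⟨⟨q, a⟩, rfl⟩
    rw [SetLike.mem_coe, LinearMap.mem_ker, LinearMap.toSpanSingleton_apply]
    apply spechtVal_injective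
    rw [map_smul, map_zero, smul_eq_mul]
    by_cases hq : q = p
    · subst hq; exact h a
    · rw [← spechtVal_mul_youngIdempotent, ← mul_assoc, mul_assoc _ a,
        youngIdempotent_mul_mul_eq_zero hq]
  rw [ideal_span_youngIdempotent] at h1
  simpa using h1 (Submodule.mem_top (x := 1))

/-- The pairing of `e_p A` with `A e_p`, valued in `e_p A e_p = ℂ e_p`, has no kernel in `A e_p` by
the preceding lemma. In finite dimension every functional is therefore represented. -/
theorem exists_spechtDual {p : n.Partition} (φ : Specht p →ₗ[ℂ] ℂ) :
    ∃ a, ∀ x, youngIdempotent p * a * spechtVal p x = φ x • youngIdempotent p := by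
  -- The functional `f` reads off coefficients on the line `ℂ e_p`.
  obtain ⟨f, hf⟩ := Module.Projective.exists_dual_eq_one ℂ (youngIdempotent_ne_zero p)
  have key : ∀ a x, youngIdempotent p * a * spechtVal p x =
      f (youngIdempotent p * a * spechtVal p x) • youngIdempotent p := by
    intro a x
    obtain ⟨z, hz⟩ := exists_youngIdempotent_mul_mul p (a * spechtVal p x)
    have h1 : youngIdempotent p * a * spechtVal p x = z • youngIdempotent p := by
      rw [← hz, mul_assoc, mul_assoc, mul_assoc, spechtVal_mul_youngIdempotent]
    rw [h1, map_smul, hf, smul_eq_mul, mul_one]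
  let F : MonoidAlgebra ℂ (Equiv.Perm (Fin n)) →ₗ[ℂ] Module.Dual ℂ (Specht p) :=
    LinearMap.mk₂ ℂ (fun a x => f (youngIdempotent p * a * spechtVal p x))
      (by intros; simp [mul_add, add_mul]) (by intros; simp)
      (by intros; simp [mul_add]) (by intros; simp)
  have hF : LinearMap.range F = ⊤ := by
    have h1 : (LinearMap.range F).dualCoannihilator = ⊥ := by
      rw [eq_bot_iff]
      intro x hx
      rw [Submodule.mem_dualCoannihilator] at hx
      refine eq_zero_of_forall_youngIdempotent_mul fun a => ?_
      rw [key]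
      have h2 : f (youngIdempotent p * a * spechtVal p x) = 0 := hx (F a) ⟨a, rfl⟩
      rw [h2, zero_smul]
    have h2 := Subspace.dualCoannihilator_dualAnnihilator_eq (W := LinearMap.range F)
    rw [h1, Submodule.dualAnnihilator_bot] at h2
    exact h2.symm
  obtain ⟨a, ha⟩ := LinearMap.range_eq_top.1 hF φ
  refine ⟨a, fun x => ?_⟩
  rw [key, ← ha]
  rfl

variable {X : Type*} [AddCommGroup X] [Module ℂ X]
  (r : Representation ℂ (Equiv.Perm (Fin n)) X)

theorem asAlgebraHom_mul_apply {G : Type*} [Group G] (r : Representation ℂ G X)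
    (a b : MonoidAlgebra ℂ G) (x : X) :
    r.asAlgebraHom (a * b) x = r.asAlgebraHom a (r.asAlgebraHom b x) := by
  rw [map_mul, Module.End.mul_apply]

/-- The space `e_p X`, which is the multiplicity space of the Specht module of `p` in `X`. -/
def multSpace (p : n.Partition) : Submodule ℂ X :=
  LinearMap.range (r.asAlgebraHom (youngIdempotent p))

theorem mem_multSpace {p : n.Partition} {x : X} :
    x ∈ multSpace r p ↔ r.asAlgebraHom (youngIdempotent p) x = x := by
  constructor
  · rintro ⟨y, rfl⟩
    rw [← asAlgebraHom_mul_apply, youngIdempotent_mul_self]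
  · intro h
    exact ⟨x, h⟩

theorem asAlgebraHom_mem_multSpace (p : n.Partition) (x : X) :
    r.asAlgebraHom (youngIdempotent p) x ∈ multSpace r p := ⟨x, rfl⟩

theorem range_asAlgebraHom_youngSymmetrizer (p : n.Partition) :
    LinearMap.range (r.asAlgebraHom (youngSymmetrizer p)) = multSpace r p := by
  obtain ⟨z, hz, h⟩ := exists_youngSymmetrizer_eq_smul p
  rw [h, map_smul, LinearMap.range_smul _ _ hz, multSpace]

/-- The bilinear action of elements of a Specht module on a representation. -/
def spechtAct (p : n.Partition) : Specht p →ₗ[ℂ] X →ₗ[ℂ] X :=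
  r.asAlgebraHom.toLinearMap ∘ₗ (spechtVal p).restrictScalars ℂ

theorem spechtAct_apply {p : n.Partition} (z : Specht p) (x : X) :
    spechtAct r p z x = r.asAlgebraHom (spechtVal p z) x := rfl

theorem spechtAct_smul {p : n.Partition} (a : MonoidAlgebra ℂ (Equiv.Perm (Fin n)))
    (z : Specht p) (x : X) :
    spechtAct r p (a • z) x = r.asAlgebraHom a (spechtAct r p z x) := by
  rw [spechtAct_apply, map_smul, smul_eq_mul, asAlgebraHom_mul_apply, spechtAct_apply]

theorem spechtAct_spechtGen {p : n.Partition} {x : X} (hx : x ∈ multSpace r p) :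
    spechtAct r p (spechtGen p) x = x := by
  rw [spechtAct_apply, spechtVal_spechtGen, (mem_multSpace r).1 hx]

/-- For `a` representing the coordinate functional of `b p j`, the element `e_p a` sends the sum to
`w p j` and annihilates every other term. -/
theorem eq_zero_of_sum_spechtAct {J : n.Partition → Type*} [∀ p, Fintype (J p)]
    (b : ∀ p, Module.Basis (J p) ℂ (Specht p)) (w : ∀ p, J p → X)
    (hw : ∀ p j, w p j ∈ multSpace r p) (h : ∑ p, ∑ j, spechtAct r p (b p j) (w p j) = 0)
    (p : n.Partition) (j : J p) : w p j = 0 := by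
  classical
  obtain ⟨a, ha⟩ := exists_spechtDual ((b p).coord j)
  have h1 := congrArg (r.asAlgebraHom (youngIdempotent p * a)) h
  rw [map_zero, map_sum, Finset.sum_eq_single p, map_sum, Finset.sum_eq_single j] at h1
  · rw [spechtAct_apply, ← asAlgebraHom_mul_apply, ha, Module.Basis.coord_apply,
      Module.Basis.repr_self, Finsupp.single_eq_same, one_smul, (mem_multSpace r).1 (hw p j)] at h1
    exact h1
  · intro j' _ hj
    rw [spechtAct_apply, ← asAlgebraHom_mul_apply, ha, Module.Basis.coord_apply,
      Module.Basis.repr_self, Finsupp.single_eq_of_ne (Ne.symm hj), zero_smul, map_zero,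
      LinearMap.zero_apply]
  · simp
  · intro q _ hq
    rw [map_sum]
    refine Finset.sum_eq_zero fun j' _ => ?_
    rw [spechtAct_apply, ← asAlgebraHom_mul_apply, ← spechtVal_mul_youngIdempotent, ← mul_assoc,
      mul_assoc _ a, youngIdempotent_mul_mul_eq_zero (Ne.symm hq), map_zero, LinearMap.zero_apply]
  · simp

/-- The span is stable under the group algebra and contains all `e_p b x`. Since the left ideal
generated by the `e_p b` contains `1`, it contains `x`. -/
theorem mem_span_spechtAct (x : X) : x ∈ Submodule.span ℂ
    {y | ∃ (p : n.Partition) (z : Specht p), ∃ w ∈ multSpace r p, y = spechtAct r p z w} := by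
  set S := Submodule.span ℂ
    {y | ∃ (p : n.Partition) (z : Specht p), ∃ w ∈ multSpace r p, y = spechtAct r p z w} with hS
  have hstab : ∀ a, ∀ y ∈ S, r.asAlgebraHom a y ∈ S := by
    intro a y hy
    induction hy using Submodule.span_induction with
    | mem y hy =>
      obtain ⟨p, z, w, hw, rfl⟩ := hy
      rw [← spechtAct_smul]
      exact Submodule.subset_span ⟨p, a • z, w, hw, rfl⟩
    | zero => rw [map_zero]; exact S.zero_mem
    | add y z _ _ hy hz => rw [map_add]; exact S.add_mem hy hz
    | smul c y _ hy => rw [map_smul]; exact S.smul_mem c hy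
  have hall : ∀ a ∈ Ideal.span (Set.range fun p : n.Partition ×
      MonoidAlgebra ℂ (Equiv.Perm (Fin n)) => youngIdempotent p.1 * p.2),
      r.asAlgebraHom a x ∈ S := by
    intro a ha
    induction ha using Submodule.span_induction with
    | mem a ha =>
      obtain ⟨⟨p, b⟩, rfl⟩ := ha
      rw [asAlgebraHom_mul_apply]
      refine Submodule.subset_span ⟨p, spechtGen p, _,
        asAlgebraHom_mem_multSpace r p (r.asAlgebraHom b x), ?_⟩
      rw [spechtAct_spechtGen r (asAlgebraHom_mem_multSpace r p _)]
    | zero => rw [map_zero]; exact S.zero_mem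
    | add y z _ _ hy hz => rw [map_add]; exact S.add_mem hy hz
    | smul c y _ hy => rw [smul_eq_mul, asAlgebraHom_mul_apply]; exact hstab c _ hy
  have h1 := hall 1 (by rw [ideal_span_youngIdempotent]; exact Submodule.mem_top)
  simpa using h1

/-- A basis of a representation adapted to its isotypic decomposition. -/
def isotypicBasis {J κ : n.Partition → Type*} [∀ p, Fintype (J p)] [∀ p, Fintype (κ p)]
    (b : ∀ p, Module.Basis (J p) ℂ (Specht p)) (v : ∀ p, Module.Basis (κ p) ℂ (multSpace r p)) :
    Module.Basis (Σ p, J p × κ p) ℂ X :=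
  Module.Basis.mk (v := fun i : Σ p, J p × κ p => spechtAct r i.1 (b i.1 i.2.1) (v i.1 i.2.2))
    (by
      rw [Fintype.linearIndependent_iff]
      intro g hg
      rw [Fintype.sum_sigma] at hg
      simp_rw [Fintype.sum_prod_type] at hg
      rintro ⟨p, j, k⟩
      have h1 := eq_zero_of_sum_spechtAct r b
        (fun p j => ∑ k, g ⟨p, j, k⟩ • (v p k : X))
        (fun p j => Submodule.sum_mem _ fun k _ => Submodule.smul_mem _ _ (v p k).2)
        (by rw [← hg]; simp only [map_sum, map_smul]) p j
      have h2 : ∑ k, g ⟨p, j, k⟩ • v p k = 0 := Subtype.ext (by rw [Submodule.coe_sum]; exact h1)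
      exact Fintype.linearIndependent_iff.1 (v p).linearIndependent _ h2 k)
    (by
      intro x _
      refine Submodule.span_le.2 ?_ (mem_span_spechtAct r x)
      rintro _ ⟨p, z, w, hw, rfl⟩
      rw [SetLike.mem_coe, ← (b p).sum_repr z]
      have h1 : w = ∑ k, (v p).repr ⟨w, hw⟩ k • (v p k : X) := by
        have h2 := congrArg Subtype.val ((v p).sum_repr ⟨w, hw⟩)
        rw [Submodule.coe_sum] at h2
        exact h2.symm
      rw [h1, map_sum]
      refine Submodule.sum_mem _ fun k _ => ?_
      rw [map_sum, LinearMap.sum_apply]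
      refine Submodule.sum_mem _ fun j _ => ?_
      rw [map_smul, map_smul, LinearMap.smul_apply]
      exact Submodule.smul_mem _ _ (Submodule.smul_mem _ _
        (Submodule.subset_span ⟨⟨p, j, k⟩, rfl⟩)))

theorem isotypicBasis_apply {J κ : n.Partition → Type*} [∀ p, Fintype (J p)] [∀ p, Fintype (κ p)]
    (b : ∀ p, Module.Basis (J p) ℂ (Specht p)) (v : ∀ p, Module.Basis (κ p) ℂ (multSpace r p))
    (p : n.Partition) (j : J p) (k : κ p) :
    isotypicBasis r b v ⟨p, j, k⟩ = spechtAct r p (b p j) (v p k) :=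
  Module.Basis.mk_apply _ _ _

end Isotypic


/-! ### Two commuting actions -/

theorem commute_asAlgebraHom_of_commute {G H X : Type*} [Group G] [Group H] [AddCommGroup X]
    [Module ℂ X] {r : Representation ℂ G X} {f : Module.End ℂ X} (h : ∀ g, Commute (r g) f)
    (a : MonoidAlgebra ℂ G) : Commute (r.asAlgebraHom a) f := by
  induction a using MonoidAlgebra.induction_on with
  | of g => rw [Representation.asAlgebraHom_of]; exact h g
  | add a b ha hb => rw [map_add]; exact ha.add_left hb
  | smul c a ha => rw [map_smul]; exact ha.smul_left c

section TwoActions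

variable {k : ℕ} {X : Type*} [AddCommGroup X] [Module ℂ X]
  {r₁ r₂ r : Representation ℂ (Equiv.Perm (Fin k)) X}

variable (r₁ r₂) in
/-- The multiplicity space of `p ⊠ q` in a space with two commuting actions. -/
def multSpace₂ (p q : k.Partition) : Submodule ℂ X := multSpace r₁ p ⊓ multSpace r₂ q

variable (r₁ r₂) in
/-- The bilinear action of elements of `p ⊠ q` on a space with two commuting actions. -/
def spechtAct₂ (p q : k.Partition) : (Specht p ⊗[ℂ] Specht q) →ₗ[ℂ] X →ₗ[ℂ] X :=
  TensorProduct.lift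
    ((LinearMap.mul ℂ (Module.End ℂ X)).compl₁₂ (spechtAct r₁ p) (spechtAct r₂ q))

theorem spechtAct₂_tmul {p q : k.Partition} (y : Specht p) (z : Specht q) (x : X) :
    spechtAct₂ r₁ r₂ p q (y ⊗ₜ z) x = spechtAct r₁ p y (spechtAct r₂ q z x) := rfl

theorem commute_spechtAct (hc : ∀ σ τ, Commute (r₁ σ) (r₂ τ))
    (a b : MonoidAlgebra ℂ (Equiv.Perm (Fin k))) :
    Commute (r₁.asAlgebraHom a) (r₂.asAlgebraHom b) :=
  commute_asAlgebraHom_of_commute (H := Equiv.Perm (Fin k))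
    (fun g => (commute_asAlgebraHom_of_commute (H := Equiv.Perm (Fin k))
      (fun g' => (hc g g').symm) b).symm) a

theorem spechtAct_mem_multSpace (hc : ∀ σ τ, Commute (r₁ σ) (r₂ τ)) {p q : k.Partition}
    (z : Specht q) {x : X} (hx : x ∈ multSpace r₁ p) : spechtAct r₂ q z x ∈ multSpace r₁ p := by
  rw [mem_multSpace] at hx ⊢
  rw [spechtAct_apply]
  conv_rhs => rw [← hx]
  exact LinearMap.congr_fun (commute_spechtAct hc _ _).eq x

theorem spechtRep_asAlgebraHom {n : ℕ} {p : n.Partition}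
    (a : MonoidAlgebra ℂ (Equiv.Perm (Fin n))) (z : Specht p) :
    (spechtRep p).asAlgebraHom a z = a • z := by
  induction a using MonoidAlgebra.induction_on with
  | of g => rw [Representation.asAlgebraHom_of]; rfl
  | add a b ha hb => rw [map_add, LinearMap.add_apply, ha, hb, add_smul]
  | smul c a ha => rw [map_smul, LinearMap.smul_apply, ha, smul_assoc]

theorem spechtRep_apply {n : ℕ} {p : n.Partition} (σ : Equiv.Perm (Fin n)) (z : Specht p) :
    spechtRep p σ z = MonoidAlgebra.of ℂ _ σ • z := rfl

theorem spechtAct_spechtRep {n : ℕ} {X : Type*} [AddCommGroup X] [Module ℂ X]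
    (r : Representation ℂ (Equiv.Perm (Fin n)) X) {p : n.Partition} (σ : Equiv.Perm (Fin n))
    (z : Specht p) (x : X) :
    spechtAct r p (spechtRep p σ z) x = r σ (spechtAct r p z x) := by
  rw [spechtRep_apply, spechtAct_smul, Representation.asAlgebraHom_of]

theorem asAlgebraHom_spechtAct₂ (hc : ∀ σ τ, Commute (r₁ σ) (r₂ τ))
    (hr : ∀ σ x, r σ x = r₁ σ (r₂ σ x)) {p q : k.Partition}
    (a : MonoidAlgebra ℂ (Equiv.Perm (Fin k))) (z : Specht p ⊗[ℂ] Specht q) (x : X) :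
    r.asAlgebraHom a (spechtAct₂ r₁ r₂ p q z x) =
      spechtAct₂ r₁ r₂ p q (((spechtRep p).tprod (spechtRep q)).asAlgebraHom a z) x := by
  induction a using MonoidAlgebra.induction_on with
  | of σ =>
    rw [Representation.asAlgebraHom_of, Representation.asAlgebraHom_of, Representation.tprod_apply]
    induction z using TensorProduct.induction_on with
    | zero => simp
    | add y z hy hz => simp only [map_add, LinearMap.add_apply, hy, hz]
    | tmul y z =>
      rw [TensorProduct.map_tmul, spechtAct₂_tmul, spechtAct₂_tmul, spechtAct_spechtRep,
        spechtAct_spechtRep, hr]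
      congr 1
      have := commute_asAlgebraHom_of_commute (H := Equiv.Perm (Fin k)) (r := r₁) (f := r₂ σ)
        (fun g => hc g σ) (spechtVal p y)
      exact (LinearMap.congr_fun this.eq _).symm
  | add a b ha hb => simp only [map_add, LinearMap.add_apply, ha, hb]
  | smul c a ha => simp only [map_smul, LinearMap.smul_apply, ha]

/-- The independence for a single action is applied twice, first to `r₁` and then to `r₂`. The
second action keeps vectors inside the multiplicity spaces of the first. -/
theorem eq_zero_of_sum_spechtAct₂ (hc : ∀ σ τ, Commute (r₁ σ) (r₂ τ))
    {I : k.Partition → k.Partition → Type*} [∀ p q, Fintype (I p q)]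
    (m : ∀ p q, Module.Basis (I p q) ℂ (multSpace₂ r₁ r₂ p q))
    (z : ∀ p q, I p q → Specht p ⊗[ℂ] Specht q)
    (h : ∑ p, ∑ q, ∑ i, spechtAct₂ r₁ r₂ p q (z p q i) (m p q i : X) = 0)
    (p q : k.Partition) (i : I p q) : z p q i = 0 := by
  let b : ∀ p : k.Partition, Module.Basis _ ℂ (Specht p) := fun p => Module.finBasis ℂ (Specht p)
  obtain ⟨c, hz⟩ : ∃ c : ∀ p q, I p q → Fin _ × Fin _ → ℂ,
      ∀ p q i, z p q i = ∑ j, ∑ l, c p q i (j, l) • (b p j ⊗ₜ[ℂ] b q l) := by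
    refine ⟨fun p q i => ((b p).tensorProduct (b q)).repr (z p q i), fun p q i => ?_⟩
    conv_lhs => rw [← ((b p).tensorProduct (b q)).sum_repr (z p q i), Fintype.sum_prod_type]
    simp only [Module.Basis.tensorProduct_apply]
  have h1 := eq_zero_of_sum_spechtAct r₁ b
    (fun p j => ∑ q, ∑ l, spechtAct r₂ q (b q l) (∑ i, c p q i (j, l) • (m p q i : X)))
    (fun p j => Submodule.sum_mem _ fun q _ => Submodule.sum_mem _ fun l _ =>
      spechtAct_mem_multSpace hc _ (Submodule.sum_mem _ fun i _ =>
        Submodule.smul_mem _ _ (m p q i).2.1)) (by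
      rw [← h]
      refine Finset.sum_congr rfl fun p _ => ?_
      simp only [hz, map_sum, LinearMap.sum_apply, map_smul, LinearMap.smul_apply, spechtAct₂_tmul]
      rw [Finset.sum_comm]
      refine Finset.sum_congr rfl fun q _ => ?_
      conv_rhs => rw [Finset.sum_comm]
      refine Finset.sum_congr rfl fun j _ => ?_
      rw [Finset.sum_comm])
  have h3 : ∀ j l, c p q i (j, l) = 0 := by
    intro j l
    have h4 := eq_zero_of_sum_spechtAct r₂ b
      (fun q l => ∑ i, c p q i (j, l) • (m p q i : X))
      (fun q l => Submodule.sum_mem _ fun i _ => Submodule.smul_mem _ _ (m p q i).2.2) (h1 p j) q l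
    have h5 : ∑ i, c p q i (j, l) • m p q i = 0 := Subtype.ext (by rw [Submodule.coe_sum]; exact h4)
    exact Fintype.linearIndependent_iff.1 (m p q).linearIndependent _ h5 i
  rw [hz]
  simp [h3]

/-- A vector of `e_p X` for the first action is decomposed under the second. Applying `e_p` to its
components, which commutes with the second action, moves them into the intersection of the two
multiplicity spaces. -/
theorem mem_span_spechtAct₂ (hc : ∀ σ τ, Commute (r₁ σ) (r₂ τ)) (x : X) : x ∈ Submodule.span ℂ
    {y | ∃ (p q : k.Partition) (z : Specht p ⊗[ℂ] Specht q), ∃ w ∈ multSpace₂ r₁ r₂ p q,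
      y = spechtAct₂ r₁ r₂ p q z w} := by
  refine Submodule.span_le.2 ?_ (mem_span_spechtAct r₁ x)
  rintro _ ⟨p, y, w, hw, rfl⟩
  have h1 := Submodule.mem_map_of_mem (f := spechtAct r₁ p y ∘ₗ
    r₁.asAlgebraHom (youngIdempotent p)) (mem_span_spechtAct r₂ w)
  rw [Submodule.map_span, LinearMap.comp_apply, (mem_multSpace r₁).1 hw] at h1
  refine Submodule.span_mono ?_ h1
  rintro _ ⟨_, ⟨q, z, u, hu, rfl⟩, rfl⟩
  refine ⟨p, q, y ⊗ₜ z, r₁.asAlgebraHom (youngIdempotent p) u,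
    ⟨asAlgebraHom_mem_multSpace r₁ p u, ?_⟩, ?_⟩
  · rw [SetLike.mem_coe, mem_multSpace]
    rw [mem_multSpace] at hu
    conv_rhs => rw [← hu]
    exact (LinearMap.congr_fun (commute_spechtAct hc _ _).eq u).symm
  · rw [spechtAct₂_tmul, LinearMap.comp_apply]
    congr 1
    exact LinearMap.congr_fun (commute_spechtAct hc _ _).eq u

theorem spechtAct₂_mem_multSpace (hc : ∀ σ τ, Commute (r₁ σ) (r₂ τ))
    (hr : ∀ σ x, r σ x = r₁ σ (r₂ σ x)) {p q ν : k.Partition} {z : Specht p ⊗[ℂ] Specht q}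
    (hz : z ∈ multSpace ((spechtRep p).tprod (spechtRep q)) ν) (x : X) :
    spechtAct₂ r₁ r₂ p q z x ∈ multSpace r ν := by
  rw [mem_multSpace] at hz ⊢
  rw [asAlgebraHom_spechtAct₂ hc hr, hz]

/-- A basis of the multiplicity space of the Specht module of `ν` for the diagonal action. -/
def diagBasis (hc : ∀ σ τ, Commute (r₁ σ) (r₂ τ)) (hr : ∀ σ x, r σ x = r₁ σ (r₂ σ x))
    (ν : k.Partition) {I K : k.Partition → k.Partition → Type*}
    [∀ p q, Fintype (I p q)] [∀ p q, Fintype (K p q)]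
    (m : ∀ p q, Module.Basis (I p q) ℂ (multSpace₂ r₁ r₂ p q))
    (ζ : ∀ p q, Module.Basis (K p q) ℂ (multSpace ((spechtRep p).tprod (spechtRep q)) ν)) :
    Module.Basis (Σ a : k.Partition × k.Partition, I a.1 a.2 × K a.1 a.2) ℂ (multSpace r ν) :=
  Module.Basis.mk
    (v := fun i : Σ a : k.Partition × k.Partition, I a.1 a.2 × K a.1 a.2 =>
      (⟨spechtAct₂ r₁ r₂ i.1.1 i.1.2 (ζ _ _ i.2.2) (m _ _ i.2.1),
        spechtAct₂_mem_multSpace hc hr (ζ _ _ i.2.2).2 _⟩ : multSpace r ν))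
    (by
      rw [Fintype.linearIndependent_iff]
      intro g hg
      have hg' := congrArg Subtype.val hg
      rw [Submodule.coe_sum, Fintype.sum_sigma, Fintype.sum_prod_type] at hg'
      simp_rw [Fintype.sum_prod_type] at hg'
      rintro ⟨⟨p, q⟩, i, l⟩
      have h1 := eq_zero_of_sum_spechtAct₂ hc m
        (fun p q i => ∑ l, g ⟨(p, q), i, l⟩ • (ζ p q l : Specht p ⊗[ℂ] Specht q))
        (by
          refine Eq.trans ?_ hg'
          simp only [map_sum, map_smul, LinearMap.sum_apply, LinearMap.smul_apply]
          rfl) p q i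
      have h2 : ∑ l, g ⟨(p, q), i, l⟩ • ζ p q l = 0 :=
        Subtype.ext (by rw [Submodule.coe_sum]; exact h1)
      exact Fintype.linearIndependent_iff.1 (ζ p q).linearIndependent _ h2 l)
    (by
      rintro ⟨x, hx⟩ -
      rw [mem_multSpace] at hx
      let f : X →ₗ[ℂ] multSpace r ν := (r.asAlgebraHom (youngIdempotent ν)).codRestrict _
        (asAlgebraHom_mem_multSpace r ν)
      have h1 := Submodule.mem_map_of_mem (f := f)
        (mem_span_spechtAct₂ (r₁ := r₁) (r₂ := r₂) hc x)
      have h2 : f x = ⟨x, (mem_multSpace r).2 hx⟩ := Subtype.ext hx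
      rw [Submodule.map_span, h2] at h1
      refine Submodule.span_le.2 ?_ h1
      rintro _ ⟨_, ⟨p, q, z, w, hw, rfl⟩, rfl⟩
      -- The idempotent of `ν` for the diagonal action passes to the factor in `p ⊗ q`, leaving `w`
      -- unchanged.
      set z' := ((spechtRep p).tprod (spechtRep q)).asAlgebraHom (youngIdempotent ν) z
      have hz' : z' ∈ multSpace ((spechtRep p).tprod (spechtRep q)) ν := ⟨z, rfl⟩
      have h3 : f (spechtAct₂ r₁ r₂ p q z w) =
          ∑ i, ∑ l, ((m p q).repr ⟨w, hw⟩ i * (ζ p q).repr ⟨z', hz'⟩ l) •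
            (⟨spechtAct₂ r₁ r₂ p q (ζ _ _ l) (m _ _ i),
              spechtAct₂_mem_multSpace hc hr (ζ _ _ l).2 _⟩ : multSpace r ν) := by
        apply Subtype.ext
        have h4 := congrArg Subtype.val ((m p q).sum_repr ⟨w, hw⟩)
        have h5 := congrArg Subtype.val ((ζ p q).sum_repr ⟨z', hz'⟩)
        rw [Submodule.coe_sum] at h4 h5
        rw [LinearMap.codRestrict_apply, asAlgebraHom_spechtAct₂ hc hr, Submodule.coe_sum]
        simp_rw [Submodule.coe_sum]
        change spechtAct₂ r₁ r₂ p q (⟨z', hz'⟩ : multSpace _ ν) (⟨w, hw⟩ : multSpace₂ r₁ r₂ p q) = _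
        conv_lhs => rw [← h4, ← h5]
        rw [map_sum]
        refine Finset.sum_congr rfl fun i _ => ?_
        rw [map_sum, LinearMap.sum_apply]
        refine Finset.sum_congr rfl fun l _ => ?_
        simp only [Submodule.coe_smul, map_smul, LinearMap.smul_apply, smul_smul]
      rw [SetLike.mem_coe, h3]
      exact Submodule.sum_mem _ fun i _ => Submodule.sum_mem _ fun l _ => Submodule.smul_mem _ _
        (Submodule.subset_span ⟨⟨(p, q), i, l⟩, rfl⟩))

theorem diagBasis_apply (hc : ∀ σ τ, Commute (r₁ σ) (r₂ τ)) (hr : ∀ σ x, r σ x = r₁ σ (r₂ σ x))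
    (ν : k.Partition) {I K : k.Partition → k.Partition → Type*}
    [∀ p q, Fintype (I p q)] [∀ p q, Fintype (K p q)]
    (m : ∀ p q, Module.Basis (I p q) ℂ (multSpace₂ r₁ r₂ p q))
    (ζ : ∀ p q, Module.Basis (K p q) ℂ (multSpace ((spechtRep p).tprod (spechtRep q)) ν))
    (p q : k.Partition) (i : I p q) (l : K p q) :
    (diagBasis hc hr ν m ζ ⟨(p, q), i, l⟩ : X) = spechtAct₂ r₁ r₂ p q (ζ p q l) (m p q i) := by
  rw [diagBasis, Module.Basis.mk_apply]

end TwoActions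


/-! ### Eigenspaces of involutions -/

theorem asAlgebraHom_intertwine {G X Y : Type*} [Group G] [AddCommGroup X] [Module ℂ X]
    [AddCommGroup Y] [Module ℂ Y] {r : Representation ℂ G X} {r' : Representation ℂ G Y}
    {f : X →ₗ[ℂ] Y} (h : ∀ g x, f (r g x) = r' g (f x)) (a : MonoidAlgebra ℂ G) (x : X) :
    f (r.asAlgebraHom a x) = r'.asAlgebraHom a (f x) := by
  induction a using MonoidAlgebra.induction_on with
  | of g => rw [Representation.asAlgebraHom_of, Representation.asAlgebraHom_of]; exact h g x
  | add a b ha hb => rw [map_add, map_add, LinearMap.add_apply, map_add, ha, hb]; rfl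
  | smul c a ha => rw [map_smul, map_smul, LinearMap.smul_apply, map_smul, ha]; rfl

/-- The part of sign `s` of a subspace under an involution. -/
def signPart {X : Type*} [AddCommGroup X] [Module ℂ X] (E : Submodule ℂ X) (θ : X →ₗ[ℂ] X)
    (s : ℤˣ) : Submodule ℂ X := E ⊓ LinearMap.ker (θ - ((s : ℤ) : ℂ) • LinearMap.id)

theorem mem_signPart {X : Type*} [AddCommGroup X] [Module ℂ X] {E : Submodule ℂ X}
    {θ : X →ₗ[ℂ] X} {s : ℤˣ} {x : X} :
    x ∈ signPart E θ s ↔ x ∈ E ∧ θ x = ((s : ℤ) : ℂ) • x := by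
  simp [signPart, sub_eq_zero]

theorem units_sq_complex (s : ℤˣ) : ((s : ℤ) : ℂ) * ((s : ℤ) : ℂ) = 1 := by
  rcases Int.units_eq_one_or s with h | h <;> simp [h]

/-- The operator `(1 + s θ) / 2` is the projection of `E` onto the part of sign `s`, and the trace
of a projection is its rank. -/
theorem two_mul_finrank_signPart {X : Type*} [AddCommGroup X] [Module ℂ X] [Module.Finite ℂ X]
    {E : Submodule ℂ X} {θ : X →ₗ[ℂ] X} (hE : ∀ x ∈ E, θ x ∈ E) (hθ : ∀ x, θ (θ x) = x) (s : ℤˣ) :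
    (2 : ℂ) * Module.finrank ℂ (signPart E θ s) =
      Module.finrank ℂ E + ((s : ℤ) : ℂ) * LinearMap.trace ℂ E (θ.restrict hE) := by
  have h1 : LinearMap.IsProj ((signPart E θ s).comap E.subtype)
      ((2 : ℂ)⁻¹ • (LinearMap.id + ((s : ℤ) : ℂ) • θ.restrict hE)) := by
    constructor
    · intro x
      rw [Submodule.mem_comap, mem_signPart, Submodule.subtype_apply]
      refine ⟨Submodule.coe_mem _, ?_⟩
      simp only [LinearMap.smul_apply, LinearMap.add_apply, LinearMap.id_apply,
        Submodule.coe_smul, Submodule.coe_add, LinearMap.coe_restrict_apply,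
        map_smul, map_add, hθ, smul_add, smul_smul]
      rw [mul_left_comm ((s : ℤ) : ℂ) 2⁻¹ ((s : ℤ) : ℂ), units_sq_complex, mul_one, add_comm,
        mul_comm]
    · intro x hx
      rw [Submodule.mem_comap, mem_signPart] at hx
      apply Subtype.ext
      simp only [LinearMap.smul_apply, LinearMap.add_apply, LinearMap.id_apply,
        Submodule.coe_smul, Submodule.coe_add, LinearMap.coe_restrict_apply]
      have h2 := hx.2
      rw [Submodule.subtype_apply] at h2
      rw [h2, smul_smul, units_sq_complex, one_smul, ← two_smul ℂ, smul_smul]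
      norm_num
  have h2 := h1.trace
  have h3 : Module.finrank ℂ ((signPart E θ s).comap E.subtype) =
      Module.finrank ℂ (signPart E θ s) :=
    (Submodule.comapSubtypeEquivOfLe (inf_le_left : signPart E θ s ≤ E)).finrank_eq
  rw [map_smul, map_add, map_smul, LinearMap.trace_id, h3] at h2
  rw [← h2, smul_eq_mul, smul_eq_mul]
  ring

/-! ### An involution that exchanges two commuting actions -/

section Swap

variable {k : ℕ} {X : Type*} [AddCommGroup X] [Module ℂ X]
  {r₁ r₂ r : Representation ℂ (Equiv.Perm (Fin k)) X}
  (hc : ∀ σ τ, Commute (r₁ σ) (r₂ τ)) (hr : ∀ σ x, r σ x = r₁ σ (r₂ σ x))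

section Repr

variable (ν : k.Partition) {I K : k.Partition → k.Partition → Type*}
  [∀ p q, Fintype (I p q)] [∀ p q, Fintype (K p q)]
  (m : ∀ p q, Module.Basis (I p q) ℂ (multSpace₂ r₁ r₂ p q))
  (ζ : ∀ p q, Module.Basis (K p q) ℂ (multSpace ((spechtRep p).tprod (spechtRep q)) ν))

theorem spechtAct₂_eq_sum_diagBasis {p q : k.Partition} (w : multSpace₂ r₁ r₂ p q)
    (z : multSpace ((spechtRep p).tprod (spechtRep q)) ν) :
    (⟨spechtAct₂ r₁ r₂ p q z w, spechtAct₂_mem_multSpace hc hr z.2 _⟩ : multSpace r ν) =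
      ∑ i, ∑ l, ((m p q).repr w i * (ζ p q).repr z l) • diagBasis hc hr ν m ζ ⟨(p, q), i, l⟩ := by
  apply Subtype.ext
  have h4 := congrArg Subtype.val ((m p q).sum_repr w)
  have h5 := congrArg Subtype.val ((ζ p q).sum_repr z)
  rw [Submodule.coe_sum] at h4 h5
  rw [Submodule.coe_sum]
  simp_rw [Submodule.coe_sum]
  conv_lhs => rw [← h4, ← h5]
  rw [map_sum]
  refine Finset.sum_congr rfl fun i _ => ?_
  rw [map_sum, LinearMap.sum_apply]
  refine Finset.sum_congr rfl fun l _ => ?_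
  simp only [Submodule.coe_smul, diagBasis_apply, map_smul, LinearMap.smul_apply, smul_smul]

theorem diagBasis_repr_self {p q : k.Partition} (w : multSpace₂ r₁ r₂ p q)
    (z : multSpace ((spechtRep p).tprod (spechtRep q)) ν) (i : I p q) (l : K p q) :
    (diagBasis hc hr ν m ζ).repr ⟨spechtAct₂ r₁ r₂ p q z w,
      spechtAct₂_mem_multSpace hc hr z.2 _⟩ ⟨(p, q), i, l⟩ =
      (m p q).repr w i * (ζ p q).repr z l := by
  classical
  rw [spechtAct₂_eq_sum_diagBasis hc hr ν m ζ]
  simp only [map_sum, map_smul, Module.Basis.repr_self, Finsupp.coe_finsetSum, Finset.sum_apply,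
    Finsupp.smul_apply, smul_eq_mul]
  rw [Finset.sum_eq_single i, Finset.sum_eq_single l]
  · simp
  · intro l' _ h; rw [Finsupp.single_apply, if_neg (by simpa using h), mul_zero]
  · simp
  · intro i' _ h
    exact Finset.sum_eq_zero fun l' _ => by
      rw [Finsupp.single_apply, if_neg (by simp [h]), mul_zero]
  · simp

theorem diagBasis_repr_of_ne {p q p' q' : k.Partition} (hne : (p, q) ≠ (p', q'))
    (w : multSpace₂ r₁ r₂ p q)
    (z : multSpace ((spechtRep p).tprod (spechtRep q)) ν) (i : I p' q') (l : K p' q') :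
    (diagBasis hc hr ν m ζ).repr ⟨spechtAct₂ r₁ r₂ p q z w,
      spechtAct₂_mem_multSpace hc hr z.2 _⟩ ⟨(p', q'), i, l⟩ = 0 := by
  classical
  rw [spechtAct₂_eq_sum_diagBasis hc hr ν m ζ]
  simp only [map_sum, map_smul, Module.Basis.repr_self, Finsupp.coe_finsetSum, Finset.sum_apply,
    Finsupp.smul_apply, smul_eq_mul]
  refine Finset.sum_eq_zero fun i' _ => Finset.sum_eq_zero fun l' _ => ?_
  rw [Finsupp.single_apply, if_neg, mul_zero]
  intro h
  exact hne (Sigma.mk.inj_iff.1 h).1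

end Repr

variable {θ : X →ₗ[ℂ] X} (hθ : ∀ x, θ (θ x) = x)
  (hs : ∀ σ x, θ (r₁ σ x) = r₂ σ (θ x))

include hθ hs in
theorem swap_intertwine (σ : Equiv.Perm (Fin k)) (x : X) : θ (r₂ σ x) = r₁ σ (θ x) := by
  conv_lhs => rw [← hθ x, ← hs, hθ]

include hθ hs in
theorem swap_mem_multSpace₂ {p q : k.Partition} {x : X} (hx : x ∈ multSpace₂ r₁ r₂ p q) :
    θ x ∈ multSpace₂ r₁ r₂ q p := by
  obtain ⟨h1, h2⟩ := hx
  rw [SetLike.mem_coe, mem_multSpace] at h1 h2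
  constructor
  · rw [SetLike.mem_coe, mem_multSpace, ← asAlgebraHom_intertwine (swap_intertwine hθ hs), h2]
  · rw [SetLike.mem_coe, mem_multSpace, ← asAlgebraHom_intertwine hs, h1]

theorem comm_intertwine (p q : k.Partition) (σ : Equiv.Perm (Fin k))
    (z : Specht p ⊗[ℂ] Specht q) :
    (TensorProduct.comm ℂ _ _).toLinearMap (((spechtRep p).tprod (spechtRep q)) σ z) =
      ((spechtRep q).tprod (spechtRep p)) σ ((TensorProduct.comm ℂ _ _).toLinearMap z) := by
  rw [Representation.tprod_apply, Representation.tprod_apply]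
  induction z using TensorProduct.induction_on with
  | zero => simp
  | tmul x y => simp only [LinearEquiv.coe_coe, TensorProduct.map_tmul, TensorProduct.comm_tmul]
  | add x y hx hy => simp only [map_add, hx, hy]

theorem comm_mem_multSpace {p q ν : k.Partition} {z : Specht p ⊗[ℂ] Specht q}
    (hz : z ∈ multSpace ((spechtRep p).tprod (spechtRep q)) ν) :
    (TensorProduct.comm ℂ _ _).toLinearMap z ∈ multSpace ((spechtRep q).tprod (spechtRep p)) ν := by
  rw [mem_multSpace] at hz ⊢
  rw [← asAlgebraHom_intertwine (comm_intertwine p q), hz]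

include hc hθ hs in
theorem swap_spechtAct₂ {p q : k.Partition} (z : Specht p ⊗[ℂ] Specht q) (x : X) :
    θ (spechtAct₂ r₁ r₂ p q z x) =
      spechtAct₂ r₁ r₂ q p ((TensorProduct.comm ℂ _ _).toLinearMap z) (θ x) := by
  induction z using TensorProduct.induction_on with
  | zero => simp
  | tmul y z =>
    rw [LinearEquiv.coe_coe, TensorProduct.comm_tmul, spechtAct₂_tmul, spechtAct₂_tmul,
      spechtAct_apply, asAlgebraHom_intertwine hs, spechtAct_apply,
      asAlgebraHom_intertwine (swap_intertwine hθ hs)]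
    exact (LinearMap.congr_fun (commute_spechtAct hc _ _).eq _).symm
  | add x y hx hy => simp only [map_add, LinearMap.add_apply, hx, hy]

include hc hr hθ hs in
theorem swap_mem_multSpace {ν : k.Partition} {x : X} (hx : x ∈ multSpace r ν) :
    θ x ∈ multSpace r ν := by
  rw [mem_multSpace] at hx ⊢
  rw [← asAlgebraHom_intertwine (r := r), hx]
  intro σ x
  rw [hr, hr, hs, swap_intertwine hθ hs]
  exact (LinearMap.congr_fun (hc σ σ).eq _).symm

include hc hr in
theorem finrank_multSpace_diag [Module.Finite ℂ X] (ν : k.Partition) :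
    Module.finrank ℂ (multSpace r ν) = ∑ p, ∑ q, Module.finrank ℂ (multSpace₂ r₁ r₂ p q) *
      Module.finrank ℂ (multSpace ((spechtRep p).tprod (spechtRep q)) ν) := by
  rw [Module.finrank_eq_card_basis (diagBasis hc hr ν (fun p q => Module.finBasis ℂ _)
    (fun p q => Module.finBasis ℂ _))]
  simp [Fintype.sum_prod_type]

/-- In the basis `diagBasis`, `θ` carries the summand of `(p, q)` to that of `(q, p)`. Only `p = q`
meets the diagonal, and there `θ` is the tensor product of the two restricted involutions, so the
traces multiply. -/
theorem trace_swap_multSpace [Module.Finite ℂ X] (ν : k.Partition) :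
    LinearMap.trace ℂ (multSpace r ν)
      (θ.restrict fun _ hx => swap_mem_multSpace hc hr hθ hs hx) =
    ∑ p, LinearMap.trace ℂ (multSpace₂ r₁ r₂ p p)
        (θ.restrict fun _ hx => swap_mem_multSpace₂ hθ hs hx) *
      LinearMap.trace ℂ (multSpace ((spechtRep p).tprod (spechtRep p)) ν)
        ((TensorProduct.comm ℂ _ _).toLinearMap.restrict fun _ hx => comm_mem_multSpace hx) := by
  classical
  let m := fun p q => Module.finBasis ℂ (multSpace₂ r₁ r₂ p q)
  let ζ := fun p q => Module.finBasis ℂ (multSpace ((spechtRep p).tprod (spechtRep q)) ν)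
  rw [LinearMap.trace_eq_matrix_trace ℂ (diagBasis hc hr ν m ζ), Matrix.trace, Fintype.sum_sigma,
    Fintype.sum_prod_type]
  refine Finset.sum_congr rfl fun p _ => ?_
  have key : ∀ q i l, θ.restrict (fun _ hx => swap_mem_multSpace hc hr hθ hs hx)
      (diagBasis hc hr ν m ζ ⟨(p, q), i, l⟩) =
      ⟨spechtAct₂ r₁ r₂ q p ((⟨_, comm_mem_multSpace (ζ p q l).2⟩ : multSpace _ ν))
        (⟨_, swap_mem_multSpace₂ hθ hs (m p q i).2⟩ : multSpace₂ r₁ r₂ q p),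
        spechtAct₂_mem_multSpace hc hr (comm_mem_multSpace (ζ p q l).2) _⟩ := by
    intro q i l
    apply Subtype.ext
    rw [LinearMap.coe_restrict_apply, diagBasis_apply, swap_spechtAct₂ hc hθ hs]
  rw [Finset.sum_eq_single p]
  · rw [Fintype.sum_prod_type, LinearMap.trace_eq_matrix_trace ℂ (m p p),
      LinearMap.trace_eq_matrix_trace ℂ (ζ p p), Matrix.trace, Matrix.trace, Finset.sum_mul_sum]
    refine Finset.sum_congr rfl fun i _ => Finset.sum_congr rfl fun l _ => ?_
    rw [Matrix.diag_apply, LinearMap.toMatrix_apply, key, diagBasis_repr_self]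
    rw [Matrix.diag_apply, LinearMap.toMatrix_apply, Matrix.diag_apply, LinearMap.toMatrix_apply]
    rfl
  · intro q _ hq
    refine Finset.sum_eq_zero fun ⟨i, l⟩ _ => ?_
    rw [Matrix.diag_apply, LinearMap.toMatrix_apply, key, diagBasis_repr_of_ne]
    simp [hq]
  · simp

end Swap


/-! ### Restriction to `S_k × S_k` and to the diagonal -/

section Restriction

variable {k : ℕ}

theorem youngInclusion_castAdd (σ τ : Equiv.Perm (Fin k)) (i : Fin k) :
    youngInclusion k (σ, τ) (Fin.castAdd k i) = Fin.castAdd k (σ i) := by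
  simp [youngInclusion, -Fin.natAdd_eq_addNat]

theorem youngInclusion_natAdd (σ τ : Equiv.Perm (Fin k)) (i : Fin k) :
    youngInclusion k (σ, τ) (Fin.natAdd k i) = Fin.natAdd k (τ i) := by
  simp [youngInclusion, -Fin.natAdd_eq_addNat]

theorem blockSwap_castAdd (i : Fin k) : blockSwap k (Fin.castAdd k i) = Fin.natAdd k i :=
  finAddFlip_apply_castAdd i k

theorem blockSwap_natAdd (i : Fin k) : blockSwap k (Fin.natAdd k i) = Fin.castAdd k i :=
  finAddFlip_apply_natAdd i k

theorem blockSwap_mul_self : blockSwap k * blockSwap k = 1 := by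
  ext1 i
  refine Fin.addCases (fun i => ?_) (fun i => ?_) i <;>
    simp [-Fin.natAdd_eq_addNat, blockSwap_castAdd, blockSwap_natAdd]

theorem blockSwap_mul_youngInclusion (σ τ : Equiv.Perm (Fin k)) :
    blockSwap k * youngInclusion k (σ, τ) = youngInclusion k (τ, σ) * blockSwap k := by
  ext1 i
  refine Fin.addCases (fun i => ?_) (fun i => ?_) i <;>
    simp [-Fin.natAdd_eq_addNat, blockSwap_castAdd, blockSwap_natAdd, youngInclusion_castAdd, youngInclusion_natAdd]

variable {X : Type*} [AddCommGroup X] [Module ℂ X]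
  (R : Representation ℂ (Equiv.Perm (Fin (k + k))) X)

/-- The action of the first factor of `S_k × S_k`. -/
def leftRep : Representation ℂ (Equiv.Perm (Fin k)) X :=
  R.comp ((youngInclusion k).comp (MonoidHom.inl _ _))

/-- The action of the second factor of `S_k × S_k`. -/
def rightRep : Representation ℂ (Equiv.Perm (Fin k)) X :=
  R.comp ((youngInclusion k).comp (MonoidHom.inr _ _))

/-- The action of the diagonal of `S_k × S_k`. -/
def diagRep : Representation ℂ (Equiv.Perm (Fin k)) X :=
  R.comp ((youngInclusion k).comp ((MonoidHom.id _).prod (MonoidHom.id _)))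

theorem commute_leftRep_rightRep (σ τ : Equiv.Perm (Fin k)) :
    Commute (leftRep R σ) (rightRep R τ) := by
  change R (youngInclusion k (σ, 1)) * R (youngInclusion k (1, τ)) =
    R (youngInclusion k (1, τ)) * R (youngInclusion k (σ, 1))
  simp only [← map_mul, Prod.mk_mul_mk, one_mul, mul_one]

theorem leftRep_rightRep (σ τ : Equiv.Perm (Fin k)) (x : X) :
    leftRep R σ (rightRep R τ x) = R (youngInclusion k (σ, τ)) x := by
  change (R (youngInclusion k (σ, 1)) * R (youngInclusion k (1, τ))) x = _
  simp only [← map_mul, Prod.mk_mul_mk, one_mul, mul_one]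

theorem diagRep_apply (σ : Equiv.Perm (Fin k)) (x : X) :
    diagRep R σ x = leftRep R σ (rightRep R σ x) := by
  rw [leftRep_rightRep]
  rfl

theorem blockSwap_blockSwap (x : X) : R (blockSwap k) (R (blockSwap k) x) = x := by
  rw [← Module.End.mul_apply, ← map_mul, blockSwap_mul_self, map_one, Module.End.one_apply]

theorem blockSwap_leftRep (σ : Equiv.Perm (Fin k)) (x : X) :
    R (blockSwap k) (leftRep R σ x) = rightRep R σ (R (blockSwap k) x) := by
  change (R (blockSwap k) * R (youngInclusion k (σ, 1))) x =
    (R (youngInclusion k (1, σ)) * R (blockSwap k)) x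
  rw [← map_mul, blockSwap_mul_youngInclusion, map_mul]

end Restriction

/-! ### Branching and product coefficients as dimensions of multiplicity spaces -/

section Coefficients

variable {k : ℕ}

/-- The value of an intertwining map at the generator. -/
def branchingEval (μ : (k + k).Partition) (p q : k.Partition) :
    BranchingSpace μ p q →ₗ[ℂ] Specht μ where
  toFun f := f (spechtGen p ⊗ₜ spechtGen q)
  map_add' _ _ := rfl
  map_smul' _ _ := rfl

theorem branchingSpace_apply {μ : (k + k).Partition} {p q : k.Partition} (f : BranchingSpace μ p q)
    (a b : MonoidAlgebra ℂ (Equiv.Perm (Fin k))) (x : Specht p) (y : Specht q) :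
    f ((a • x) ⊗ₜ (b • y)) = (leftRep (spechtRep μ)).asAlgebraHom a
      ((rightRep (spechtRep μ)).asAlgebraHom b (f (x ⊗ₜ y))) := by
  have h1 : ∀ (σ τ : Equiv.Perm (Fin k)) x y, f (spechtRep p σ x ⊗ₜ spechtRep q τ y) =
      spechtRep μ (youngInclusion k (σ, τ)) (f (x ⊗ₜ y)) := fun σ τ x y =>
    Representation.IntertwiningMap.isIntertwining _ _ f (σ, τ) (x ⊗ₜ y)
  have h2 : ∀ y, f ((a • x) ⊗ₜ y) = (leftRep (spechtRep μ)).asAlgebraHom a (f (x ⊗ₜ y)) := by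
    intro y
    have := asAlgebraHom_intertwine (r := spechtRep p) (r' := leftRep (spechtRep μ))
      (f := f.toLinearMap ∘ₗ (TensorProduct.mk ℂ _ _).flip y) (fun g x => by
        have := h1 g 1 x y
        rw [map_one] at this
        exact this) a x
    rw [spechtRep_asAlgebraHom] at this
    exact this
  have h3 : f (x ⊗ₜ (b • y)) = (rightRep (spechtRep μ)).asAlgebraHom b (f (x ⊗ₜ y)) := by
    have := asAlgebraHom_intertwine (r := spechtRep q) (r' := rightRep (spechtRep μ))
      (f := f.toLinearMap ∘ₗ (TensorProduct.mk ℂ _ _) x) (fun g y => by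
        have := h1 1 g x y
        rw [map_one] at this
        exact this) b y
    rw [spechtRep_asAlgebraHom] at this
    exact this
  rw [h2, h3]

/-- The generators of the Specht modules generate `p ⊠ q`, so an intertwining map is recovered from
its value at their tensor product. -/
theorem branchingSpace_eq_spechtAct₂ {μ : (k + k).Partition} {p q : k.Partition}
    (f : BranchingSpace μ p q) (z : Specht p ⊗[ℂ] Specht q) :
    f z = spechtAct₂ (leftRep (spechtRep μ)) (rightRep (spechtRep μ)) p q z
      (branchingEval μ p q f) := by
  induction z using TensorProduct.induction_on with
  | zero => simp
  | tmul x y =>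
    rw [spechtAct₂_tmul, spechtAct_apply, spechtAct_apply]
    conv_lhs => rw [← spechtVal_smul_spechtGen x, ← spechtVal_smul_spechtGen y,
      branchingSpace_apply]
    rfl
  | add x y hx hy => rw [map_add, map_add, LinearMap.add_apply, hx, hy]

theorem branchingEval_injective (μ : (k + k).Partition) (p q : k.Partition) :
    Function.Injective (branchingEval μ p q) := fun f g h =>
  DFunLike.ext _ _ fun z => by
    rw [branchingSpace_eq_spechtAct₂ f, branchingSpace_eq_spechtAct₂ g, h]

theorem youngIdempotent_smul_spechtGen {n : ℕ} (p : n.Partition) :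
    youngIdempotent p • spechtGen p = spechtGen p := by
  rw [← spechtVal_spechtGen, spechtVal_smul_spechtGen]

/-- This is `Hom(A e, X) = e X` for the idempotent `e = e_p ⊗ e_q`. The value at the generator is
fixed by `e`, and conversely a vector fixed by `e` defines a map by acting on it. -/
theorem range_branchingEval (μ : (k + k).Partition) (p q : k.Partition) :
    LinearMap.range (branchingEval μ p q) =
      multSpace₂ (leftRep (spechtRep μ)) (rightRep (spechtRep μ)) p q := by
  apply le_antisymm
  · rintro _ ⟨f, rfl⟩
    constructor
    · rw [SetLike.mem_coe, mem_multSpace]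
      have := branchingSpace_apply f (youngIdempotent p) 1 (spechtGen p) (spechtGen q)
      rw [map_one, one_smul, Module.End.one_apply, youngIdempotent_smul_spechtGen] at this
      exact this.symm
    · rw [SetLike.mem_coe, mem_multSpace]
      have := branchingSpace_apply f 1 (youngIdempotent q) (spechtGen p) (spechtGen q)
      rw [map_one, one_smul, Module.End.one_apply, youngIdempotent_smul_spechtGen] at this
      exact this.symm
  · intro m hm
    refine ⟨LinearMap.intertwiningMap_of_isIntertwiningMap _ _
      ((spechtAct₂ (leftRep (spechtRep μ)) (rightRep (spechtRep μ)) p q).flip m) ?_, ?_⟩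
    · rintro ⟨σ, τ⟩ z
      rw [LinearMap.flip_apply, LinearMap.flip_apply]
      induction z using TensorProduct.induction_on with
      | zero => simp
      | tmul x y =>
        change spechtAct₂ _ _ p q (spechtRep p σ x ⊗ₜ spechtRep q τ y) m =
          spechtRep μ (youngInclusion k (σ, τ)) _
        rw [spechtAct₂_tmul, spechtAct₂_tmul, spechtAct_spechtRep, spechtAct_spechtRep,
          ← leftRep_rightRep]
        congr 1
        have := commute_asAlgebraHom_of_commute (H := Equiv.Perm (Fin k))
          (fun g => commute_leftRep_rightRep (spechtRep μ) g τ) (spechtVal p x)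
        exact LinearMap.congr_fun this.eq _
      | add x y hx hy => simp only [map_add, LinearMap.add_apply, hx, hy]
    · change spechtAct₂ _ _ p q (spechtGen p ⊗ₜ spechtGen q) m = m
      rw [spechtAct₂_tmul, spechtAct_spechtGen _ hm.2, spechtAct_spechtGen _ hm.1]

theorem finrank_multSpace₂ (μ : (k + k).Partition) (p q : k.Partition) :
    Module.finrank ℂ (multSpace₂ (leftRep (spechtRep μ)) (rightRep (spechtRep μ)) p q) =
      branchingCoeff μ p q := by
  rw [← range_branchingEval, LinearMap.finrank_range_of_inj (branchingEval_injective μ p q),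
    branchingCoeff]

/-- Exchange of factors fixes the tensor square of the generator, so evaluation carries the
involution on maps to the block swap on vectors. -/
theorem map_signedBranchingSpace (μ : (k + k).Partition) (p : k.Partition) (ε : ℤˣ) :
    (signedBranchingSpace μ p ε).map (branchingEval μ p p) =
      signPart (multSpace₂ (leftRep (spechtRep μ)) (rightRep (spechtRep μ)) p p)
        (spechtRep μ (blockSwap k)) ε := by
  rw [← range_branchingEval]
  ext m
  rw [mem_signPart]
  constructor
  · rintro ⟨f, hf, rfl⟩
    exact ⟨⟨f, rfl⟩, hf (spechtGen p ⊗ₜ spechtGen p)⟩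
  · rintro ⟨⟨f, rfl⟩, hf⟩
    refine ⟨f, fun z => ?_, rfl⟩
    rw [branchingSpace_eq_spechtAct₂, swap_spechtAct₂ (commute_leftRep_rightRep (spechtRep μ))
      (blockSwap_blockSwap (spechtRep μ)) (blockSwap_leftRep (spechtRep μ)), hf, map_smul,
      branchingSpace_eq_spechtAct₂ f z]
    simp

theorem finrank_signPart_multSpace₂ (μ : (k + k).Partition) (p : k.Partition) (ε : ℤˣ) :
    Module.finrank ℂ (signPart (multSpace₂ (leftRep (spechtRep μ)) (rightRep (spechtRep μ)) p p)
        (spechtRep μ (blockSwap k)) ε) = signedBranchingCoeff μ p ε := by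
  rw [← map_signedBranchingSpace, signedBranchingCoeff]
  exact (Submodule.equivMapOfInjective _ (branchingEval_injective μ p p) _).finrank_eq.symm

/-- The value of an intertwining map at the generator. -/
def productEval (ν p q : k.Partition) : ProductSpace ν p q →ₗ[ℂ] Specht p ⊗[ℂ] Specht q where
  toFun f := f (spechtGen ν)
  map_add' _ _ := rfl
  map_smul' _ _ := rfl

theorem productSpace_apply {ν p q : k.Partition} (f : ProductSpace ν p q)
    (a : MonoidAlgebra ℂ (Equiv.Perm (Fin k))) (x : Specht ν) :
    f (a • x) = ((spechtRep p).tprod (spechtRep q)).asAlgebraHom a (f x) := by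
  have := asAlgebraHom_intertwine (r := spechtRep ν) (r' := (spechtRep p).tprod (spechtRep q))
    (f := f.toLinearMap) (fun g x => Representation.IntertwiningMap.isIntertwining _ _ f g x) a x
  rw [spechtRep_asAlgebraHom] at this
  exact this

theorem productSpace_eq_spechtAct {ν p q : k.Partition} (f : ProductSpace ν p q) (x : Specht ν) :
    f x = spechtAct ((spechtRep p).tprod (spechtRep q)) ν x (productEval ν p q f) := by
  conv_lhs => rw [← spechtVal_smul_spechtGen x, productSpace_apply]
  rfl

theorem productEval_injective (ν p q : k.Partition) :
    Function.Injective (productEval ν p q) := fun f g h =>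
  DFunLike.ext _ _ fun z => by
    rw [productSpace_eq_spechtAct f, productSpace_eq_spechtAct g, h]

theorem range_productEval (ν p q : k.Partition) :
    LinearMap.range (productEval ν p q) = multSpace ((spechtRep p).tprod (spechtRep q)) ν := by
  apply le_antisymm
  · rintro _ ⟨f, rfl⟩
    rw [mem_multSpace]
    have := productSpace_apply f (youngIdempotent ν) (spechtGen ν)
    rw [youngIdempotent_smul_spechtGen] at this
    exact this.symm
  · intro m hm
    refine ⟨LinearMap.intertwiningMap_of_isIntertwiningMap _ _
      ((spechtAct ((spechtRep p).tprod (spechtRep q)) ν).flip m) ?_, ?_⟩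
    · intro σ z
      rw [LinearMap.flip_apply, LinearMap.flip_apply, spechtAct_spechtRep]
    · exact spechtAct_spechtGen _ hm

theorem finrank_multSpace_tprod (ν p q : k.Partition) :
    Module.finrank ℂ (multSpace ((spechtRep p).tprod (spechtRep q)) ν) = productCoeff ν p q := by
  rw [← range_productEval, LinearMap.finrank_range_of_inj (productEval_injective ν p q),
    productCoeff]

theorem map_signedProductSpace (ν p : k.Partition) (ε : ℤˣ) :
    (signedProductSpace ν p ε).map (productEval ν p p) =
      signPart (multSpace ((spechtRep p).tprod (spechtRep p)) ν)
        (TensorProduct.comm ℂ (Specht p) (Specht p)).toLinearMap ε := by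
  rw [← range_productEval]
  ext m
  rw [mem_signPart]
  constructor
  · rintro ⟨f, hf, rfl⟩
    exact ⟨⟨f, rfl⟩, hf (spechtGen ν)⟩
  · rintro ⟨⟨f, rfl⟩, hf⟩
    refine ⟨f, fun z => ?_, rfl⟩
    have h := asAlgebraHom_intertwine (comm_intertwine p p) (spechtVal ν z) (productEval ν p p f)
    rw [hf, map_smul] at h
    rw [productSpace_eq_spechtAct]
    exact h

theorem finrank_signPart_multSpace_tprod (ν p : k.Partition) (ε : ℤˣ) :
    Module.finrank ℂ (signPart (multSpace ((spechtRep p).tprod (spechtRep p)) ν)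
        (TensorProduct.comm ℂ (Specht p) (Specht p)).toLinearMap ε) = signedProductCoeff ν p ε := by
  rw [← map_signedProductSpace, signedProductCoeff]
  exact (Submodule.equivMapOfInjective _ (productEval_injective ν p p) _).finrank_eq.symm

end Coefficients


/-! ### Which Specht modules occur in tensor powers -/

section TensorPower

variable {n d : ℕ}

theorem colLen_zero_partitionDiagram (p : n.Partition) :
    (partitionDiagram p).colLen 0 = Multiset.card p.parts := by
  rw [← YoungDiagram.length_rowLens, partitionDiagram, YoungDiagram.rowLens_ofRowLens_eq_self
    fun x hx => p.parts_pos ((Multiset.mem_sort _).1 hx), Multiset.length_sort]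

theorem rowOf_lt (p : n.Partition) (i : Fin n) : rowOf p i < Multiset.card p.parts := by
  rw [← colLen_zero_partitionDiagram, ← YoungDiagram.mem_iff_lt_colLen]
  exact (partitionDiagram p).up_left_mem le_rfl (Nat.zero_le _) (rowOf_colOf_mem p i)

theorem tensorPermRep_youngSymmetrizer_apply (p : n.Partition) (w : (Fin n → Fin d) → ℂ)
    (j : Fin n → Fin d) :
    (tensorPermRep n d).asAlgebraHom (youngSymmetrizer p) w j =
      ∑ σ : Equiv.Perm (Fin n) with ∀ i, rowOf p (σ i) = rowOf p i,
        ∑ τ : Equiv.Perm (Fin n) with ∀ i, colOf p (τ i) = colOf p i,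
          ((Equiv.Perm.sign τ : ℤ) : ℂ) * w (j ∘ σ ∘ τ) := by
  rw [youngSymmetrizer, asAlgebraHom_mul_apply, rowSymmetrizer, colAntisymmetrizer, map_sum,
    LinearMap.sum_apply, Finset.sum_apply]
  refine Finset.sum_congr rfl fun σ _ => ?_
  rw [Representation.asAlgebraHom_of, map_sum, LinearMap.sum_apply, map_sum, Finset.sum_apply]
  refine Finset.sum_congr rfl fun τ _ => ?_
  rw [map_smul, Representation.asAlgebraHom_of]
  rfl

/-- The Young symmetrizer is applied to the basis vector whose index at a letter is the row of that
letter. In its coefficient at the same index, each row permutation contributes `1`, since a column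
permutation that also preserves rows is trivial. -/
theorem exists_ne_zero_mem_multSpace_tensorPermRep {p : n.Partition}
    (hp : Multiset.card p.parts ≤ d) : ∃ w ∈ multSpace (tensorPermRep n d) p, w ≠ 0 := by
  classical
  let f : Fin n → Fin d := fun i => ⟨rowOf p i, (rowOf_lt p i).trans_le hp⟩
  refine ⟨(tensorPermRep n d).asAlgebraHom (youngSymmetrizer p) (Pi.single f 1), ?_, fun h => ?_⟩
  · rw [← range_asAlgebraHom_youngSymmetrizer]
    exact ⟨_, rfl⟩
  · have h1 := congrFun h f
    rw [tensorPermRep_youngSymmetrizer_apply] at h1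
    have h2 : ∀ σ ∈ (Finset.univ.filter fun σ : Equiv.Perm (Fin n) =>
        ∀ i, rowOf p (σ i) = rowOf p i),
        (∑ τ : Equiv.Perm (Fin n) with ∀ i, colOf p (τ i) = colOf p i,
          ((Equiv.Perm.sign τ : ℤ) : ℂ) * (Pi.single f 1 : (Fin n → Fin d) → ℂ) (f ∘ σ ∘ τ)) =
        1 := by
      intro σ hσ
      simp only [Finset.mem_filter, Finset.mem_univ, true_and] at hσ
      rw [Finset.sum_eq_single 1]
      · have : f ∘ σ ∘ (1 : Equiv.Perm (Fin n)) = f := by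
          ext i; simp [f, hσ]
        rw [this, Pi.single_eq_same]; simp
      · intro τ hτ hne
        simp only [Finset.mem_filter, Finset.mem_univ, true_and] at hτ
        rw [Pi.single_eq_of_ne, mul_zero]
        intro h3
        apply hne
        ext1 i
        refine eq_of_rowOf_colOf p ?_ (hτ i)
        have h4 := congrArg Fin.val (congrFun h3 i)
        simpa [f, hσ] using h4
      · simp
    rw [Finset.sum_congr rfl h2, Finset.sum_const, nsmul_eq_mul, mul_one, Pi.zero_apply,
      Nat.cast_eq_zero, Finset.card_eq_zero] at h1
    exact Finset.notMem_empty (1 : Equiv.Perm (Fin n)) (h1 ▸ by simp)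

/-- The first column has more than `d` cells, so any multi-index repeats a value there. Exchanging
the two letters fixes the multi-index and reverses the sign, so already the column antisymmetrizer
acts as zero. -/
theorem asAlgebraHom_tensorPermRep_eq_zero {p : n.Partition} (hp : ¬ Multiset.card p.parts ≤ d) :
    (tensorPermRep n d).asAlgebraHom (youngIdempotent p) = 0 := by
  have key : (tensorPermRep n d).asAlgebraHom (colAntisymmetrizer p) = 0 := by
    refine LinearMap.ext fun w => funext fun j => ?_
    rw [not_le, ← colLen_zero_partitionDiagram] at hp
    have hL : ∀ a : Fin ((partitionDiagram p).colLen 0), ∃ i, rowOf p i = a ∧ colOf p i = 0 :=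
      fun a => exists_rowOf_colOf p (YoungDiagram.mem_iff_lt_colLen.2 a.2)
    choose L hL1 hL2 using hL
    obtain ⟨a, b, hab, hj⟩ := Fintype.exists_ne_map_eq_of_card_lt (fun a => j (L a)) (by simpa)
    have hne : L a ≠ L b := fun h => hab (Fin.ext (by rw [← hL1, ← hL1, h]))
    have h1 := of_mul_colAntisymmetrizer p (σ := Equiv.swap (L a) (L b)) (by
      intro x
      rw [Equiv.swap_apply_def]
      split_ifs <;> simp_all)
    rw [Equiv.Perm.sign_swap hne] at h1
    have h2 := congrFun (congrArg (fun x => (tensorPermRep n d).asAlgebraHom x w) h1) j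
    simp only [asAlgebraHom_mul_apply, Representation.asAlgebraHom_of] at h2
    have h3 : j ∘ Equiv.swap (L a) (L b) = j := by
      ext1 x
      rw [Function.comp_apply, Equiv.swap_apply_def]
      split_ifs <;> simp_all
    change (tensorPermRep n d).asAlgebraHom (colAntisymmetrizer p) w
      (j ∘ Equiv.swap (L a) (L b)) = _ at h2
    rw [h3] at h2
    simp only [Units.val_neg, Units.val_one, Int.cast_neg, Int.cast_one, map_smul,
      LinearMap.smul_apply, Pi.smul_apply, smul_eq_mul, neg_mul, one_mul] at h2
    simpa using self_eq_neg.1 h2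
  obtain ⟨z, -, hz⟩ := exists_youngIdempotent_eq_smul p
  rw [hz, map_smul, youngSymmetrizer, map_mul, key, mul_zero, smul_zero]

/-- If `z ≠ 0`, a functional equal to `1` at `z` gives `a` with `e_p a z = e_p`, which recovers `w`
from `z w`. -/
theorem spechtAct_injective {X : Type*} [AddCommGroup X] [Module ℂ X]
    (r : Representation ℂ (Equiv.Perm (Fin n)) X) {p : n.Partition} {w : X}
    (hw : w ∈ multSpace r p) (hw0 : w ≠ 0) {z : Specht p} (h : spechtAct r p z w = 0) : z = 0 := by
  by_contra hz
  obtain ⟨φ, hφ⟩ := Module.Projective.exists_dual_eq_one ℂ hz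
  obtain ⟨a, ha⟩ := exists_spechtDual φ
  have h1 := congrArg (r.asAlgebraHom (youngIdempotent p * a)) h
  rw [spechtAct_apply, ← asAlgebraHom_mul_apply, ha, hφ, one_smul, (mem_multSpace r).1 hw,
    map_zero] at h1
  exact hw0 h1

end TensorPower

/-! ### Constituents of the restriction have at most `d` parts -/

section Bounded

variable {k d : ℕ}

/-- Acting on a nonzero vector of its multiplicity space embeds `Specht μ` in the tensor power.
There the idempotent of a partition with too many parts, acting on the first or last `k` factors, is
zero. -/
theorem multSpace₂_eq_bot {μ : (k + k).Partition} (hμ : Multiset.card μ.parts ≤ d)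
    {p q : k.Partition} (hpq : ¬ (Multiset.card p.parts ≤ d ∧ Multiset.card q.parts ≤ d)) :
    multSpace₂ (leftRep (spechtRep μ)) (rightRep (spechtRep μ)) p q = ⊥ := by
  rw [eq_bot_iff]
  intro m hm
  obtain ⟨w, hw, hw0⟩ := exists_ne_zero_mem_multSpace_tensorPermRep hμ
  refine spechtAct_injective (tensorPermRep (k + k) d) hw hw0 ?_
  let F := (spechtAct (tensorPermRep (k + k) d) μ).flip w
  have hF : ∀ σ z, F (spechtRep μ σ z) = tensorPermRep (k + k) d σ (F z) := fun σ z =>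
    spechtAct_spechtRep _ _ _ _
  change F m = 0
  rw [not_and_or] at hpq
  rcases hpq with hp | hq
  · rw [← (mem_multSpace _).1 hm.1, asAlgebraHom_intertwine (r := leftRep (spechtRep μ))
      (r' := leftRep (tensorPermRep (k + k) d)) fun σ z => hF _ z]
    ext i
    -- Freezing the last `k` indices at those of `i` reduces the claim to the action of `S_k` on the
    -- `k`-th tensor power.
    let E : ((Fin (k + k) → Fin d) → ℂ) →ₗ[ℂ] ((Fin k → Fin d) → ℂ) :=
      LinearMap.funLeft ℂ ℂ fun j => Fin.append j fun a => i (Fin.natAdd k a)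
    have hE : ∀ σ u, E (leftRep (tensorPermRep (k + k) d) σ u) = tensorPermRep k d σ (E u) := by
      intro σ u
      ext j
      change u (Fin.append j (fun a => i (Fin.natAdd k a)) ∘ youngInclusion k (σ, 1)) =
        u (Fin.append (j ∘ σ) fun a => i (Fin.natAdd k a))
      congr 1
      ext a
      refine Fin.addCases (fun a => ?_) (fun a => ?_) a <;>
        simp [-Fin.natAdd_eq_addNat, youngInclusion_castAdd, youngInclusion_natAdd]
    have h1 : ∀ u : (Fin (k + k) → Fin d) → ℂ, u i = E u fun a => i (Fin.castAdd k a) := by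
      intro u
      change u i = u (Fin.append (fun a => i (Fin.castAdd k a)) fun a => i (Fin.natAdd k a))
      rw [Fin.append_castAdd_natAdd]
    refine (h1 _).trans ?_
    rw [asAlgebraHom_intertwine hE, asAlgebraHom_tensorPermRep_eq_zero hp]
    rfl
  · rw [← (mem_multSpace _).1 hm.2, asAlgebraHom_intertwine (r := rightRep (spechtRep μ))
      (r' := rightRep (tensorPermRep (k + k) d)) fun σ z => hF _ z]
    ext i
    let E : ((Fin (k + k) → Fin d) → ℂ) →ₗ[ℂ] ((Fin k → Fin d) → ℂ) :=
      LinearMap.funLeft ℂ ℂ fun j => Fin.append (fun a => i (Fin.castAdd k a)) j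
    have hE : ∀ σ u, E (rightRep (tensorPermRep (k + k) d) σ u) = tensorPermRep k d σ (E u) := by
      intro σ u
      ext j
      change u (Fin.append (fun a => i (Fin.castAdd k a)) j ∘ youngInclusion k (1, σ)) =
        u (Fin.append (fun a => i (Fin.castAdd k a)) (j ∘ σ))
      congr 1
      ext a
      refine Fin.addCases (fun a => ?_) (fun a => ?_) a <;>
        simp [-Fin.natAdd_eq_addNat, youngInclusion_castAdd, youngInclusion_natAdd]
    have h1 : ∀ u : (Fin (k + k) → Fin d) → ℂ, u i = E u fun a => i (Fin.natAdd k a) := by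
      intro u
      change u i = u (Fin.append (fun a => i (Fin.castAdd k a)) fun a => i (Fin.natAdd k a))
      rw [Fin.append_castAdd_natAdd]
    refine (h1 _).trans ?_
    rw [asAlgebraHom_intertwine hE, asAlgebraHom_tensorPermRep_eq_zero hq]
    rfl

theorem branchingCoeff_eq_zero {μ : (k + k).Partition} (hμ : Multiset.card μ.parts ≤ d)
    {p q : k.Partition} (hpq : ¬ (Multiset.card p.parts ≤ d ∧ Multiset.card q.parts ≤ d)) :
    branchingCoeff μ p q = 0 := by
  rw [← finrank_multSpace₂, multSpace₂_eq_bot hμ hpq, finrank_bot]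

end Bounded


/-! ### The block sizes as dimensions -/

section BlockSize

variable {k d : ℕ}

/-- The space of vectors of sign `s` in the multiplicity space of `ν` in the restriction of the
Specht module of `μ` to the diagonal of `S_k × S_k`. -/
abbrev blockSpace (μ : (k + k).Partition) (ν : k.Partition) (s : ℤˣ) : Submodule ℂ (Specht μ) :=
  signPart (multSpace (diagRep (spechtRep μ)) ν) (spechtRep μ (blockSwap k)) s

theorem sum_partition_eq_sum_bounded {M : Type*} [AddCommMonoid M] {f : k.Partition → M}
    (hf : ∀ p : k.Partition, ¬ Multiset.card p.parts ≤ d → f p = 0) :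
    ∑ p, f p = ∑ p : BoundedPartition k d, f p.1 := by
  rw [← Finset.sum_subtype (Finset.univ.filter fun p : k.Partition => Multiset.card p.parts ≤ d)
    (by simp) f]
  refine (Finset.sum_subset (Finset.subset_univ _) fun p _ hp => hf p ?_).symm
  simpa using hp

theorem finrank_diag_eq_sum {μ : (k + k).Partition} (hμ : Multiset.card μ.parts ≤ d)
    (ν : k.Partition) :
    Module.finrank ℂ (multSpace (diagRep (spechtRep μ)) ν) =
      ∑ p : BoundedPartition k d, ∑ q : BoundedPartition k d,
        branchingCoeff μ p.1 q.1 * productCoeff ν p.1 q.1 := by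
  rw [finrank_multSpace_diag (commute_leftRep_rightRep (spechtRep μ)) (diagRep_apply (spechtRep μ))]
  simp_rw [finrank_multSpace₂, finrank_multSpace_tprod]
  rw [sum_partition_eq_sum_bounded (d := d)]
  · refine Finset.sum_congr rfl fun p _ => sum_partition_eq_sum_bounded fun q hq => ?_
    rw [branchingCoeff_eq_zero hμ (fun h => hq h.2), zero_mul]
  · intro p hp
    refine Finset.sum_eq_zero fun q _ => ?_
    rw [branchingCoeff_eq_zero hμ (fun h => hp h.1), zero_mul]

/-- Each signed coefficient is half of a dimension plus `±` a trace. In the sum of products over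
`ε`, the terms linear in `ε` cancel and the product of the traces keeps the sign `s`. -/
theorem two_mul_sum_signed (μ : (k + k).Partition) (ν p : k.Partition) (s : ℤˣ) :
    (2 : ℂ) * ∑ ε : ℤˣ, (signedBranchingCoeff μ p ε * signedProductCoeff ν p (s * ε) : ℂ) =
      branchingCoeff μ p p * productCoeff ν p p + ((s : ℤ) : ℂ) *
        (LinearMap.trace ℂ (multSpace₂ (leftRep (spechtRep μ)) (rightRep (spechtRep μ)) p p)
          ((spechtRep μ (blockSwap k)).restrict fun _ hx => swap_mem_multSpace₂
            (blockSwap_blockSwap (spechtRep μ)) (blockSwap_leftRep (spechtRep μ)) hx) *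
        LinearMap.trace ℂ (multSpace ((spechtRep p).tprod (spechtRep p)) ν)
          ((TensorProduct.comm ℂ _ _).toLinearMap.restrict fun _ hx => comm_mem_multSpace hx)) := by
  have h1 := fun ε => two_mul_finrank_signPart (fun _ hx => swap_mem_multSpace₂
    (blockSwap_blockSwap (spechtRep μ)) (blockSwap_leftRep (spechtRep μ)) hx)
    (blockSwap_blockSwap (spechtRep μ)) (E := multSpace₂ (leftRep (spechtRep μ))
      (rightRep (spechtRep μ)) p p) ε
  have h2 := fun ε => two_mul_finrank_signPart (E := multSpace ((spechtRep p).tprod (spechtRep p)) ν)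
    (θ := (TensorProduct.comm ℂ (Specht p) (Specht p)).toLinearMap)
    (fun _ hx => comm_mem_multSpace hx) (by simp) ε
  simp only [finrank_multSpace₂, finrank_signPart_multSpace₂] at h1
  simp only [finrank_multSpace_tprod, finrank_signPart_multSpace_tprod] at h2
  generalize LinearMap.trace ℂ (multSpace₂ (leftRep (spechtRep μ)) (rightRep (spechtRep μ)) p p)
    _ = t at h1 ⊢
  generalize LinearMap.trace ℂ (multSpace ((spechtRep p).tprod (spechtRep p)) ν) _ = u at h2 ⊢
  have h3 : ∀ ε, (2 : ℂ) * 2 * (signedBranchingCoeff μ p ε * signedProductCoeff ν p (s * ε)) =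
      (branchingCoeff μ p p + ((ε : ℤ) : ℂ) * t) *
        (productCoeff ν p p + (((s * ε : ℤˣ) : ℤ) : ℂ) * u) := by
    intro ε
    rw [← h1, ← h2]
    ring
  have h4 : (2 : ℂ) * (2 * ∑ ε : ℤˣ,
      (signedBranchingCoeff μ p ε * signedProductCoeff ν p (s * ε) : ℂ)) =
      2 * (branchingCoeff μ p p * productCoeff ν p p + ((s : ℤ) : ℂ) * (t * u)) := by
    rw [← mul_assoc, Finset.mul_sum, Finset.sum_congr rfl fun ε _ => h3 ε, UnitsInt.univ,
      Finset.sum_pair (by decide)]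
    push_cast
    ring
  exact mul_left_cancel₀ two_ne_zero h4

/-- The dimension formula for eigenspaces is combined with the trace of the block swap; only the
terms with `p = q` depend on `s`. The identity is doubled to stay within natural numbers, and proved
over `ℂ` because of the traces. -/
theorem two_mul_finrank_blockSpace (μ : (k + k).Partition) (ν : k.Partition) (s : ℤˣ) :
    2 * Module.finrank ℂ (blockSpace μ ν s) =
      (∑ p : k.Partition, ∑ q : k.Partition,
        if p = q then 0 else branchingCoeff μ p q * productCoeff ν p q) +
      2 * ∑ p : k.Partition, ∑ ε : ℤˣ,
        signedBranchingCoeff μ p ε * signedProductCoeff ν p (s * ε) := by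
  have hc := commute_leftRep_rightRep (spechtRep μ)
  have hr := diagRep_apply (spechtRep μ)
  have hθ := blockSwap_blockSwap (spechtRep μ)
  have hs := blockSwap_leftRep (spechtRep μ)
  apply Nat.cast_injective (R := ℂ)
  push_cast
  have h1 := two_mul_finrank_signPart (fun _ hx => swap_mem_multSpace hc hr hθ hs (ν := ν) hx) hθ s
  rw [blockSpace, h1, trace_swap_multSpace hc hr hθ hs, finrank_multSpace_diag hc hr,
    Finset.mul_sum, Finset.mul_sum]
  simp_rw [two_mul_sum_signed]
  push_cast
  rw [← Finset.sum_add_distrib, ← Finset.sum_add_distrib]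
  refine Finset.sum_congr rfl fun p _ => ?_
  rw [← add_assoc]
  congr 1
  rw [← Finset.add_sum_erase _ _ (Finset.mem_univ p), add_comm,
    ← Finset.add_sum_erase _ _ (Finset.mem_univ p), if_pos rfl, zero_add, finrank_multSpace₂,
    finrank_multSpace_tprod]
  congr 1
  refine Finset.sum_congr rfl fun q hq => ?_
  rw [if_neg (Finset.ne_of_mem_erase hq).symm, finrank_multSpace₂, finrank_multSpace_tprod]

theorem signedBranchingCoeff_eq_zero {μ : (k + k).Partition} (hμ : Multiset.card μ.parts ≤ d)
    {p : k.Partition} (hp : ¬ Multiset.card p.parts ≤ d) (ε : ℤˣ) :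
    signedBranchingCoeff μ p ε = 0 := by
  have h := branchingCoeff_eq_zero hμ (p := p) (q := p) fun h => hp h.1
  rw [← finrank_signPart_multSpace₂]
  rw [← finrank_multSpace₂] at h
  exact Nat.eq_zero_of_le_zero (h ▸ Submodule.finrank_mono inf_le_left)

/-- Partitions with more than `d` parts contribute nothing. The doubled identity shows that the
off-diagonal sum is even, so the natural number division in `blockSize` is exact. -/
theorem finrank_blockSpace {μ : (k + k).Partition} (hμ : Multiset.card μ.parts ≤ d)
    (ν : k.Partition) (s : ℤˣ) : Module.finrank ℂ (blockSpace μ ν s) = blockSize d μ ν s := by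
  have h := two_mul_finrank_blockSpace μ ν s
  rw [sum_partition_eq_sum_bounded (d := d), sum_partition_eq_sum_bounded (d := d)] at h
  · have h1 : ∀ p : BoundedPartition k d, (∑ q : k.Partition,
        if p.1 = q then 0 else branchingCoeff μ p.1 q * productCoeff ν p.1 q) =
        ∑ q : BoundedPartition k d,
          if p = q then 0 else branchingCoeff μ p.1 q.1 * productCoeff ν p.1 q.1 := by
      intro p
      rw [sum_partition_eq_sum_bounded (d := d)]
      · simp only [Subtype.ext_iff]
      · intro q hq
        rw [branchingCoeff_eq_zero hμ (fun h => hq h.2), zero_mul, ite_self]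
    simp_rw [h1] at h
    rw [blockSize]
    omega
  · intro p hp
    refine Finset.sum_eq_zero fun ε _ => ?_
    rw [signedBranchingCoeff_eq_zero hμ hp, zero_mul]
  · intro p hp
    refine Finset.sum_eq_zero fun q _ => ?_
    rw [branchingCoeff_eq_zero hμ (fun h => hp h.1), zero_mul, ite_self]

theorem finrank_signPart_add {X : Type*} [AddCommGroup X] [Module ℂ X] [Module.Finite ℂ X]
    {E : Submodule ℂ X} {θ : X →ₗ[ℂ] X} (hE : ∀ x ∈ E, θ x ∈ E) (hθ : ∀ x, θ (θ x) = x) :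
    Module.finrank ℂ (signPart E θ 1) + Module.finrank ℂ (signPart E θ (-1)) =
      Module.finrank ℂ E := by
  have h1 := two_mul_finrank_signPart hE hθ 1
  have h2 := two_mul_finrank_signPart hE hθ (-1)
  apply Nat.cast_injective (R := ℂ)
  push_cast at h1 h2 ⊢
  linear_combination (h1 + h2) / 2

theorem blockSize_add {μ : (k + k).Partition} (hμ : Multiset.card μ.parts ≤ d) (ν : k.Partition) :
    blockSize d μ ν 1 + blockSize d μ ν (-1) =
      ∑ p : BoundedPartition k d, ∑ q : BoundedPartition k d,
        branchingCoeff μ p.1 q.1 * productCoeff ν p.1 q.1 := by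
  rw [← finrank_diag_eq_sum hμ, ← finrank_blockSpace hμ, ← finrank_blockSpace hμ]
  exact finrank_signPart_add (fun _ hx => swap_mem_multSpace
    (commute_leftRep_rightRep (spechtRep μ)) (diagRep_apply (spechtRep μ))
    (blockSwap_blockSwap (spechtRep μ)) (blockSwap_leftRep (spechtRep μ)) hx)
    (blockSwap_blockSwap (spechtRep μ))

end BlockSize


/-! ### Tensor powers of unitary matrices span the commutant of the permutations -/

section Density

variable {n d : ℕ}

/-- The homogeneous polynomial function with given coefficients, evaluated at a matrix. -/
def polyEval {R : Type*} [CommRing R] [Algebra ℂ R] (φ : (Fin n → Fin d × Fin d) → ℂ)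
    (A : Matrix (Fin d) (Fin d) R) : R :=
  ∑ c, algebraMap ℂ R (φ c) * ∏ t, A (c t).1 (c t).2

theorem polyEval_smul (φ : (Fin n → Fin d × Fin d) → ℂ) (z : ℂ)
    (A : Matrix (Fin d) (Fin d) ℂ) : polyEval φ (z • A) = z ^ n * polyEval φ A := by
  rw [polyEval, polyEval, Finset.mul_sum]
  refine Finset.sum_congr rfl fun c _ => ?_
  simp only [Matrix.smul_apply, smul_eq_mul, Finset.prod_mul_distrib, Finset.prod_const,
    Finset.card_univ, Fintype.card_fin]
  ring

open Polynomial in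
theorem eval_polyEval (φ : (Fin n → Fin d × Fin d) → ℂ) (z : ℂ)
    (A : Matrix (Fin d) (Fin d) ℂ[X]) :
    (polyEval φ A).eval z = polyEval φ (A.map (Polynomial.eval z)) := by
  simp [polyEval, Polynomial.eval_finsetSum, Polynomial.eval_prod]

/-- The product of `1 - iH` and `1 + iH` is `1 + Hᴴ H`, which is positive definite. -/
theorem isUnit_one_sub_I_smul {H : Matrix (Fin d) (Fin d) ℂ} (hH : H.IsHermitian) :
    IsUnit (1 - Complex.I • H) := by
  have h1 : (1 + Hᴴ * H).PosDef :=
    Matrix.PosDef.one.add_posSemidef (Matrix.posSemidef_conjTranspose_mul_self H)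
  have h2 : (1 - Complex.I • H) * (1 + Complex.I • H) = 1 + Hᴴ * H := by
    rw [hH.eq, sub_mul, mul_add, mul_add, smul_mul_smul_comm, Complex.I_mul_I]
    simp only [mul_one, one_mul, neg_smul, one_smul]
    abel
  have h3 := h1.isUnit
  rw [← h2, Matrix.isUnit_iff_isUnit_det, Matrix.det_mul] at h3
  exact (Matrix.isUnit_iff_isUnit_det _).2 (isUnit_of_mul_isUnit_left h3)

theorem cayley_mem_unitaryGroup {H : Matrix (Fin d) (Fin d) ℂ} (hH : H.IsHermitian) :
    (1 + Complex.I • H) * (1 - Complex.I • H)⁻¹ ∈ Matrix.unitaryGroup (Fin d) ℂ := by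
  have hS := (Matrix.isUnit_iff_isUnit_det _).1 (isUnit_one_sub_I_smul hH)
  have hST : (1 - Complex.I • H)ᴴ = 1 + Complex.I • H := by
    simp [Matrix.conjTranspose_sub, Matrix.conjTranspose_smul, hH.eq]
  have hTS : (1 + Complex.I • H)ᴴ = 1 - Complex.I • H := by
    rw [← hST, Matrix.conjTranspose_conjTranspose]
  have hT : IsUnit (1 + Complex.I • H).det := by
    rw [← hST, Matrix.det_conjTranspose]
    exact hS.star
  have hcomm : (1 - Complex.I • H) * (1 + Complex.I • H) =
      (1 + Complex.I • H) * (1 - Complex.I • H) := by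
    simp only [sub_mul, add_mul, mul_add, mul_sub, one_mul, mul_one]
    abel
  rw [Matrix.mem_unitaryGroup_iff', Matrix.star_eq_conjTranspose, Matrix.conjTranspose_mul,
    Matrix.conjTranspose_nonsing_inv, hST, hTS]
  calc _ = (1 + Complex.I • H)⁻¹ * ((1 - Complex.I • H) * (1 + Complex.I • H)) *
        (1 - Complex.I • H)⁻¹ := by simp only [mul_assoc]
    _ = 1 := by
      rw [hcomm, Matrix.nonsing_inv_mul_cancel_left _ _ hT, Matrix.mul_nonsing_inv _ hS]

open Polynomial in
theorem map_eval_adjugate (z : ℂ) (A : Matrix (Fin d) (Fin d) ℂ[X]) :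
    A.adjugate.map (Polynomial.eval z) = (A.map (Polynomial.eval z)).adjugate :=
  (Polynomial.evalRingHom z).map_adjugate A

open Polynomial in
theorem map_eval_mul (z : ℂ) (A B : Matrix (Fin d) (Fin d) ℂ[X]) :
    (A * B).map (Polynomial.eval z) = A.map (Polynomial.eval z) * B.map (Polynomial.eval z) :=
  Matrix.map_mul (f := Polynomial.evalRingHom z)

open Polynomial in
-- Write `K = H₁ + i H₂` with Hermitian parts. Along `H₁ + z H₂` the expression is a polynomial in
-- `z`, since the adjugate replaces the inverse. At real `z` its argument is a scalar multiple of a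
-- Cayley transform, hence of a unitary matrix, and homogeneity gives zero. The polynomial thus
-- vanishes, in particular at `z = i`.
theorem polyEval_cayley_eq_zero {φ : (Fin n → Fin d × Fin d) → ℂ}
    (h : ∀ g ∈ Matrix.unitaryGroup (Fin d) ℂ, polyEval φ g = 0) (K : Matrix (Fin d) (Fin d) ℂ) :
    polyEval φ ((1 + Complex.I • K) * (1 - Complex.I • K).adjugate) = 0 := by
  let H₁ : Matrix (Fin d) (Fin d) ℂ := (2 : ℂ)⁻¹ • (K + Kᴴ)
  let H₂ : Matrix (Fin d) (Fin d) ℂ := (2 : ℂ)⁻¹ • (-Complex.I • (K - Kᴴ))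
  have hH₁ : H₁.IsHermitian := by
    simp [H₁, Matrix.IsHermitian, Matrix.conjTranspose_smul, add_comm]
  have hH₂ : H₂.IsHermitian := by
    simp only [H₂, Matrix.IsHermitian, Matrix.conjTranspose_smul, Matrix.conjTranspose_sub,
      Matrix.conjTranspose_conjTranspose, star_neg, star_inv₀, Complex.star_def, Complex.conj_I,
      neg_neg, map_ofNat]
    rw [neg_smul, ← smul_neg Complex.I, neg_sub]
  let M : Matrix (Fin d) (Fin d) ℂ[X] := Matrix.of fun i j => C (H₁ i j) + X * C (H₂ i j)
  let N₁ : Matrix (Fin d) (Fin d) ℂ[X] := Matrix.of fun i j =>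
    C ((1 : Matrix _ _ ℂ) i j) + C Complex.I * M i j
  let N₂ : Matrix (Fin d) (Fin d) ℂ[X] := Matrix.of fun i j =>
    C ((1 : Matrix _ _ ℂ) i j) - C Complex.I * M i j
  have hM : ∀ z i j, (M i j).eval z = (H₁ + z • H₂) i j := by
    intro z i j; simp [M, mul_comm z]
  have hN₁ : ∀ z, N₁.map (Polynomial.eval z) = 1 + Complex.I • (H₁ + z • H₂) := by
    intro z; ext i j
    simp [N₁, hM, mul_add]
  have hN₂ : ∀ z, N₂.map (Polynomial.eval z) = 1 - Complex.I • (H₁ + z • H₂) := by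
    intro z; ext i j
    simp [N₂, hM, mul_add]
  have hQ : ∀ z, (polyEval φ (N₁ * N₂.adjugate)).eval z =
      polyEval φ ((1 + Complex.I • (H₁ + z • H₂)) * (1 - Complex.I • (H₁ + z • H₂)).adjugate) := by
    intro z
    rw [eval_polyEval, map_eval_mul, map_eval_adjugate, hN₁, hN₂]
  have hroot : ∀ x : ℝ, (polyEval φ (N₁ * N₂.adjugate)).eval (x : ℂ) = 0 := by
    intro x
    have hH : (H₁ + (x : ℂ) • H₂).IsHermitian := by
      refine hH₁.add ?_
      rw [Matrix.IsHermitian, Matrix.conjTranspose_smul, hH₂.eq]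
      simp
    rw [hQ]
    set H := H₁ + (x : ℂ) • H₂
    have hS := (Matrix.isUnit_iff_isUnit_det _).1 (isUnit_one_sub_I_smul hH)
    have h1 : (1 - Complex.I • H).adjugate = (1 - Complex.I • H).det • (1 - Complex.I • H)⁻¹ := by
      rw [Matrix.inv_def, smul_smul, Ring.mul_inverse_cancel _ hS, one_smul]
    rw [h1, mul_smul_comm, polyEval_smul, h _ (cayley_mem_unitaryGroup hH), mul_zero]
  have hzero : polyEval φ (N₁ * N₂.adjugate) = 0 := by
    refine Polynomial.eq_zero_of_infinite_isRoot _ ?_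
    refine Set.Infinite.mono ?_ (Set.infinite_range_of_injective Complex.ofReal_injective)
    rintro _ ⟨x, rfl⟩
    exact hroot x
  have hK : H₁ + Complex.I • H₂ = K := by
    ext i j
    simp only [H₁, H₂, Matrix.add_apply, Matrix.smul_apply, Matrix.sub_apply, smul_eq_mul]
    linear_combination (-(2 : ℂ)⁻¹ * (K i j - Kᴴ i j)) * Complex.I_mul_I
  rw [← hK, ← hQ, hzero, Polynomial.eval_zero]

/-- The Cayley transform is inverted: with `V = (A + 1)⁻¹` and `iK = (A - 1)V`, one has `1 + iK =
2AV` and `1 - iK = 2V`. The argument in the preceding lemma becomes `det(2V) A`, and the scalar is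
nonzero. -/
theorem polyEval_eq_zero_of_isUnit {φ : (Fin n → Fin d × Fin d) → ℂ}
    (h : ∀ g ∈ Matrix.unitaryGroup (Fin d) ℂ, polyEval φ g = 0) {A : Matrix (Fin d) (Fin d) ℂ}
    (hA : IsUnit (A + 1).det) : polyEval φ A = 0 := by
  obtain ⟨V, hV, hV0⟩ : ∃ V : Matrix (Fin d) (Fin d) ℂ, A * V + V = 1 ∧ V.det ≠ 0 :=
    ⟨(A + 1)⁻¹, by
      have h := Matrix.mul_nonsing_inv _ hA
      rwa [add_mul, one_mul] at h,
      (Matrix.isUnit_nonsing_inv_det _ hA).ne_zero⟩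
  have h1 := polyEval_cayley_eq_zero h (-Complex.I • ((A - 1) * V))
  have h2 : Complex.I • (-Complex.I • ((A - 1) * V)) = (A - 1) * V := by
    rw [smul_smul]; simp
  have h3 : 1 + (A - 1) * V = A * ((2 : ℂ) • V) := by
    rw [sub_mul, one_mul, two_smul, mul_add, ← hV]
    abel
  have h4 : 1 - (A - 1) * V = (2 : ℂ) • V := by
    rw [sub_mul, one_mul, two_smul, ← hV]
    abel
  rw [h2, h3, h4, mul_assoc, Matrix.mul_adjugate, mul_smul_comm, mul_one, polyEval_smul] at h1
  refine (mul_eq_zero.1 h1).resolve_left (pow_ne_zero _ ?_)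
  rw [Matrix.det_smul]
  exact mul_ne_zero (pow_ne_zero _ two_ne_zero) hV0

open Polynomial in
-- Along `A - z` the preceding lemma applies unless `z` is an eigenvalue of `A + 1`. The product
-- with the characteristic polynomial of `A + 1` therefore vanishes identically, and that polynomial
-- is nonzero.
theorem polyEval_eq_zero {φ : (Fin n → Fin d × Fin d) → ℂ}
    (h : ∀ g ∈ Matrix.unitaryGroup (Fin d) ℂ, polyEval φ g = 0) (A : Matrix (Fin d) (Fin d) ℂ) :
    polyEval φ A = 0 := by
  let Q : ℂ[X] := polyEval φ (Matrix.of fun i j => C (A i j) - X * C ((1 : Matrix _ _ ℂ) i j))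
  have hQ : ∀ z, Q.eval z = polyEval φ (A - z • (1 : Matrix (Fin d) (Fin d) ℂ)) := by
    intro z
    rw [eval_polyEval]
    congr 1
    ext i j
    simp [mul_comm z]
  have hD : ∀ z, ((A + 1).charpoly).eval z = 0 ∨ Q.eval z = 0 := by
    intro z
    rw [or_iff_not_imp_left]
    intro hz
    rw [hQ]
    refine polyEval_eq_zero_of_isUnit h (isUnit_iff_ne_zero.2 fun h0 => hz ?_)
    rw [Matrix.eval_charpoly, ← neg_sub, Matrix.det_neg]
    have : A - z • (1 : Matrix (Fin d) (Fin d) ℂ) + 1 = A + 1 - Matrix.scalar (Fin d) z := by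
      rw [Matrix.scalar_apply, ← Matrix.smul_one_eq_diagonal]; abel
    rw [← this, h0, mul_zero]
  have h1 : (A + 1).charpoly * Q = 0 := Polynomial.funext fun z => by
    rw [Polynomial.eval_mul, Polynomial.eval_zero]
    exact mul_eq_zero.2 (hD z)
  have h2 := (mul_eq_zero.1 h1).resolve_left (Matrix.charpoly_monic _).ne_zero
  have h3 := hQ 0
  rw [h2, Polynomial.eval_zero, zero_smul, sub_zero] at h3
  exact h3.symm

theorem exists_perm_of_card_fiber_eq {α : Type*} [DecidableEq α] {c c' : Fin n → α}
    (h : ∑ t, Finsupp.single (c t) (1 : ℕ) = ∑ t, Finsupp.single (c' t) 1) :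
    ∃ σ : Equiv.Perm (Fin n), c = c' ∘ σ := by
  have h1 : ∀ x, Fintype.card {t // c t = x} = Fintype.card {t // c' t = x} := by
    intro x
    have := DFunLike.congr_fun h x
    simp only [Finsupp.coe_finsetSum, Finset.sum_apply, Finsupp.single_apply, Finset.sum_boole,
      Nat.cast_id] at this
    rw [Fintype.card_subtype, Fintype.card_subtype, this]
  refine ⟨Equiv.ofFiberEquiv fun x => Fintype.equivOfCardEq (h1 x), ?_⟩
  ext1 t
  exact (Equiv.ofFiberEquiv_map _ _).symm

/-- The polynomial vanishes at every matrix, so its coefficients do: `φ` sums to zero over all index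
families with the same monomial. These form an orbit under permutations, on which `y` is constant.
-/
theorem sum_mul_eq_zero_of_polyEval_eq_zero {φ : (Fin n → Fin d × Fin d) → ℂ}
    (h : ∀ g ∈ Matrix.unitaryGroup (Fin d) ℂ, polyEval φ g = 0)
    {y : (Fin n → Fin d × Fin d) → ℂ} (hy : ∀ (σ : Equiv.Perm (Fin n)) c, y (c ∘ σ) = y c) :
    ∑ c, φ c * y c = 0 := by
  classical
  let wt : (Fin n → Fin d × Fin d) → (Fin d × Fin d →₀ ℕ) := fun c => ∑ t, Finsupp.single (c t) 1
  let P : MvPolynomial (Fin d × Fin d) ℂ := ∑ c, MvPolynomial.monomial (wt c) (φ c)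
  have hP : P = 0 := by
    refine MvPolynomial.funext fun A => ?_
    rw [map_zero, ← polyEval_eq_zero h (Matrix.of fun i j => A (i, j)), polyEval, map_sum]
    refine Finset.sum_congr rfl fun c _ => ?_
    rw [MvPolynomial.eval_monomial]
    congr 1
    simp only [wt]
    rw [← Finsupp.prod_finsetSum_index (by simp) (by intros; rw [pow_add])]
    simp
  have hcoeff : ∀ m, ∑ c with wt c = m, φ c = 0 := by
    intro m
    have := congrArg (MvPolynomial.coeff m) hP
    rw [MvPolynomial.coeff_sum, MvPolynomial.coeff_zero] at this
    simp only [MvPolynomial.coeff_monomial] at this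
    rw [← this, Finset.sum_filter]
  rw [← Finset.sum_fiberwise_of_maps_to (t := Finset.univ.image wt) (g := wt) (by simp)]
  refine Finset.sum_eq_zero fun m hm => ?_
  obtain ⟨c₀, -, rfl⟩ := Finset.mem_image.1 hm
  have h2 : ∀ c ∈ Finset.univ.filter fun c => wt c = wt c₀, φ c * y c = φ c * y c₀ := by
    intro c hc
    obtain ⟨σ, rfl⟩ := exists_perm_of_card_fiber_eq (Finset.mem_filter.1 hc).2
    rw [hy]
  rw [Finset.sum_congr rfl h2, ← Finset.sum_mul, hcoeff, zero_mul]

/-- A linear functional that vanishes on tensor powers of unitary matrices vanishes on all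
matrices that are invariant under permutations of the tensor factors. -/
theorem sum_mul_eq_zero_of_tensorPow {φ : Matrix (Fin n → Fin d) (Fin n → Fin d) ℂ}
    (h : ∀ g ∈ Matrix.unitaryGroup (Fin d) ℂ, ∑ i, ∑ j, φ i j * tensorPow n g i j = 0)
    {Y : Matrix (Fin n → Fin d) (Fin n → Fin d) ℂ}
    (hY : ∀ (σ : Equiv.Perm (Fin n)) i j, Y (i ∘ σ) (j ∘ σ) = Y i j) :
    ∑ i, ∑ j, φ i j * Y i j = 0 := by
  have key : ∀ F : (Fin n → Fin d) → (Fin n → Fin d) → ℂ, ∑ i, ∑ j, F i j =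
      ∑ c : Fin n → Fin d × Fin d, F (fun t => (c t).1) fun t => (c t).2 := by
    intro F
    rw [← Fintype.sum_prod_type' (f := F)]
    exact (Fintype.sum_equiv (Equiv.arrowProdEquivProdArrow (Fin n) (fun _ => Fin d)
      (fun _ => Fin d)) _ _ fun c => rfl).symm
  rw [key]
  refine sum_mul_eq_zero_of_polyEval_eq_zero (φ := fun c => φ (fun t => (c t).1) fun t => (c t).2)
    (y := fun c => Y (fun t => (c t).1) fun t => (c t).2) ?_
    fun σ c => hY σ (fun t => (c t).1) fun t => (c t).2
  intro g hg
  have := h g hg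
  rw [key] at this
  exact this

/-- The double commutant property for tensor powers of unitary matrices. -/
theorem commute_of_commute_tensorPow {Φ Y : Matrix (Fin n → Fin d) (Fin n → Fin d) ℂ}
    (hΦ : ∀ g ∈ Matrix.unitaryGroup (Fin d) ℂ, Commute (tensorPow n g) Φ)
    (hY : ∀ (σ : Equiv.Perm (Fin n)) i j, Y (i ∘ σ) (j ∘ σ) = Y i j) : Commute Y Φ := by
  rw [Commute, SemiconjBy, ← sub_eq_zero]
  ext a b
  -- Each entry of the commutator with `Φ` is a linear functional of `Z`, with coefficients
  -- depending only on `Φ`.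
  have key : ∀ Z : Matrix (Fin n → Fin d) (Fin n → Fin d) ℂ, (Z * Φ - Φ * Z) a b =
      ∑ i, ∑ j, ((if i = a then Φ j b else 0) - if j = b then Φ a i else 0) * Z i j := by
    intro Z
    simp only [sub_mul, Finset.sum_sub_distrib, ite_mul, zero_mul, Finset.sum_ite_eq',
      Finset.mem_univ, if_true]
    rw [Finset.sum_comm]
    simp [Matrix.mul_apply, mul_comm]
  rw [key, Matrix.zero_apply]
  refine sum_mul_eq_zero_of_tensorPow (fun g hg => ?_) hY
  rw [← key, (hΦ g hg).eq, sub_self, Matrix.zero_apply]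

end Density


/-! ### Square roots, polar parts and unitary forms -/

section Polar

variable {m : Type*} [Fintype m] [DecidableEq m]

theorem exists_sqrt_of_posDef {P : Matrix m m ℂ} (hP : P.PosDef) :
    ∃ S : Matrix m m ℂ, Sᴴ = S ∧ S * S = P ∧ IsUnit S.det ∧ ∀ D, Commute P D → Commute S D := by
  set V : Matrix m m ℂ := hP.1.eigenvectorUnitary.1 with hV
  have hVV : V * Vᴴ = 1 := Matrix.mem_unitaryGroup_iff.1 hP.1.eigenvectorUnitary.2
  have hVV' : Vᴴ * V = 1 := Matrix.mem_unitaryGroup_iff'.1 hP.1.eigenvectorUnitary.2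
  set ev : m → ℝ := hP.1.eigenvalues with hev
  have hpos : ∀ i, 0 < ev i := hP.eigenvalues_pos
  have hspec : P = V * Matrix.diagonal (fun i => (ev i : ℂ)) * Vᴴ := hP.1.spectral_theorem
  set s : m → ℂ := fun i => (Real.sqrt (ev i) : ℂ) with hs
  have hss : ∀ i, s i * s i = ev i := fun i => by
    rw [hs, ← Complex.ofReal_mul, Real.mul_self_sqrt (hpos i).le]
  have hSS : V * Matrix.diagonal s * Vᴴ * (V * Matrix.diagonal s * Vᴴ) = P := by
    calc _ = V * Matrix.diagonal s * (Vᴴ * V) * Matrix.diagonal s * Vᴴ := by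
          simp only [mul_assoc]
      _ = P := by
          rw [hVV', mul_one, mul_assoc V, Matrix.diagonal_mul_diagonal, hspec]
          simp only [hss]
  refine ⟨V * Matrix.diagonal s * Vᴴ, ?_, hSS, ?_, ?_⟩
  · rw [Matrix.conjTranspose_mul, Matrix.conjTranspose_mul, Matrix.conjTranspose_conjTranspose,
      Matrix.diagonal_conjTranspose, mul_assoc]
    congr 3
    ext i
    simp [hs]
  · have h := (Matrix.isUnit_iff_isUnit_det _).1 hP.isUnit
    rw [← hSS, Matrix.det_mul] at h
    exact isUnit_of_mul_isUnit_left h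
  · intro D hD
    set E := Vᴴ * D * V with hE
    have hDE : D = V * E * Vᴴ := by
      calc D = (V * Vᴴ) * D * (V * Vᴴ) := by rw [hVV, one_mul, mul_one]
        _ = V * E * Vᴴ := by rw [hE]; simp only [mul_assoc]
    have conj : ∀ A B : Matrix m m ℂ, V * A * Vᴴ * (V * B * Vᴴ) = V * (A * B) * Vᴴ := by
      intro A B
      calc _ = V * A * (Vᴴ * V) * B * Vᴴ := by simp only [mul_assoc]
        _ = _ := by rw [hVV', mul_one]; simp only [mul_assoc]
    have h1 : Matrix.diagonal (fun i => (ev i : ℂ)) * E =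
        E * Matrix.diagonal (fun i => (ev i : ℂ)) := by
      have h2 := hD.eq
      rw [hspec, hDE, conj, conj] at h2
      have h3 := congrArg (fun A => Vᴴ * A * V) h2
      simpa [mul_assoc, hVV', ← mul_assoc Vᴴ V] using h3
    rw [Commute, SemiconjBy, hDE, conj, conj]
    congr 2
    ext i j
    have h2 := congrFun (congrFun h1 i) j
    rw [Matrix.diagonal_mul, Matrix.mul_diagonal] at h2 ⊢
    -- In the eigenbasis of `P`, a commuting matrix has nonzero entries only between equal
    -- eigenvalues, and these have equal square roots.
    by_cases hij : E i j = 0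
    · rw [hij]; simp
    · rw [mul_comm, mul_right_inj' hij] at h2
      rw [mul_comm, hs]
      simp only [Complex.ofReal_inj] at h2
      simp only [h2]

/-- The unitary part of an invertible matrix intertwines all pairs of unitary matrices that
the matrix itself intertwines. -/
theorem exists_unitary_intertwiner {F : Matrix m m ℂ} (hF : IsUnit F.det) :
    ∃ U ∈ Matrix.unitaryGroup m ℂ,
      ∀ R ∈ Matrix.unitaryGroup m ℂ, ∀ D ∈ Matrix.unitaryGroup m ℂ, R * F = F * D →
        R = U * D * Uᴴ := by
  have hP : (Fᴴ * F).PosDef := Matrix.PosDef.conjTranspose_mul_self F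
    (Matrix.mulVec_injective_of_isUnit ((Matrix.isUnit_iff_isUnit_det _).2 hF))
  obtain ⟨S, hSH, hSS, hSdet, hScomm⟩ := exists_sqrt_of_posDef hP
  have hU : F * S⁻¹ ∈ Matrix.unitaryGroup m ℂ := by
    rw [Matrix.mem_unitaryGroup_iff', Matrix.star_eq_conjTranspose, Matrix.conjTranspose_mul,
      Matrix.conjTranspose_nonsing_inv, hSH]
    calc _ = S⁻¹ * (Fᴴ * F) * S⁻¹ := by simp only [mul_assoc]
      _ = 1 := by
        rw [← hSS, Matrix.nonsing_inv_mul_cancel_left _ _ hSdet, Matrix.mul_nonsing_inv _ hSdet]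
  refine ⟨F * S⁻¹, hU, fun R hR D hD h => ?_⟩
  have hRR : Rᴴ * R = 1 := Matrix.mem_unitaryGroup_iff'.1 hR
  have hDD : D * Dᴴ = 1 := Matrix.mem_unitaryGroup_iff.1 hD
  -- Because `R` is unitary, `F * D = R * F` has the same Gram matrix as `F`.
  have hPD : Commute (Fᴴ * F) D := by
    have h1 : Dᴴ * (Fᴴ * F) * D = Fᴴ * F := by
      calc _ = (F * D)ᴴ * (F * D) := by rw [Matrix.conjTranspose_mul]; simp only [mul_assoc]
        _ = Fᴴ * (Rᴴ * R) * F := by rw [← h, Matrix.conjTranspose_mul]; simp only [mul_assoc]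
        _ = _ := by rw [hRR, mul_one]
    calc Fᴴ * F * D = D * Dᴴ * (Fᴴ * F * D) := by rw [hDD, one_mul]
      _ = D * (Dᴴ * (Fᴴ * F) * D) := by simp only [mul_assoc]
      _ = _ := by rw [h1]
  have hSD := hScomm D hPD
  have h2 : R * (F * S⁻¹) = F * S⁻¹ * D := by
    rw [← mul_assoc, h, mul_assoc, mul_assoc]
    congr 1
    calc D * S⁻¹ = S⁻¹ * (S * D) * S⁻¹ := by rw [Matrix.nonsing_inv_mul_cancel_left _ _ hSdet]
      _ = S⁻¹ * D := by rw [hSD.eq, mul_assoc, Matrix.mul_nonsing_inv_cancel_right _ _ hSdet]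
  have h3 : F * S⁻¹ * (F * S⁻¹)ᴴ = 1 := Matrix.mem_unitaryGroup_iff.1 hU
  rw [← h2, mul_assoc, h3, mul_one]

end Polar

/-! ### Unitary matrix forms -/

section UnitaryForm

/-- The inner product pulled back along `J` is invariant, so the matrices in an orthonormal basis
for it are unitary. -/
theorem exists_unitary_isMatrixForm {G V m : Type*} [Group G] [AddCommGroup V] [Module ℂ V]
    [Fintype m] (ρ : Representation ℂ G V) (J : V →ₗ[ℂ] EuclideanSpace ℂ m)
    (hJ : Function.Injective J)
    (hinner : ∀ g v w, inner ℂ (J (ρ g v)) (J (ρ g w)) = inner ℂ (J v) (J w)) :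
    ∃ π : G →* Matrix.unitaryGroup (Fin (Module.finrank ℂ V)) ℂ, IsMatrixForm ρ π := by
  let J' : V ≃ₗ[ℂ] LinearMap.range J := LinearEquiv.ofInjective J hJ
  let o := (stdOrthonormalBasis ℂ (LinearMap.range J)).reindex (finCongr J'.finrank_eq.symm)
  let b : V ≃ₗ[ℂ] (Fin (Module.finrank ℂ V) → ℂ) :=
    J' ≪≫ₗ o.repr.toLinearEquiv ≪≫ₗ WithLp.linearEquiv 2 ℂ _
  have hb : ∀ v w, star (b v) ⬝ᵥ b w = inner ℂ (J v) (J w) := by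
    intro v w
    have h1 : inner ℂ (o.repr (J' v)) (o.repr (J' w)) = inner ℂ (J v) (J w) := by
      rw [o.repr.inner_map_map]; rfl
    rw [← h1, EuclideanSpace.inner_eq_star_dotProduct, dotProduct_comm]
    rfl
  let T : G → Matrix (Fin (Module.finrank ℂ V)) (Fin (Module.finrank ℂ V)) ℂ := fun g =>
    LinearMap.toMatrix' (b.toLinearMap ∘ₗ ρ g ∘ₗ b.symm.toLinearMap)
  have hT : ∀ g v, T g *ᵥ v = b (ρ g (b.symm v)) := by
    intro g v
    rw [← Matrix.toLin'_apply, Matrix.toLin'_toMatrix']; rfl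
  have hTu : ∀ g, T g ∈ Matrix.unitaryGroup (Fin (Module.finrank ℂ V)) ℂ := by
    intro g
    rw [Matrix.mem_unitaryGroup_iff', Matrix.star_eq_conjTranspose]
    have h1 : ∀ v w, star v ⬝ᵥ ((T g)ᴴ * T g) *ᵥ w = star v ⬝ᵥ w := by
      intro v w
      rw [← Matrix.mulVec_mulVec, Matrix.dotProduct_mulVec, ← Matrix.star_mulVec, hT, hT, hb,
        hinner, ← hb, b.apply_symm_apply, b.apply_symm_apply]
    ext i j
    have h2 := h1 (Pi.single i 1) (Pi.single j 1)
    simpa [Matrix.one_apply, Pi.single_apply, ← Pi.single_star, eq_comm] using h2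
  refine ⟨{ toFun := fun g => ⟨T g, hTu g⟩, map_one' := ?_, map_mul' := ?_ }, b, ?_⟩
  · refine Subtype.ext ?_
    change T 1 = 1
    refine Matrix.toLin'.injective (LinearMap.ext fun v => ?_)
    rw [Matrix.toLin'_apply, hT, map_one, Module.End.one_apply, b.apply_symm_apply,
      Matrix.toLin'_one, LinearMap.id_apply]
  · intro g h
    refine Subtype.ext ?_
    change T (g * h) = T g * T h
    refine Matrix.toLin'.injective (LinearMap.ext fun v => ?_)
    rw [Matrix.toLin'_mul, LinearMap.comp_apply, Matrix.toLin'_apply, Matrix.toLin'_apply,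
      Matrix.toLin'_apply, hT, hT, hT, b.symm_apply_apply, map_mul, Module.End.mul_apply]
  · intro g v
    change _ = T g *ᵥ b v
    rw [hT, b.symm_apply_apply]

/-- Left multiplication permutes the coefficients of an element of the group algebra, hence
preserves their standard inner product. -/
theorem exists_unitary_spechtRep {n : ℕ} (p : n.Partition) :
    ∃ ρ : Equiv.Perm (Fin n) →* Matrix.unitaryGroup (Fin (spechtDim p)) ℂ,
      IsMatrixForm (spechtRep p) ρ := by
  let c : MonoidAlgebra ℂ (Equiv.Perm (Fin n)) →ₗ[ℂ] (Equiv.Perm (Fin n) → ℂ) :=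
    { toFun := fun a σ => a.coeff σ, map_add' := fun _ _ => rfl, map_smul' := fun _ _ => rfl }
  let J : Specht p →ₗ[ℂ] EuclideanSpace ℂ (Equiv.Perm (Fin n)) :=
    (WithLp.linearEquiv 2 ℂ _).symm.toLinearMap ∘ₗ c ∘ₗ (spechtVal p).restrictScalars ℂ
  refine exists_unitary_isMatrixForm _ J ?_ ?_
  · intro x y h
    refine spechtVal_injective p ?_
    have h1 : c (spechtVal p x) = c (spechtVal p y) := (WithLp.linearEquiv 2 ℂ _).symm.injective h
    ext σ
    exact congrFun h1 σ
  · intro g v w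
    have h1 : ∀ v τ, J (spechtRep p g v) τ = J v (g⁻¹ * τ) := by
      intro v τ
      change (spechtVal p (spechtRep p g v)).coeff τ = (spechtVal p v).coeff (g⁻¹ * τ)
      rw [spechtRep_apply, map_smul, smul_eq_mul, MonoidAlgebra.of_apply,
        MonoidAlgebra.coeff_single_mul_apply, one_mul]
    rw [PiLp.inner_apply, PiLp.inner_apply]
    simp only [h1]
    exact Equiv.sum_comp (Equiv.mulLeft g⁻¹) fun τ => inner ℂ (J v τ) (J w τ)

theorem tensorPow_mem_unitaryGroup {d : ℕ} (n : ℕ) (g : Matrix.unitaryGroup (Fin d) ℂ) :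
    tensorPow n (g : Matrix (Fin d) (Fin d) ℂ) ∈ Matrix.unitaryGroup (Fin n → Fin d) ℂ := by
  have h : (tensorPow n (g : Matrix (Fin d) (Fin d) ℂ))ᴴ =
      tensorPow n (g : Matrix (Fin d) (Fin d) ℂ)ᴴ := by
    ext i j
    simp [tensorPow, Matrix.conjTranspose_apply]
  rw [Matrix.mem_unitaryGroup_iff', Matrix.star_eq_conjTranspose, h, ← tensorPow_mul,
    ← Matrix.star_eq_conjTranspose, Matrix.mem_unitaryGroup_iff'.1 g.2, tensorPow_one]

theorem exists_unitary_weylRep {n : ℕ} (d : ℕ) (p : n.Partition) :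
    ∃ π : Matrix.unitaryGroup (Fin d) ℂ →* Matrix.unitaryGroup (Fin (weylDim d p)) ℂ,
      IsMatrixForm (weylRep d p) π := by
  let J : Weyl d p →ₗ[ℂ] EuclideanSpace ℂ (Fin n → Fin d) :=
    (WithLp.linearEquiv 2 ℂ _).symm.toLinearMap ∘ₗ (weylSub d p).toSubmodule.subtype
  refine exists_unitary_isMatrixForm _ J ?_ ?_
  · exact (WithLp.linearEquiv 2 ℂ _).symm.injective.comp Subtype.val_injective
  · intro g v w
    have h1 : ∀ v, (J (weylRep d p g v)).ofLp =
        tensorPow n (g : Matrix (Fin d) (Fin d) ℂ) *ᵥ v.1 := fun v => rfl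
    have h2 : ∀ v, (J v).ofLp = v.1 := fun v => rfl
    have h3 := Matrix.mem_unitaryGroup_iff'.1 (tensorPow_mem_unitaryGroup n g)
    rw [Matrix.star_eq_conjTranspose] at h3
    rw [EuclideanSpace.inner_eq_star_dotProduct, EuclideanSpace.inner_eq_star_dotProduct, h1, h1,
      h2, h2, dotProduct_comm, dotProduct_comm w.1, Matrix.star_mulVec, ← Matrix.dotProduct_mulVec,
      Matrix.mulVec_mulVec, h3, Matrix.one_mulVec]

end UnitaryForm


/-! ### A basis of the tensor power adapted to all the actions -/

section Isotypic

/-- Families of matrices act on the multiplicity spaces of a representation by operators that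
commute with the representation. -/
theorem exists_isotypic_endomorphism {n : ℕ} {X : Type*} [AddCommGroup X] [Module ℂ X]
    (r : Representation ℂ (Equiv.Perm (Fin n)) X) {κ : n.Partition → Type*} [∀ p, Fintype (κ p)]
    (v : ∀ p, Module.Basis (κ p) ℂ (multSpace r p)) (A : ∀ p, Matrix (κ p) (κ p) ℂ) :
    ∃ y : Module.End ℂ X,
      (∀ p (z : Specht p) a, y (spechtAct r p z (v p a)) =
        ∑ a', A p a' a • spechtAct r p z (v p a')) ∧
      ∀ σ w, y (r σ w) = r σ (y w) := by
  let b : ∀ p : n.Partition, Module.Basis _ ℂ (Specht p) := fun p => Module.finBasis ℂ (Specht p)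
  let w := isotypicBasis r b v
  let y := w.constr ℂ fun j => ∑ a', A j.1 a' j.2.2 • w ⟨j.1, j.2.1, a'⟩
  have hb : ∀ p j a, y (spechtAct r p (b p j) (v p a)) =
      ∑ a', A p a' a • spechtAct r p (b p j) (v p a') := by
    intro p j a
    simp only [← isotypicBasis_apply r b v]
    exact w.constr_basis ℂ _ ⟨p, j, a⟩
  have hy : ∀ p (z : Specht p) a, y (spechtAct r p z (v p a)) =
      ∑ a', A p a' a • spechtAct r p z (v p a') := by
    intro p z a
    rw [← (b p).sum_repr z]
    simp only [map_sum, map_smul, LinearMap.sum_apply, LinearMap.smul_apply, hb,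
      Finset.smul_sum]
    rw [Finset.sum_comm]
    exact Finset.sum_congr rfl fun _ _ => Finset.sum_congr rfl fun _ _ => smul_comm _ _ _
  refine ⟨y, hy, fun σ u => ?_⟩
  have h : y ∘ₗ r σ = r σ ∘ₗ y := w.ext fun ⟨p, j, a⟩ => by
    rw [LinearMap.comp_apply, LinearMap.comp_apply, isotypicBasis_apply, ← spechtAct_spechtRep,
      hy, hy, map_sum]
    simp only [map_smul, spechtAct_spechtRep]
  exact LinearMap.congr_fun h u

end Isotypic

/-! ### Splitting a subspace into the eigenspaces of an involution -/

section SignBasis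

variable {X : Type*} [AddCommGroup X] [Module ℂ X] {E : Submodule ℂ X} {θ : X →ₗ[ℂ] X}

theorem sum_units {M : Type*} [AddCommMonoid M] (f : ℤˣ → M) : ∑ s, f s = f 1 + f (-1) :=
  Finset.sum_pair (by decide)

/-- A subspace that is stable under an involution is the sum of its parts of either sign. -/
def signPartEquiv (hE : ∀ x ∈ E, θ x ∈ E) (hθ : ∀ x, θ (θ x) = x) :
    (∀ s : ℤˣ, signPart E θ s) ≃ₗ[ℂ] E where
  toFun f := ∑ s, ⟨f s, (mem_signPart.1 (f s).2).1⟩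
  map_add' f g := by
    rw [← Finset.sum_add_distrib]; rfl
  map_smul' c f := by
    rw [RingHom.id_apply, Finset.smul_sum]; rfl
  invFun x s := ⟨(2 : ℂ)⁻¹ • (x + ((s : ℤ) : ℂ) • θ x), mem_signPart.2 ⟨E.smul_mem _
    (E.add_mem x.2 (E.smul_mem _ (hE _ x.2))), by
      rw [map_smul, map_add, map_smul, hθ, smul_comm _ (2 : ℂ)⁻¹, smul_add ((s : ℤ) : ℂ),
        smul_smul _ _ (θ x.1), units_sq_complex, one_smul, add_comm]⟩⟩
  left_inv f := by
    have h1 := (mem_signPart.1 (f 1).2).2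
    have h2 := (mem_signPart.1 (f (-1)).2).2
    simp only [Units.val_one, Int.cast_one, one_smul, Units.val_neg, Int.cast_neg, neg_smul]
      at h1 h2
    funext s
    refine Subtype.ext ?_
    have h3 : ((∑ s, ⟨f s, (mem_signPart.1 (f s).2).1⟩ : E) : X) = f 1 + f (-1) := by
      rw [sum_units, Submodule.coe_add]
    change (2 : ℂ)⁻¹ • (_ + ((s : ℤ) : ℂ) • θ _) = _
    rw [h3, map_add, h1, h2]
    rcases Int.units_eq_one_or s with rfl | rfl
    · simp only [Units.val_one, Int.cast_one, one_smul]
      module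
    · simp only [Units.val_one, Int.cast_one, one_smul, Units.val_neg, Int.cast_neg, neg_smul]
      module
  right_inv x := by
    refine Subtype.ext ?_
    dsimp only
    rw [sum_units, Submodule.coe_add]
    simp only [Units.val_one, Int.cast_one, one_smul, Units.val_neg, Int.cast_neg, neg_smul]
    module

theorem signPartEquiv_single (hE : ∀ x ∈ E, θ x ∈ E) (hθ : ∀ x, θ (θ x) = x) (s : ℤˣ)
    (x : signPart E θ s) : (signPartEquiv hE hθ (Pi.single s x) : X) = x := by
  change ((∑ t, ⟨((Pi.single s x : ∀ s, signPart E θ s) t : X), _⟩ : E) : X) = x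
  rw [Submodule.coe_sum, Finset.sum_eq_single s]
  · change ((Pi.single s x : ∀ s, signPart E θ s) s : X) = x
    rw [Pi.single_eq_same]
  · intro t _ ht
    change ((Pi.single s x : ∀ s, signPart E θ s) t : X) = 0
    rw [Pi.single_eq_of_ne ht]; rfl
  · intro h
    exact (h (Finset.mem_univ s)).elim

end SignBasis

/-! ### Bases adapted to `U(d)`, `S_k` and the block swap -/

section AdaptedBasis

variable {d k : ℕ}

/-- A basis of the multiplicity space of `ν` in the restriction of `μ` that consists of
eigenvectors of the block swap. -/
def signBasis (μ : (k + k).Partition) (ν : k.Partition) :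
    Module.Basis (Σ s : ℤˣ, Fin (Module.finrank ℂ (blockSpace μ ν s))) ℂ
      (multSpace (diagRep (spechtRep μ)) ν) :=
  (Pi.basis fun s => Module.finBasis ℂ (blockSpace μ ν s)).map
    (signPartEquiv (fun _ hx => swap_mem_multSpace
      (commute_leftRep_rightRep (spechtRep μ)) (diagRep_apply (spechtRep μ))
      (blockSwap_blockSwap (spechtRep μ)) (blockSwap_leftRep (spechtRep μ)) hx)
      (blockSwap_blockSwap (spechtRep μ)))

theorem blockSwap_signBasis (μ : (k + k).Partition) (ν : k.Partition)
    (i : Σ s : ℤˣ, Fin (Module.finrank ℂ (blockSpace μ ν s))) :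
    spechtRep μ (blockSwap k) (signBasis μ ν i) = ((i.1 : ℤ) : ℂ) • (signBasis μ ν i : Specht μ) := by
  obtain ⟨s, i⟩ := i
  rw [signBasis, Module.Basis.map_apply, Pi.basis_apply, signPartEquiv_single]
  exact (mem_signPart.1 (Module.finBasis ℂ (blockSpace μ ν s) i).2).2

/-- Index set of a basis of a Specht module of `S_{2k}`. -/
abbrev DiagIndex (μ : (k + k).Partition) : Type :=
  Σ ν : k.Partition, Fin (spechtDim ν) × Σ s : ℤˣ, Fin (Module.finrank ℂ (blockSpace μ ν s))

theorem weylDim_eq_finrank_multSpace {n : ℕ} (p : n.Partition) :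
    weylDim d p = Module.finrank ℂ (multSpace (tensorPermRep n d) p) := by
  rw [← range_asAlgebraHom_youngSymmetrizer]; rfl

theorem weylDim_eq_zero {n : ℕ} {p : n.Partition} (hp : ¬ Multiset.card p.parts ≤ d) :
    weylDim d p = 0 := by
  rw [weylDim_eq_finrank_multSpace, multSpace, asAlgebraHom_tensorPermRep_eq_zero hp,
    LinearMap.range_zero, finrank_bot]

theorem weylDim_pos {n : ℕ} {p : n.Partition} (hp : Multiset.card p.parts ≤ d) :
    0 < weylDim d p := by
  obtain ⟨w, hw, hw0⟩ := exists_ne_zero_mem_multSpace_tensorPermRep hp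
  rw [weylDim_eq_finrank_multSpace]
  exact Module.finrank_pos_iff_exists_ne_zero.2 ⟨⟨w, hw⟩, fun h => hw0 (congrArg Subtype.val h)⟩

theorem spechtDim_pos {n : ℕ} (p : n.Partition) : 0 < spechtDim p :=
  Module.finrank_pos_iff_exists_ne_zero.2 ⟨spechtGen p, spechtGen_ne_zero p⟩

theorem BlockLabel.finrank_eq_size (l : BlockLabel d k) :
    Module.finrank ℂ (blockSpace l.1.1 l.2.1 l.2.2) = l.size := finrank_blockSpace l.1.2 _ _

/-- The embedding of the block indices in the indices of the isotypic decomposition. -/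
def blockIndexMap (x : BlockIndex d k) :
    Σ μ : (k + k).Partition, DiagIndex μ × Fin (weylDim d μ) :=
  ⟨x.1.1.1, ⟨x.1.2.1, x.2.2.2, x.1.2.2, Fin.cast x.1.finrank_eq_size.symm x.2.1⟩,
    x.2.2.1⟩

/-- Partitions `μ` with more than `d` parts are missing from the block labels, but their factor `Fin
(weylDim d μ)` is empty. -/
theorem blockIndexMap_bijective : Function.Bijective (blockIndexMap (d := d) (k := k)) := by
  constructor
  · rintro ⟨⟨⟨μ, hμ⟩, ν, s⟩, i, a, b⟩ ⟨⟨⟨μ', hμ'⟩, ν', s'⟩, i', a', b'⟩ h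
    simp only [blockIndexMap, Sigma.mk.injEq] at h
    obtain ⟨rfl, h⟩ := h
    simp only [heq_eq_eq, Prod.mk.injEq, Sigma.mk.injEq] at h
    obtain ⟨⟨rfl, h⟩, rfl⟩ := h
    simp only [heq_eq_eq, Prod.mk.injEq, Sigma.mk.injEq] at h
    obtain ⟨rfl, rfl, h⟩ := h
    rw [heq_eq_eq, Fin.cast_inj] at h
    subst h
    rfl
  · rintro ⟨μ, ⟨ν, b, s, i⟩, a⟩
    by_cases hμ : Multiset.card μ.parts ≤ d
    · exact ⟨⟨⟨⟨μ, hμ⟩, ν, s⟩, Fin.cast (finrank_blockSpace hμ _ _) i, a, b⟩, rfl⟩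
    · exact (Fin.cast (weylDim_eq_zero hμ) a).elim0

variable (x : ∀ ν : k.Partition, Module.Basis (Fin (spechtDim ν)) ℂ (Specht ν))
  (v : ∀ μ : (k + k).Partition,
    Module.Basis (Fin (weylDim d μ)) ℂ (multSpace (tensorPermRep (k + k) d) μ))

/-- A basis of a Specht module of `S_{2k}` adapted to the action of `S_k × ℤ/2`. -/
def diagSpechtBasis (μ : (k + k).Partition) : Module.Basis (DiagIndex μ) ℂ (Specht μ) :=
  isotypicBasis (diagRep (spechtRep μ)) x (signBasis μ)

/-- A basis of the tensor power adapted to the actions of `U(d)`, `S_k` and `ℤ/2`. -/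
def adaptedBasis : Module.Basis (BlockIndex d k) ℂ ((Fin (k + k) → Fin d) → ℂ) :=
  (isotypicBasis (tensorPermRep (k + k) d) (diagSpechtBasis x) v).reindex
    (Equiv.ofBijective _ blockIndexMap_bijective).symm

/-- The Specht module component of a vector of the adapted basis. -/
def adaptedSpecht (l : BlockLabel d k) (i : Fin l.size) (b : Fin (spechtDim l.2.1)) :
    Specht l.1.1 :=
  spechtAct (diagRep (spechtRep l.1.1)) l.2.1 (x l.2.1 b)
    (signBasis l.1.1 l.2.1 ⟨l.2.2, Fin.cast l.finrank_eq_size.symm i⟩)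

theorem adaptedBasis_apply (l : BlockLabel d k) (i : Fin l.size) (a : Fin (weylDim d l.1.1))
    (b : Fin (spechtDim l.2.1)) : adaptedBasis x v ⟨l, i, a, b⟩ =
      spechtAct (tensorPermRep (k + k) d) l.1.1 (adaptedSpecht x l i b) (v l.1.1 a) := by
  rw [adaptedBasis, Module.Basis.reindex_apply, Equiv.symm_symm, Equiv.ofBijective_apply,
    blockIndexMap, isotypicBasis_apply, diagSpechtBasis, isotypicBasis_apply]
  rfl

theorem tensorUnitaryRep_adaptedBasis {g : Matrix.unitaryGroup (Fin d) ℂ} {l : BlockLabel d k}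
    {P : Matrix (Fin (weylDim d l.1.1)) (Fin (weylDim d l.1.1)) ℂ}
    (hP : ∀ a, tensorUnitaryRep (k + k) d g (v l.1.1 a) =
      ∑ a', P a' a • (v l.1.1 a' : (Fin (k + k) → Fin d) → ℂ))
    (i : Fin l.size) (a : Fin (weylDim d l.1.1)) (b : Fin (spechtDim l.2.1)) :
    tensorUnitaryRep (k + k) d g (adaptedBasis x v ⟨l, i, a, b⟩) =
      ∑ a', P a' a • adaptedBasis x v ⟨l, i, a', b⟩ := by
  simp only [adaptedBasis_apply]
  have h := LinearMap.congr_fun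
    (commute_asAlgebraHom (d := d) (spechtVal l.1.1 (adaptedSpecht x l i b)) g).eq (v l.1.1 a)
  rw [Module.End.mul_apply, Module.End.mul_apply, hP, map_sum] at h
  rw [spechtAct_apply, ← h]
  simp only [map_smul, spechtAct_apply]

theorem tensorPermRep_adaptedBasis_of_diag {σ : Equiv.Perm (Fin k)} {l : BlockLabel d k}
    {P : Matrix (Fin (spechtDim l.2.1)) (Fin (spechtDim l.2.1)) ℂ}
    (hP : ∀ b, spechtRep l.2.1 σ (x l.2.1 b) = ∑ b', P b' b • x l.2.1 b')
    (i : Fin l.size) (a : Fin (weylDim d l.1.1)) (b : Fin (spechtDim l.2.1)) :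
    tensorPermRep (k + k) d (youngInclusion k (σ, σ)) (adaptedBasis x v ⟨l, i, a, b⟩) =
      ∑ b', P b' b • adaptedBasis x v ⟨l, i, a, b'⟩ := by
  simp only [adaptedBasis_apply]
  have h : spechtRep l.1.1 (youngInclusion k (σ, σ)) (adaptedSpecht x l i b) =
      ∑ b', P b' b • adaptedSpecht x l i b' := by
    change diagRep (spechtRep l.1.1) σ _ = _
    simp only [adaptedSpecht]
    rw [← spechtAct_spechtRep, hP, map_sum, LinearMap.sum_apply]
    simp only [map_smul, LinearMap.smul_apply]
  rw [← spechtAct_spechtRep, h, map_sum, LinearMap.sum_apply]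
  simp only [map_smul, LinearMap.smul_apply]

/-- The block swap commutes with the diagonal of `S_k × S_k`, so it acts only through the factor in
`signBasis`, which is an eigenvector. -/
theorem tensorPermRep_blockSwap_adaptedBasis (y : BlockIndex d k) :
    tensorPermRep (k + k) d (blockSwap k) (adaptedBasis x v y) =
      ((y.1.2.2 : ℤ) : ℂ) • adaptedBasis x v y := by
  obtain ⟨l, i, a, b⟩ := y
  simp only [adaptedBasis_apply]
  have h : spechtRep l.1.1 (blockSwap k) (adaptedSpecht x l i b) =
      ((l.2.2 : ℤ) : ℂ) • adaptedSpecht x l i b := by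
    rw [adaptedSpecht, spechtAct_apply, asAlgebraHom_intertwine (r := diagRep (spechtRep l.1.1))
      (r' := diagRep (spechtRep l.1.1)), blockSwap_signBasis, map_smul]
    intro σ y
    rw [diagRep_apply, leftRep_rightRep, diagRep_apply, leftRep_rightRep, ← Module.End.mul_apply,
      ← Module.End.mul_apply, ← map_mul, ← map_mul, blockSwap_mul_youngInclusion]
  rw [← spechtAct_spechtRep, h, map_smul, LinearMap.smul_apply]

end AdaptedBasis


/-! ### Block matrices -/

section BlockMatrices

variable {d k : ℕ}

/-- A family of matrices, one for each block label. -/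
abbrev BlockFamily (d k : ℕ) : Type := ∀ l : BlockLabel d k, Matrix (Fin l.size) (Fin l.size) ℂ

/-- A family of matrices acting on the representations of `U(d)`. -/
abbrev WeylFamily (d k : ℕ) : Type :=
  ∀ μ : BoundedPartition (k + k) d, Matrix (Fin (weylDim d μ.1)) (Fin (weylDim d μ.1)) ℂ

/-- A family of matrices acting on the Specht modules. -/
abbrev SpechtFamily (k : ℕ) : Type :=
  ∀ ν : k.Partition, Matrix (Fin (spechtDim ν)) (Fin (spechtDim ν)) ℂ

variable (M M' : BlockFamily d k) (A A' : WeylFamily d k) (B B' : SpechtFamily k)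

theorem blockSum_apply_same (l : BlockLabel d k) (i j) :
    blockSum M A B ⟨l, i⟩ ⟨l, j⟩ =
      M l i.1 j.1 * (A l.1 i.2.1 j.2.1 * B l.2.1 i.2.2 j.2.2) := by
  rw [blockSum, Matrix.blockDiagonal'_apply_eq]; rfl

theorem blockSum_apply_of_ne {l l' : BlockLabel d k} (h : l ≠ l') (i j) :
    blockSum M A B ⟨l, i⟩ ⟨l', j⟩ = 0 := by
  rw [blockSum, Matrix.blockDiagonal'_apply_ne _ _ _ h]

theorem blockSum_mul : blockSum M A B * blockSum M' A' B' =
    blockSum (M * M') (A * A') (B * B') := by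
  rw [blockSum, blockSum, ← Matrix.blockDiagonal'_mul]
  simp only [← Matrix.mul_kronecker_mul]
  rfl

theorem blockSum_one : blockSum (1 : BlockFamily d k) 1 1 = 1 := by
  rw [blockSum]
  simp only [Pi.one_apply, Matrix.one_kronecker_one]
  exact Matrix.blockDiagonal'_one

theorem conjTranspose_blockSum : (blockSum M A B)ᴴ =
    blockSum (fun l => (M l)ᴴ) (fun μ => (A μ)ᴴ) (fun ν => (B ν)ᴴ) := by
  rw [blockSum, Matrix.blockDiagonal'_conjTranspose]
  simp only [Matrix.conjTranspose_kronecker]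
  rfl

theorem blockSum_mem_unitaryGroup {M : BlockFamily d k} {A : WeylFamily d k} {B : SpechtFamily k}
    (hM : ∀ l, M l ∈ Matrix.unitaryGroup _ ℂ) (hA : ∀ μ, A μ ∈ Matrix.unitaryGroup _ ℂ)
    (hB : ∀ ν, B ν ∈ Matrix.unitaryGroup _ ℂ) :
    blockSum M A B ∈ Matrix.unitaryGroup (BlockIndex d k) ℂ := by
  have h1 : (M * fun l => (M l)ᴴ) = 1 := funext fun l => Matrix.mem_unitaryGroup_iff.1 (hM l)
  have h2 : (A * fun l => (A l)ᴴ) = 1 := funext fun l => Matrix.mem_unitaryGroup_iff.1 (hA l)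
  have h3 : (B * fun l => (B l)ᴴ) = 1 := funext fun l => Matrix.mem_unitaryGroup_iff.1 (hB l)
  rw [Matrix.mem_unitaryGroup_iff, Matrix.star_eq_conjTranspose, conjTranspose_blockSum,
    blockSum_mul, h1, h2, h3, blockSum_one]

theorem blockSum_sum {ι : Type*} (s : Finset ι) (c : ι → ℂ) (B : ι → SpechtFamily k) :
    blockSum M A (fun ν => ∑ t ∈ s, c t • B t ν) = ∑ t ∈ s, c t • blockSum M A (B t) := by
  ext ⟨l, i⟩ ⟨l', j⟩
  rw [Matrix.sum_apply]
  by_cases h : l = l'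
  · subst h
    simp only [Matrix.smul_apply, blockSum_apply_same, Matrix.sum_apply, smul_eq_mul,
      Finset.mul_sum]
    exact Finset.sum_congr rfl fun _ _ => by ring
  · simp only [Matrix.smul_apply, blockSum_apply_of_ne _ _ _ h, smul_zero, Finset.sum_const_zero]

theorem posDef_blockDiagonal' {o : Type*} {n : o → Type*} [Fintype o] [DecidableEq o]
    [∀ i, Fintype (n i)] {N : ∀ i, Matrix (n i) (n i) ℂ} (h : ∀ i, (N i).PosDef) :
    (Matrix.blockDiagonal' N).PosDef := by
  classical
  refine Matrix.PosDef.of_dotProduct_mulVec_pos ?_ fun w hw => ?_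
  · rw [Matrix.IsHermitian, Matrix.blockDiagonal'_conjTranspose]
    simp only [(h _).1.eq]
  · have key : star w ⬝ᵥ Matrix.blockDiagonal' N *ᵥ w =
        ∑ i, star (fun j => w ⟨i, j⟩) ⬝ᵥ N i *ᵥ fun j => w ⟨i, j⟩ := by
      simp only [dotProduct, Matrix.mulVec, Fintype.sum_sigma]
      refine Finset.sum_congr rfl fun i _ => Finset.sum_congr rfl fun j _ => ?_
      congr 1
      rw [Finset.sum_eq_single i]
      · simp only [Matrix.blockDiagonal'_apply_eq]
      · intro i' _ hi
        simp [Matrix.blockDiagonal'_apply_ne _ _ _ (Ne.symm hi)]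
      · simp
    rw [key]
    obtain ⟨⟨i, j⟩, hij⟩ := Function.ne_iff.1 hw
    refine Finset.sum_pos' (fun i _ => (h i).posSemidef.dotProduct_mulVec_nonneg _)
      ⟨i, Finset.mem_univ _, (h i).dotProduct_mulVec_pos fun h0 => hij ?_⟩
    exact congrFun h0 j

theorem posDef_blockSum {M : BlockFamily d k} (hM : ∀ l, (M l).PosDef) :
    (blockSum M 1 1).PosDef :=
  posDef_blockDiagonal' fun l => (hM l).kronecker (Matrix.PosDef.one.kronecker Matrix.PosDef.one)

/-- A vector of the standard basis in every representation of `U(d)`. -/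
def weylIndex (μ : BoundedPartition (k + k) d) : Fin (weylDim d μ.1) := ⟨0, weylDim_pos μ.2⟩

/-- A vector of the standard basis in every Specht module. -/
def spechtIndex (ν : k.Partition) : Fin (spechtDim ν) := ⟨0, spechtDim_pos ν⟩

/-- The blocks of a matrix. -/
def blocks (X : Matrix (BlockIndex d k) (BlockIndex d k) ℂ) : BlockFamily d k := fun l =>
  X.submatrix (fun i => ⟨l, i, weylIndex l.1, spechtIndex l.2.1⟩)
    fun i => ⟨l, i, weylIndex l.1, spechtIndex l.2.1⟩

theorem blocks_blockSum : blocks (blockSum M 1 1) = M := by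
  funext l
  ext i j
  rw [blocks, Matrix.submatrix_apply, blockSum_apply_same]
  simp

theorem posDef_blocks {X : Matrix (BlockIndex d k) (BlockIndex d k) ℂ} (hX : X.PosDef)
    (l : BlockLabel d k) : (blocks X l).PosDef :=
  hX.submatrix fun i j h => by simpa using h

variable {M A B} {X : Matrix (BlockIndex d k) (BlockIndex d k) ℂ}

theorem blockSum_mul_apply (l : BlockLabel d k) (i) (y : BlockIndex d k) :
    (blockSum M A B * X) ⟨l, i⟩ y =
      ∑ j, M l i.1 j.1 * (A l.1 i.2.1 j.2.1 * B l.2.1 i.2.2 j.2.2) * X ⟨l, j⟩ y := by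
  rw [Matrix.mul_apply, Fintype.sum_sigma, Finset.sum_eq_single l]
  · simp only [blockSum_apply_same]
  · intro l' _ h
    simp only [blockSum_apply_of_ne _ _ _ (Ne.symm h), zero_mul, Finset.sum_const_zero]
  · simp

theorem mul_blockSum_apply (l : BlockLabel d k) (i) (y : BlockIndex d k) :
    (X * blockSum M A B) y ⟨l, i⟩ =
      ∑ j, X y ⟨l, j⟩ * (M l j.1 i.1 * (A l.1 j.2.1 i.2.1 * B l.2.1 j.2.2 i.2.2)) := by
  rw [Matrix.mul_apply, Fintype.sum_sigma, Finset.sum_eq_single l]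
  · simp only [blockSum_apply_same]
  · intro l' _ h
    simp only [blockSum_apply_of_ne _ _ _ h, mul_zero, Finset.sum_const_zero]
  · simp

/-- `X` commutes with the projection onto the blocks with the first label of `x`. -/
theorem eq_zero_of_commute_weyl (hA : ∀ A : WeylFamily d k, Commute (blockSum 1 A 1) X)
    {x y : BlockIndex d k} (h : x.1.1 ≠ y.1.1) : X x y = 0 := by
  classical
  obtain ⟨l, i, a, b⟩ := x
  obtain ⟨l', i', a', b'⟩ := y
  have h1 := congrFun (congrFun (hA (Pi.single l.1 1)).eq ⟨l, i, a, b⟩) ⟨l', i', a', b'⟩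
  rw [blockSum_mul_apply, mul_blockSum_apply] at h1
  simpa [Fintype.sum_prod_type, Matrix.one_apply, Pi.single_eq_of_ne (Ne.symm h)] using h1

theorem eq_zero_of_commute_specht (hB : ∀ B : SpechtFamily k, Commute (blockSum 1 1 B) X)
    {x y : BlockIndex d k} (h : x.1.2.1 ≠ y.1.2.1) : X x y = 0 := by
  classical
  obtain ⟨l, i, a, b⟩ := x
  obtain ⟨l', i', a', b'⟩ := y
  have h1 := congrFun (congrFun (hB (Pi.single l.2.1 1)).eq ⟨l, i, a, b⟩) ⟨l', i', a', b'⟩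
  rw [blockSum_mul_apply, mul_blockSum_apply] at h1
  simpa [Fintype.sum_prod_type, Matrix.one_apply, Pi.single_eq_of_ne (Ne.symm h)] using h1

theorem eq_zero_of_commute_sign
    (hs : Commute (blockSum (fun l => ((l.2.2 : ℤ) : ℂ) • 1) 1 1) X)
    {x y : BlockIndex d k} (h : x.1.2.2 ≠ y.1.2.2) : X x y = 0 := by
  classical
  obtain ⟨l, i, a, b⟩ := x
  obtain ⟨l', i', a', b'⟩ := y
  have h1 := congrFun (congrFun hs.eq ⟨l, i, a, b⟩) ⟨l', i', a', b'⟩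
  rw [blockSum_mul_apply, mul_blockSum_apply] at h1
  have h2 : ((l.2.2 : ℤ) : ℂ) * X ⟨l, i, a, b⟩ ⟨l', i', a', b'⟩ =
      ((l'.2.2 : ℤ) : ℂ) * X ⟨l, i, a, b⟩ ⟨l', i', a', b'⟩ := by
    simpa [Fintype.sum_prod_type, Matrix.one_apply, mul_comm] using h1
  by_contra h0
  have h3 := mul_right_cancel₀ h0 h2
  exact h (by exact_mod_cast h3)

/-- Commuting with the matrix unit at `(a, a₀)` makes `X` diagonal in this factor, with an entry
that does not depend on the basis vector. -/
theorem apply_of_commute_weyl (hA : ∀ A : WeylFamily d k, Commute (blockSum 1 A 1) X)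
    (l : BlockLabel d k) (i j : Fin l.size) (a a₀ a' : Fin (weylDim d l.1.1))
    (b b' : Fin (spechtDim l.2.1)) :
    X ⟨l, i, a₀, b⟩ ⟨l, j, a', b'⟩ = if a' = a₀ then X ⟨l, i, a, b⟩ ⟨l, j, a, b'⟩ else 0 := by
  classical
  have h1 := congrFun (congrFun (hA (Pi.single l.1 (Matrix.single a a₀ 1))).eq ⟨l, i, a, b⟩)
    ⟨l, j, a', b'⟩
  rw [blockSum_mul_apply, mul_blockSum_apply] at h1
  simpa [Fintype.sum_prod_type, Matrix.one_apply, Matrix.single_apply, ite_and, eq_comm] using h1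

theorem apply_of_commute_specht (hB : ∀ B : SpechtFamily k, Commute (blockSum 1 1 B) X)
    (l : BlockLabel d k) (i j : Fin l.size) (a a' : Fin (weylDim d l.1.1))
    (b b₀ b' : Fin (spechtDim l.2.1)) :
    X ⟨l, i, a, b₀⟩ ⟨l, j, a', b'⟩ = if b' = b₀ then X ⟨l, i, a, b⟩ ⟨l, j, a', b⟩ else 0 := by
  classical
  have h1 := congrFun (congrFun (hB (Pi.single l.2.1 (Matrix.single b b₀ 1))).eq ⟨l, i, a, b⟩)
    ⟨l, j, a', b'⟩
  rw [blockSum_mul_apply, mul_blockSum_apply] at h1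
  simpa [Fintype.sum_prod_type, Matrix.one_apply, Matrix.single_apply, ite_and, eq_comm] using h1

/-- The three assumptions remove the entries between different labels, and the first two make `X`
scalar on the `U(d)` and Specht factors. One fixed basis vector in each of these factors thus
suffices to read off the block. -/
theorem eq_blockSum_of_commute (hA : ∀ A : WeylFamily d k, Commute (blockSum 1 A 1) X)
    (hB : ∀ B : SpechtFamily k, Commute (blockSum 1 1 B) X)
    (hs : Commute (blockSum (fun l => ((l.2.2 : ℤ) : ℂ) • 1) 1 1) X) :
    X = blockSum (blocks X) 1 1 := by
  ext ⟨l, i, a, b⟩ ⟨l', j, a', b'⟩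
  by_cases h : l = l'
  · subst h
    rw [blockSum_apply_same, apply_of_commute_weyl hA l i j (weylIndex l.1) a a' b b',
      apply_of_commute_specht hB l i j _ _ (spechtIndex l.2.1) b b']
    simp only [blocks, Matrix.submatrix_apply, Pi.one_apply, Matrix.one_apply, eq_comm (a := a),
      eq_comm (a := b)]
    split_ifs <;> simp
  · rw [blockSum_apply_of_ne _ _ _ h]
    by_cases h1 : l.1 = l'.1
    · by_cases h2 : l.2.1 = l'.2.1
      · by_cases h3 : l.2.2 = l'.2.2
        · exact (h (Prod.ext h1 (Prod.ext h2 h3))).elim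
        · exact eq_zero_of_commute_sign hs h3
      · exact eq_zero_of_commute_specht hB h2
    · exact eq_zero_of_commute_weyl hA h1

end BlockMatrices


/-! ### The decomposition of the tensor power in coordinates -/

section Coordinates

variable {d k : ℕ}

theorem apply_basis_of_isMatrixForm {G V : Type*} [Group G] [AddCommGroup V] [Module ℂ V] {n : ℕ}
    {r : Representation ℂ G V} {π : G →* Matrix.unitaryGroup (Fin n) ℂ} {b : V ≃ₗ[ℂ] (Fin n → ℂ)}
    (hb : ∀ g v, b (r g v) = (π g : Matrix (Fin n) (Fin n) ℂ) *ᵥ b v) (g : G) (a : Fin n) :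
    r g (Module.Basis.ofEquivFun b a) = ∑ a', (π g).1 a' a • Module.Basis.ofEquivFun b a' := by
  apply b.injective
  rw [hb, map_sum]
  simp only [map_smul, Module.Basis.coe_ofEquivFun, LinearEquiv.apply_symm_apply,
    Matrix.mulVec_single_one]
  ext i
  simp [Finset.sum_apply, Pi.single_apply]

/-- Every family of matrices on the Specht modules is realised by the group algebra. -/
theorem exists_sum_eq_spechtFamily {ρ : ∀ ν : k.Partition,
      Equiv.Perm (Fin k) →* Matrix.unitaryGroup (Fin (spechtDim ν)) ℂ}
    (hρ : ∀ ν, IsMatrixForm (spechtRep ν) (ρ ν)) (B : SpechtFamily k) :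
    ∃ c : Equiv.Perm (Fin k) → ℂ, ∀ ν, ∑ σ, c σ • (ρ ν σ).1 = B ν := by
  choose β hβ using hρ
  let x : ∀ ν : k.Partition, Module.Basis (Fin (spechtDim ν)) ℂ (Specht ν) :=
    fun ν => Module.Basis.ofEquivFun (β ν)
  choose α hα using fun ν b => exists_spechtDual ((x ν).coord b)
  -- The element `x_{b'} e_ν α_b` acts as the matrix unit from `b` to `b'`: `e_ν α_b` sends the
  -- basis vector `b` to `e_ν` and the others to `0`, and `x_{b'} e_ν = x_{b'}`. On other Specht
  -- modules it is zero.
  let a : MonoidAlgebra ℂ (Equiv.Perm (Fin k)) := ∑ ν, ∑ b, ∑ b',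
    B ν b' b • (spechtVal ν (x ν b') * (youngIdempotent ν * α ν b))
  have ha : ∀ ν b, a • x ν b = ∑ b', B ν b' b • x ν b' := by
    intro ν b
    apply spechtVal_injective
    rw [map_smul, smul_eq_mul, Finset.sum_mul, map_sum, Finset.sum_eq_single ν, Finset.sum_mul,
      Finset.sum_eq_single b, Finset.sum_mul]
    · refine Finset.sum_congr rfl fun b' _ => ?_
      rw [smul_mul_assoc, mul_assoc, hα, Module.Basis.coord_apply, Module.Basis.repr_self,
        Finsupp.single_eq_same, one_smul, spechtVal_mul_youngIdempotent, spechtVal_smul]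
    · intro b₁ _ hb
      rw [Finset.sum_mul]
      refine Finset.sum_eq_zero fun b' _ => ?_
      rw [smul_mul_assoc, mul_assoc, hα, Module.Basis.coord_apply, Module.Basis.repr_self,
        Finsupp.single_eq_of_ne hb, zero_smul, mul_zero, smul_zero]
    · simp
    · intro ν' _ hν
      simp only [Finset.sum_mul]
      refine Finset.sum_eq_zero fun b₁ _ => Finset.sum_eq_zero fun b' _ => ?_
      rw [smul_mul_assoc, ← spechtVal_mul_youngIdempotent (x ν b), mul_assoc,
        ← mul_assoc _ (spechtVal ν (x ν b)), mul_assoc _ (α ν' b₁),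
        youngIdempotent_mul_mul_eq_zero hν, mul_zero, smul_zero]
    · simp
  refine ⟨fun σ => a.coeff σ, fun ν => ?_⟩
  ext b' b
  have h1 : a • x ν b = ∑ σ, a.coeff σ • spechtRep ν σ (x ν b) := by
    rw [← spechtRep_asAlgebraHom, Representation.asAlgebraHom_def, MonoidAlgebra.lift_apply,
      Finsupp.sum_fintype _ _ (by simp), LinearMap.sum_apply]
    rfl
  simp only [x, apply_basis_of_isMatrixForm (hβ ν), Finset.smul_sum, smul_smul] at h1
  rw [ha, Finset.sum_comm] at h1
  simp only [← Finset.sum_smul] at h1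
  have h2 := congrArg (fun y => (x ν).repr y b') h1
  simp only [x, map_sum, map_smul, Module.Basis.repr_self, Finsupp.coe_finsetSum, Finset.sum_apply,
    Finsupp.smul_apply, Finsupp.single_apply, smul_eq_mul, mul_ite, mul_one, mul_zero,
    Finset.sum_ite_eq', Finset.mem_univ, if_true] at h2
  rw [Matrix.sum_apply, h2]
  rfl

theorem sum_blockSum_smul {X : Type*} [AddCommGroup X] [Module ℂ X] (M : BlockFamily d k)
    (A : WeylFamily d k) (B : SpechtFamily k) (w : BlockIndex d k → X) (l : BlockLabel d k) (i) :
    ∑ y, blockSum M A B y ⟨l, i⟩ • w y =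
      ∑ j, (M l j.1 i.1 * (A l.1 j.2.1 i.2.1 * B l.2.1 j.2.2 i.2.2)) • w ⟨l, j⟩ := by
  rw [Fintype.sum_sigma, Finset.sum_eq_single l]
  · simp only [blockSum_apply_same]
  · intro l' _ h
    simp only [blockSum_apply_of_ne _ _ _ h, zero_smul, Finset.sum_const_zero]
  · simp

/-- The matrix whose columns are the vectors of a basis. -/
def columns {N β : Type*} [Fintype N] (w : Module.Basis β ℂ (N → ℂ)) : Matrix N β ℂ :=
  Matrix.of fun i y => w y i

theorem mul_columns {N β : Type*} [Fintype N] [Fintype β] {w : Module.Basis β ℂ (N → ℂ)}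
    {R : Matrix N N ℂ} {D : Matrix β β ℂ} (h : ∀ y, R *ᵥ w y = ∑ z, D z y • w z) :
    R * columns w = columns w * D := by
  ext i y
  have h1 := congrFun (h y) i
  rw [Finset.sum_apply] at h1
  simpa [Matrix.mul_apply, Matrix.mulVec, dotProduct, columns, mul_comm] using h1

theorem exists_columns_inverse {N β : Type*} [Fintype N] [DecidableEq N] [Fintype β]
    [DecidableEq β] (w : Module.Basis β ℂ (N → ℂ)) :
    ∃ G : Matrix β N ℂ, columns w * G = 1 ∧ G * columns w = 1 := by
  have h : columns w = (Pi.basisFun ℂ N).toMatrix w := by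
    ext i y
    simp [columns, Module.Basis.toMatrix_apply]
  rw [h]
  exact ⟨w.toMatrix (Pi.basisFun ℂ N), Module.Basis.toMatrix_mul_toMatrix_flip _ _,
    Module.Basis.toMatrix_mul_toMatrix_flip _ _⟩

/-- An operator that changes only the multiplicity spaces commutes with `S_{2k}`. Its matrix is thus
permutation invariant, as the double commutant property requires. -/
theorem exists_matrix_blockSum (x : ∀ ν : k.Partition, Module.Basis (Fin (spechtDim ν)) ℂ (Specht ν))
    (v : ∀ μ : (k + k).Partition,
      Module.Basis (Fin (weylDim d μ)) ℂ (multSpace (tensorPermRep (k + k) d) μ))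
    (A : WeylFamily d k) :
    ∃ Y : Matrix (Fin (k + k) → Fin d) (Fin (k + k) → Fin d) ℂ,
      Y * columns (adaptedBasis x v) = columns (adaptedBasis x v) * blockSum 1 A 1 ∧
      ∀ (σ : Equiv.Perm (Fin (k + k))) i j, Y (i ∘ σ) (j ∘ σ) = Y i j := by
  -- The default value `0` is harmless: for partitions with more than `d` parts these matrices are
  -- empty.
  let A' : ∀ μ : (k + k).Partition, Matrix (Fin (weylDim d μ)) (Fin (weylDim d μ)) ℂ := fun μ =>
    if h : Multiset.card μ.parts ≤ d then A ⟨μ, h⟩ else 0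
  have hA' : ∀ μ : BoundedPartition (k + k) d, A' μ.1 = A μ := fun μ => dif_pos μ.2
  obtain ⟨y, hy, hyσ⟩ := exists_isotypic_endomorphism (tensorPermRep (k + k) d) v A'
  have hY : ∀ u, LinearMap.toMatrix' y *ᵥ u = y u := fun u => by
    rw [← Matrix.toLin'_apply, Matrix.toLin'_toMatrix']
  refine ⟨LinearMap.toMatrix' y, mul_columns fun z => ?_, fun σ i j => ?_⟩
  · obtain ⟨l, i, a, b⟩ := z
    rw [sum_blockSum_smul, hY, adaptedBasis_apply, hy, hA']
    simp [Fintype.sum_prod_type, Matrix.one_apply, adaptedBasis_apply]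
  · have h1 : tensorPermRep (k + k) d σ (Pi.single (j ∘ σ) 1) = Pi.single j 1 := by
      ext i
      change (Pi.single (j ∘ σ) 1 : (Fin (k + k) → Fin d) → ℂ) (i ∘ σ) = _
      simp only [Pi.single_apply, σ.surjective.right_cancellable]
    have h2 := congrFun (hyσ σ (Pi.single (j ∘ σ) 1)) i
    rw [h1, ← hY, ← hY, Matrix.mulVec_single_one] at h2
    have h3 : LinearMap.toMatrix' y i j =
        (LinearMap.toMatrix' y *ᵥ Pi.single (j ∘ σ) 1) (i ∘ σ) := h2
    rw [h3, Matrix.mulVec_single_one]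
    rfl

theorem commute_of_intertwine {N β : Type*} [Fintype N] [DecidableEq N] [Fintype β]
    [DecidableEq β] {F : Matrix N β ℂ} {G : Matrix β N ℂ} (hFG : F * G = 1) (hGF : G * F = 1)
    {Y : Matrix N N ℂ} {D X : Matrix β β ℂ} (hY : Y * F = F * D) :
    Commute Y (F * X * G) ↔ Commute D X := by
  have h1 : Y * (F * X * G) = F * (D * X) * G := by
    rw [← Matrix.mul_assoc F, ← hY]; simp only [Matrix.mul_assoc]
  have h2 : F * X * G * Y = F * (X * D) * G := by
    calc F * X * G * Y = F * X * G * (Y * (F * G)) := by rw [hFG, Matrix.mul_one]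
      _ = F * X * (G * (Y * F)) * G := by simp only [Matrix.mul_assoc]
      _ = F * X * ((G * F) * D) * G := by rw [hY]; simp only [Matrix.mul_assoc]
      _ = _ := by rw [hGF, Matrix.one_mul]; simp only [Matrix.mul_assoc]
  rw [Commute, SemiconjBy, Commute, SemiconjBy, h1, h2]
  refine ⟨fun h => ?_, fun h => by rw [h]⟩
  have h3 : ∀ Z : Matrix β β ℂ, G * (F * Z * G) * F = Z := fun Z => by
    calc G * (F * Z * G) * F = G * F * Z * (G * F) := by simp only [Matrix.mul_assoc]
      _ = Z := by rw [hGF, Matrix.one_mul, Matrix.mul_one]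
  rw [← h3 (D * X), h, h3]

/-- The family of scalar matrices given by the signs of the labels. -/
abbrev signFamily (d k : ℕ) : BlockFamily d k := fun l => ((l.2.2 : ℤ) : ℂ) • 1

theorem permOp_blockSwap_mul_columns
    (x : ∀ ν : k.Partition, Module.Basis (Fin (spechtDim ν)) ℂ (Specht ν))
    (v : ∀ μ : (k + k).Partition,
      Module.Basis (Fin (weylDim d μ)) ℂ (multSpace (tensorPermRep (k + k) d) μ)) :
    permOp d (blockSwap k)⁻¹ * columns (adaptedBasis x v) =
      columns (adaptedBasis x v) * blockSum (signFamily d k) 1 1 := by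
  refine mul_columns ?_
  rintro ⟨l, i, a, b⟩
  rw [← tensorPermRep_apply, tensorPermRep_blockSwap_adaptedBasis, sum_blockSum_smul]
  simp [Fintype.sum_prod_type, Matrix.one_apply]

/-- The columns of `F` are the adapted basis. The last clause takes the place of Schur's lemma for
the representations of `U(d)`: commuting with the group already means commuting with all matrices on
these factors. -/
theorem exists_decomposition {π : ∀ μ : (k + k).Partition,
      Matrix.unitaryGroup (Fin d) ℂ →* Matrix.unitaryGroup (Fin (weylDim d μ)) ℂ}
    (hπ : ∀ μ, IsMatrixForm (weylRep d μ) (π μ))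
    {ρ : ∀ ν : k.Partition, Equiv.Perm (Fin k) →* Matrix.unitaryGroup (Fin (spechtDim ν)) ℂ}
    (hρ : ∀ ν, IsMatrixForm (spechtRep ν) (ρ ν)) :
    ∃ (F : Matrix (Fin (k + k) → Fin d) (BlockIndex d k) ℂ)
      (G : Matrix (BlockIndex d k) (Fin (k + k) → Fin d) ℂ), F * G = 1 ∧ G * F = 1 ∧
      (∀ g : Matrix.unitaryGroup (Fin d) ℂ, tensorPow (k + k) (g : Matrix (Fin d) (Fin d) ℂ) * F =
        F * blockSum 1 (fun μ => (π μ.1 g).1) 1) ∧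
      (∀ σ : Equiv.Perm (Fin k), permOp d (youngInclusion k (σ, σ))⁻¹ * F =
        F * blockSum 1 1 fun ν => (ρ ν σ).1) ∧
      permOp d (blockSwap k)⁻¹ * F = F * blockSum (signFamily d k) 1 1 ∧
      ∀ X : Matrix (BlockIndex d k) (BlockIndex d k) ℂ,
        (∀ g, Commute (blockSum 1 (fun μ => (π μ.1 g).1) 1) X) →
          ∀ A : WeylFamily d k, Commute (blockSum 1 A 1) X := by
  choose β hβ using hρ
  choose γ hγ using hπ
  let x : ∀ ν : k.Partition, Module.Basis (Fin (spechtDim ν)) ℂ (Specht ν) :=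
    fun ν => Module.Basis.ofEquivFun (β ν)
  have hsub : ∀ μ : (k + k).Partition,
      (weylSub d μ).toSubmodule = multSpace (tensorPermRep (k + k) d) μ :=
    fun μ => range_asAlgebraHom_youngSymmetrizer _ μ
  let v : ∀ μ : (k + k).Partition,
      Module.Basis (Fin (weylDim d μ)) ℂ (multSpace (tensorPermRep (k + k) d) μ) :=
    fun μ => (Module.Basis.ofEquivFun (γ μ)).map (LinearEquiv.ofEq _ _ (hsub μ))
  have hv : ∀ μ g a, tensorUnitaryRep (k + k) d g (v μ a) =
      ∑ a', (π μ g).1 a' a • (v μ a' : (Fin (k + k) → Fin d) → ℂ) := by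
    intro μ g a
    have h := congrArg Subtype.val (apply_basis_of_isMatrixForm (hγ μ) g a)
    rw [Submodule.coe_sum] at h
    exact h
  have hx : ∀ ν σ b, spechtRep ν σ (x ν b) = ∑ b', (ρ ν σ).1 b' b • x ν b' :=
    fun ν σ b => apply_basis_of_isMatrixForm (hβ ν) σ b
  clear_value x v
  set w := adaptedBasis x v with hw
  obtain ⟨G, hFG, hGF⟩ := exists_columns_inverse w
  have hgF : ∀ g : Matrix.unitaryGroup (Fin d) ℂ,
      tensorPow (k + k) (g : Matrix (Fin d) (Fin d) ℂ) * columns w =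
        columns w * blockSum 1 (fun μ => (π μ.1 g).1) 1 := by
    intro g
    refine mul_columns fun y => ?_
    obtain ⟨l, i, a, b⟩ := y
    rw [sum_blockSum_smul]
    refine (tensorUnitaryRep_adaptedBasis x v (hv l.1.1 g) i a b).trans ?_
    simp [Fintype.sum_prod_type, Matrix.one_apply, hw]
  refine ⟨columns w, G, hFG, hGF, hgF, fun σ => ?_, ?_, fun X hX A => ?_⟩
  · refine mul_columns fun y => ?_
    obtain ⟨l, i, a, b⟩ := y
    rw [sum_blockSum_smul, ← tensorPermRep_apply]
    have h := tensorPermRep_adaptedBasis_of_diag x v (P := (ρ l.2.1 σ).1) (hx l.2.1 σ) i a b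
    rw [hw, h]
    simp [Fintype.sum_prod_type, Matrix.one_apply]
  · exact permOp_blockSwap_mul_columns x v
  -- Transported by `F`, `X` commutes with all tensor powers of unitary matrices, hence with the
  -- permutation invariant `Y` that represents `A`.
  · obtain ⟨Y, hYF, hYperm⟩ := exists_matrix_blockSum x v A
    refine (commute_of_intertwine hFG hGF hYF).1 (commute_of_commute_tensorPow ?_ hYperm)
    intro g hg
    exact (commute_of_intertwine hFG hGF (hgF ⟨g, hg⟩)).2 (hX ⟨g, hg⟩)

end Coordinates


/-! ### Transport to the standard basis and the unitary decomposition -/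

section Transport

variable {d k : ℕ}

theorem doublePow_eq_submatrix (A : Matrix (Fin d) (Fin d) ℂ) :
    doublePow k A = (tensorPow (k + k) A).submatrix (Fin.appendEquiv k k) (Fin.appendEquiv k k) := by
  ext ⟨i, i'⟩ ⟨j, j'⟩
  simp [doublePow, tensorPow, Fin.appendEquiv, Fin.prod_univ_add, -Fin.natAdd_eq_addNat]

theorem append_eq_iff {α : Type*} {i i' : Fin k → α} {f : Fin (k + k) → α} :
    Fin.append i i' = f ↔ (∀ t, i t = f (Fin.castAdd k t)) ∧ ∀ t, i' t = f (Fin.natAdd k t) := by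
  constructor
  · rintro rfl
    exact ⟨fun t => (Fin.append_left _ _ t).symm, fun t => (Fin.append_right _ _ t).symm⟩
  · rintro ⟨h1, h2⟩
    funext t
    refine Fin.addCases (fun t => ?_) (fun t => ?_) t
    · rw [Fin.append_left, h1]
    · rw [Fin.append_right, h2]

theorem doublePerm_eq_submatrix (σ : Equiv.Perm (Fin k)) :
    doublePerm d σ = (permOp d (youngInclusion k (σ, σ))).submatrix
      (Fin.appendEquiv k k) (Fin.appendEquiv k k) := by
  ext ⟨i, i'⟩ ⟨j, j'⟩
  have h : Fin.append i i' = Fin.append j j' ∘ youngInclusion k (σ, σ) ↔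
      i = j ∘ σ ∧ i' = j' ∘ σ := by
    rw [append_eq_iff]
    simp only [Function.comp_apply, youngInclusion_castAdd, youngInclusion_natAdd,
      Fin.append_left, Fin.append_right, funext_iff]
  change (if i = j ∘ σ then (1 : ℂ) else 0) * (if i' = j' ∘ σ then 1 else 0) =
    if Fin.append i i' = Fin.append j j' ∘ youngInclusion k (σ, σ) then 1 else 0
  simp only [h, ite_and, ite_mul, one_mul, zero_mul]

theorem halfSwap_eq_submatrix :
    halfSwap d k = (permOp d (blockSwap k)).submatrix
      (Fin.appendEquiv k k) (Fin.appendEquiv k k) := by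
  ext ⟨i, i'⟩ ⟨j, j'⟩
  have h : Fin.append i i' = Fin.append j j' ∘ blockSwap k ↔ (i, i') = (j', j) := by
    rw [append_eq_iff]
    simp only [Function.comp_apply, blockSwap_castAdd, blockSwap_natAdd,
      Fin.append_left, Fin.append_right, Prod.mk.injEq, funext_iff]
  change (if (i, i') = (j', j) then (1 : ℂ) else 0) =
    if Fin.append i i' = Fin.append j j' ∘ blockSwap k then 1 else 0
  simp only [h]

theorem permOp_mem_unitaryGroup {n : ℕ} (σ : Equiv.Perm (Fin n)) :
    permOp d σ ∈ Matrix.unitaryGroup (Fin n → Fin d) ℂ := by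
  rw [Matrix.mem_unitaryGroup_iff, Matrix.star_eq_conjTranspose]
  ext i j
  rw [Matrix.mul_apply, Finset.sum_eq_single (i ∘ ⇑σ⁻¹)]
  · have h : (i ∘ ⇑σ⁻¹) ∘ ⇑σ = i := by ext; simp
    simp only [permOp, Matrix.conjTranspose_apply, Matrix.of_apply, h, Matrix.one_apply, if_true,
      one_mul, eq_comm (a := i)]
    split_ifs <;> simp
  · intro l _ hl
    have h : i ≠ l ∘ σ := by
      rintro rfl
      exact hl (by ext; simp)
    simp [permOp, h]
  · simp

theorem submatrix_mem_unitaryGroup {m n : Type*} [Fintype m] [DecidableEq m] [Fintype n]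
    [DecidableEq n] {A : Matrix n n ℂ} (hA : A ∈ Matrix.unitaryGroup n ℂ) (e : m ≃ n) :
    A.submatrix e e ∈ Matrix.unitaryGroup m ℂ := by
  rw [Matrix.mem_unitaryGroup_iff, Matrix.star_eq_conjTranspose] at hA ⊢
  rw [Matrix.conjTranspose_submatrix, Matrix.submatrix_mul_equiv, hA, Matrix.submatrix_one_equiv]

theorem submatrix_mul_submatrix_id {l m n : Type*} [Fintype l] [Fintype m] [Fintype n]
    (e : m ≃ n) {R : Matrix n n ℂ} {F : Matrix n l ℂ} {D : Matrix l l ℂ} (h : R * F = F * D) :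
    R.submatrix e e * F.submatrix e id = F.submatrix e id * D := by
  rw [Matrix.submatrix_mul_equiv, h]
  rfl

end Transport

/-! ### Conjugation by a unitary matrix with relabelled columns -/

section Conjugation

variable {m n : Type*} [Fintype n] [DecidableEq n]

/-- The matrix with given matrix `D` in the orthonormal basis of the columns of `U`, these being
relabelled by `e`. -/
def conjBy (e : m ≃ n) (U : Matrix.unitaryGroup n ℂ) (D : Matrix m m ℂ) : Matrix n n ℂ :=
  U.1 * Matrix.reindex e e D * U.1ᴴ

variable (e : m ≃ n) (U : Matrix.unitaryGroup n ℂ)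

theorem conjBy_mul [Fintype m] (D D' : Matrix m m ℂ) : conjBy e U D * conjBy e U D' = conjBy e U (D * D') := by
  have h : U.1ᴴ * U.1 = 1 := Matrix.mem_unitaryGroup_iff'.1 U.2
  have h1 : Matrix.reindex e e (D * D') = Matrix.reindex e e D * Matrix.reindex e e D' := by
    simp only [Matrix.reindex_apply, Matrix.submatrix_mul_equiv]
  calc _ = U.1 * Matrix.reindex e e D * (U.1ᴴ * U.1) * Matrix.reindex e e D' * U.1ᴴ := by
        simp only [conjBy, mul_assoc]
    _ = _ := by rw [h, mul_one, conjBy, h1]; simp only [mul_assoc]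

theorem conjBy_surjective (Φ : Matrix n n ℂ) : ∃ D, conjBy e U D = Φ := by
  have h : U.1 * U.1ᴴ = 1 := Matrix.mem_unitaryGroup_iff.1 U.2
  refine ⟨(Matrix.reindex e e).symm (U.1ᴴ * Φ * U.1), ?_⟩
  calc _ = U.1 * U.1ᴴ * Φ * (U.1 * U.1ᴴ) := by
        rw [conjBy, Equiv.apply_symm_apply]; simp only [mul_assoc]
    _ = Φ := by rw [h, one_mul, mul_one]

theorem conjBy_injective : Function.Injective (conjBy e U) := by
  intro D D' hD
  have h : U.1ᴴ * U.1 = 1 := Matrix.mem_unitaryGroup_iff'.1 U.2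
  have h1 : ∀ D, U.1ᴴ * conjBy e U D * U.1 = Matrix.reindex e e D := fun D => by
    calc _ = U.1ᴴ * U.1 * Matrix.reindex e e D * (U.1ᴴ * U.1) := by simp only [conjBy, mul_assoc]
      _ = _ := by rw [h, one_mul, mul_one]
  apply (Matrix.reindex e e).injective
  rw [← h1, hD, h1]

theorem commute_conjBy_iff [Fintype m] {D D' : Matrix m m ℂ} :
    Commute (conjBy e U D) (conjBy e U D') ↔ Commute D D' := by
  rw [Commute, SemiconjBy, conjBy_mul, conjBy_mul, (conjBy_injective e U).eq_iff]; rfl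

theorem posDef_conjBy_iff {D : Matrix m m ℂ} : (conjBy e U D).PosDef ↔ D.PosDef := by
  have hU : IsUnit U.1 := (Matrix.isUnit_iff_isUnit_det _).2 (Matrix.isUnit_det_of_left_inverse
    (Matrix.mem_unitaryGroup_iff'.1 U.2))
  rw [conjBy, ← Matrix.star_eq_conjTranspose, Matrix.IsUnit.posDef_star_right_conjugate_iff hU,
    Matrix.reindex_apply]
  refine ⟨fun h => ?_, fun h => h.submatrix e.symm.injective⟩
  have h1 := h.submatrix e.injective
  rwa [Matrix.submatrix_submatrix, Equiv.symm_comp_self, Matrix.submatrix_id_id] at h1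

/-- The unitary part of an invertible matrix `F` intertwines all pairs of unitary matrices that
`F` itself intertwines. -/
theorem exists_unitary_conjBy [Fintype m] [DecidableEq m] {F : Matrix n m ℂ} {G : Matrix m n ℂ} (hFG : F * G = 1)
    (hGF : G * F = 1) : ∃ (e : m ≃ n) (U : Matrix.unitaryGroup n ℂ),
      ∀ R ∈ Matrix.unitaryGroup n ℂ, ∀ D ∈ Matrix.unitaryGroup m ℂ, R * F = F * D →
        R = conjBy e U D := by
  -- Mutually inverse matrices are square, so the index sets have equal size; any bijection serves.
  let e : m ≃ n := Fintype.equivOfCardEq (Matrix.square_of_invertible F G hFG hGF).symm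
  have hF : IsUnit (F.submatrix id e.symm).det := Matrix.isUnit_det_of_right_inverse
    (B := G.submatrix e.symm id) (by
      rw [Matrix.submatrix_mul_equiv, hFG, Matrix.submatrix_id_id])
  obtain ⟨U, hU, h⟩ := exists_unitary_intertwiner hF
  refine ⟨e, ⟨U, hU⟩, fun R hR D hD hRD => h R hR _ (submatrix_mem_unitaryGroup hD e.symm) ?_⟩
  rw [Matrix.reindex_apply, Matrix.submatrix_mul_equiv, ← hRD]
  rfl

end Conjugation

/-! ### The unitary decomposition and its commutant -/

section Main

variable {d k : ℕ}

theorem signFamily_mem_unitaryGroup (l : BlockLabel d k) :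
    signFamily d k l ∈ Matrix.unitaryGroup (Fin l.size) ℂ := by
  have h : star ((l.2.2 : ℤ) : ℂ) = ((l.2.2 : ℤ) : ℂ) := by simp
  rw [Matrix.mem_unitaryGroup_iff, signFamily, star_smul, star_one, smul_mul_smul_comm, mul_one, h,
    units_sq_complex, one_smul]

theorem blockSum_signFamily_mem_unitaryGroup :
    blockSum (signFamily d k) 1 1 ∈ Matrix.unitaryGroup (BlockIndex d k) ℂ :=
  blockSum_mem_unitaryGroup (M := signFamily d k) (A := 1) (B := 1) signFamily_mem_unitaryGroup
    (fun _ => one_mem _) fun _ => one_mem _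

/-- The group operators and their block forms are all unitary, so the unitary part of `F`
intertwines them as well. The last clause concerns block coordinates only and is unaffected by this
replacement. -/
theorem exists_unitary_decomposition (d k : ℕ) :
    ∃ (π : ∀ μ : BoundedPartition (k + k) d,
          Matrix.unitaryGroup (Fin d) ℂ →* Matrix.unitaryGroup (Fin (weylDim d μ.1)) ℂ)
      (ρ : ∀ ν : k.Partition,
          Equiv.Perm (Fin k) →* Matrix.unitaryGroup (Fin (spechtDim ν)) ℂ)
      (e : BlockIndex d k ≃ TensorIndex d k) (U : Matrix.unitaryGroup (TensorIndex d k) ℂ),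
      (∀ μ, IsMatrixForm (weylRep d μ.1) (π μ)) ∧ (∀ ν, IsMatrixForm (spechtRep ν) (ρ ν)) ∧
      (∀ g : Matrix.unitaryGroup (Fin d) ℂ, doublePow k (g : Matrix (Fin d) (Fin d) ℂ) =
        conjBy e U (blockSum 1 (fun μ => (π μ g).1) 1)) ∧
      (∀ σ : Equiv.Perm (Fin k), doublePerm d σ⁻¹ =
        conjBy e U (blockSum 1 1 fun ν => (ρ ν σ).1)) ∧
      halfSwap d k = conjBy e U (blockSum (signFamily d k) 1 1) ∧
      ∀ X : Matrix (BlockIndex d k) (BlockIndex d k) ℂ,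
        (∀ g, Commute (blockSum 1 (fun μ => (π μ g).1) 1) X) →
          ∀ A : WeylFamily d k, Commute (blockSum 1 A 1) X := by
  choose π hπ using fun μ : (k + k).Partition => exists_unitary_weylRep d μ
  choose ρ hρ using fun ν : k.Partition => exists_unitary_spechtRep ν
  obtain ⟨F, G, hFG, hGF, hg, hσ, hs, hX⟩ := exists_decomposition hπ hρ
  let a := Fin.appendEquiv (α := Fin d) k k
  have hFG' : F.submatrix a id * G.submatrix id a = 1 := by
    have h := Matrix.submatrix_mul_equiv F G a (Equiv.refl _) a
    rw [hFG, Matrix.submatrix_one_equiv] at h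
    exact h
  have hGF' : G.submatrix id a * F.submatrix a id = 1 := by
    have h := Matrix.submatrix_mul_equiv G F id a id
    rw [hGF, Matrix.submatrix_id_id] at h
    exact h
  obtain ⟨e, U, hU⟩ := exists_unitary_conjBy hFG' hGF'
  refine ⟨fun μ => π μ.1, ρ, e, U, fun μ => hπ μ.1, hρ, fun g => ?_, fun σ => ?_, ?_, hX⟩
  · rw [doublePow_eq_submatrix]
    have h1 := submatrix_mul_submatrix_id a (hg g)
    have h2 : blockSum 1 (fun μ : BoundedPartition (k + k) d => (π μ.1 g).1) 1 ∈
        Matrix.unitaryGroup (BlockIndex d k) ℂ :=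
      blockSum_mem_unitaryGroup (fun _ => one_mem _) (fun μ => (π μ.1 g).2) fun _ => one_mem _
    have h3 := submatrix_mem_unitaryGroup (tensorPow_mem_unitaryGroup (k + k) g) a
    exact hU _ h3 _ h2 h1
  · rw [doublePerm_eq_submatrix]
    have h : youngInclusion k (σ⁻¹, σ⁻¹) = (youngInclusion k (σ, σ))⁻¹ :=
      map_inv (youngInclusion k) (σ, σ)
    rw [h]
    exact hU _ (submatrix_mem_unitaryGroup (permOp_mem_unitaryGroup _) _) _
      (blockSum_mem_unitaryGroup (fun _ => one_mem _) (fun _ => one_mem _) fun ν => (ρ ν σ).2)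
      (submatrix_mul_submatrix_id a (hσ σ))
  · rw [halfSwap_eq_submatrix]
    have h : blockSwap k = (blockSwap k)⁻¹ := (inv_eq_of_mul_eq_one_left blockSwap_mul_self).symm
    rw [h]
    exact hU _ (submatrix_mem_unitaryGroup (permOp_mem_unitaryGroup _) _) _
      blockSum_signFamily_mem_unitaryGroup (submatrix_mul_submatrix_id a hs)

/-- Any family on the Specht factors is a linear combination of the matrices of group elements, with
the same coefficients for all `ν`. -/
theorem commute_blockSum_specht {ρ : ∀ ν : k.Partition,
      Equiv.Perm (Fin k) →* Matrix.unitaryGroup (Fin (spechtDim ν)) ℂ}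
    (hρ : ∀ ν, IsMatrixForm (spechtRep ν) (ρ ν))
    {X : Matrix (BlockIndex d k) (BlockIndex d k) ℂ}
    (hX : ∀ σ, Commute (blockSum 1 1 fun ν => (ρ ν σ).1) X) (B : SpechtFamily k) :
    Commute (blockSum 1 1 B) X := by
  obtain ⟨c, hc⟩ := exists_sum_eq_spechtFamily hρ B
  have h : B = fun ν => ∑ σ, c σ • (ρ ν σ).1 := funext fun ν => (hc ν).symm
  rw [h, blockSum_sum 1 1 Finset.univ c fun σ ν => (ρ ν σ).1]
  exact Commute.sum_left _ _ _ fun σ _ => (hX σ).smul_left _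

theorem commute_blockSum_weyl_specht (M : BlockFamily d k) (A : WeylFamily d k)
    (B : SpechtFamily k) : Commute (blockSum 1 A B) (blockSum M 1 1) := by
  rw [Commute, SemiconjBy, blockSum_mul, blockSum_mul, one_mul, mul_one, one_mul, mul_one, one_mul,
    mul_one]

theorem commute_signFamily (M : BlockFamily d k) :
    Commute (blockSum (signFamily d k) 1 1) (blockSum M 1 1) := by
  have h : signFamily d k * M = M * signFamily d k := funext fun l => by simp [signFamily]
  rw [Commute, SemiconjBy, blockSum_mul, blockSum_mul, h]

end Main

end

theorem mainTheorem3 (d k : ℕ) :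
    -- the block sizes of the two signs add up to the sum of products of coefficients
    (∀ (μ : BoundedPartition (k + k) d) (ν : k.Partition),
      blockSize d μ.1 ν 1 + blockSize d μ.1 ν (-1) =
        ∑ p : BoundedPartition k d, ∑ q : BoundedPartition k d,
          branchingCoeff μ.1 p.1 q.1 * productCoeff ν p.1 q.1) ∧
    ∃ (π : ∀ μ : BoundedPartition (k + k) d,
          Matrix.unitaryGroup (Fin d) ℂ →* Matrix.unitaryGroup (Fin (weylDim d μ.1)) ℂ)
      (ρ : ∀ ν : k.Partition,
          Equiv.Perm (Fin k) →* Matrix.unitaryGroup (Fin (spechtDim ν)) ℂ)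
      (e : BlockIndex d k ≃ TensorIndex d k)
      (U : Matrix.unitaryGroup (TensorIndex d k) ℂ),
      (∀ μ, IsMatrixForm (weylRep d μ.1) (π μ)) ∧
      (∀ ν, IsMatrixForm (spechtRep ν) (ρ ν)) ∧
      -- the unitary matrix decomposes the action of `U(d) × S_k × ℤ/2` with the given labels
      (∀ g : Matrix.unitaryGroup (Fin d) ℂ,
        doublePow k (g : Matrix (Fin d) (Fin d) ℂ) =
          U.1 * Matrix.reindex e e
            (blockSum (fun _ => 1) (fun μ => (π μ g).1) (fun _ => 1)) * U.1ᴴ) ∧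
      (∀ σ : Equiv.Perm (Fin k),
        doublePerm d σ⁻¹ =
          U.1 * Matrix.reindex e e
            (blockSum (fun _ => 1) (fun _ => 1) (fun ν => (ρ ν σ).1)) * U.1ᴴ) ∧
      halfSwap d k =
        U.1 * Matrix.reindex e e
          (blockSum (fun l => ((l.2.2 : ℤ) : ℂ) • 1) (fun _ => 1) (fun _ => 1)) * U.1ᴴ ∧
      -- every invariant positive definite matrix comes from a unique family of blocks
      (∀ Φ : Matrix (TensorIndex d k) (TensorIndex d k) ℂ, Φ.PosDef → IsKFoldInvariant Φ →
        ∃! M : ∀ l : BlockLabel d k, Matrix (Fin l.size) (Fin l.size) ℂ,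
          (∀ l, (M l).PosDef) ∧
          Φ = U.1 * Matrix.reindex e e (blockSum M (fun _ => 1) (fun _ => 1)) * U.1ᴴ) ∧
      -- and every family of positive definite blocks occurs
      (∀ M : ∀ l : BlockLabel d k, Matrix (Fin l.size) (Fin l.size) ℂ,
        (∀ l, (M l).PosDef) →
          (U.1 * Matrix.reindex e e (blockSum M (fun _ => 1) (fun _ => 1)) * U.1ᴴ).PosDef ∧
          IsKFoldInvariant
            (U.1 * Matrix.reindex e e (blockSum M (fun _ => 1) (fun _ => 1)) * U.1ᴴ)) := by
  refine ⟨fun μ ν => blockSize_add μ.2 ν, ?_⟩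
  obtain ⟨π, ρ, e, U, hπ, hρ, hg, hσ, hs, hX⟩ := exists_unitary_decomposition d k
  -- In block coordinates invariance becomes commutation with the three families of block matrices.
  have inv : ∀ X, IsKFoldInvariant (conjBy e U X) ↔
      (∀ g, Commute (blockSum 1 (fun μ => (π μ g).1) 1) X) ∧
      (∀ σ, Commute (blockSum 1 1 fun ν => (ρ ν σ).1) X) ∧
      Commute (blockSum (signFamily d k) 1 1) X := by
    intro X
    refine and_congr ?_ (and_congr ?_ ?_)
    · rw [Subtype.forall' (p := fun g => g ∈ Matrix.unitaryGroup (Fin d) ℂ)]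
      exact forall_congr' fun g => by rw [hg, commute_conjBy_iff]
    -- The matrix `ρ σ` corresponds to `S_{σ⁻¹} ⊗ S_{σ⁻¹}`, so the quantifier is reindexed by
    -- inversion.
    · rw [← (Equiv.inv (Equiv.Perm (Fin k))).forall_congr_right]
      exact forall_congr' fun σ => by rw [Equiv.inv_apply, hσ, commute_conjBy_iff]
    · rw [hs, commute_conjBy_iff]
  refine ⟨π, ρ, e, U, hπ, hρ, hg, hσ, hs, fun Φ hΦ hinv => ?_, fun M hM => ?_⟩
  · obtain ⟨X, rfl⟩ := conjBy_surjective e U Φ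
    obtain ⟨h1, h2, h3⟩ := (inv X).1 hinv
    have hXM := eq_blockSum_of_commute (hX X h1) (commute_blockSum_specht hρ h2) h3
    refine ⟨blocks X, ⟨posDef_blocks ((posDef_conjBy_iff e U).1 hΦ), congrArg (conjBy e U) hXM⟩, ?_⟩
    rintro M ⟨-, hM⟩
    rw [conjBy_injective e U hM]
    exact (blocks_blockSum M).symm
  · exact ⟨(posDef_conjBy_iff e U).2 (posDef_blockSum hM), (inv _).2
      ⟨fun g => commute_blockSum_weyl_specht M _ _, fun σ => commute_blockSum_weyl_specht M _ _,
        commute_signFamily M⟩⟩
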